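/- Let $X$ be a finite set and let $f:2^X\to\mathbb R$ be submodular, i.e. $f(A\cap B)+f(A\cup B)\le f(A)+f(B)$ for all $A,B\subseteq X$. Let $$F(x)=\sum_{S\subseteq X} f(S)\prod_{i\in S}x_i\prod_{i\notin S}(1-x_i)\qquad (x\in[0,1]^X)$$ be its multilinear extension. Let $M=(X,\mathcal I)$ be a matroid and let $P(M)\subseteq[0,1]^X$ be the matroid polytope, the convex hull of the indicator vectors of the independent sets $S\in\mathcal I$. 1. For every $x\in P(M)$ there is an integral point $x'\in P(M)$ with $F(x')\ge F(x)$. 2. Consequently $F$ has no integrality gap relative to $P(M)$: the maximum of $F$ over $P(M)$ and the maximum of $F$ over the integral points of $P(M)$ both exist and are equal. 3. Such an $x'$ can be constructed from $x$ in polynomial time: there are one deterministic oracle algorithm and one polynomial $p$ such that, for every $n$, every submodular $f$ and every matroid $M$ on $X=\{0,\dots,n-1\}$, and every rational $x\in P(M)$ (given by the numerators and denominators of its coordinates, in binary), the algorithm halts within $p(n+\langle x\rangle)$ steps, where $\langle x\rangle$ is the binary length of $x$, and outputs an integral point $x'\in P(M)$ with $F(x')\ge F(x)$. The algorithm is a random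 access program on integers with logarithmic cost (each operation is charged the binary length of its operands and of its result). It has access to $M$ only through an independence oracle ("is $S\in\mathcal I$?") and to $f$ only through an oracle that compares values of $F$ ("is $F(y)\le F(z)$?" for rational points $y,z\in[0,1]^X$); a query is charged the binary length of the set or of the points asked about. -/

import Mathlib

/-! ## Submodular functions, multilinear extension, matroid polytope -/

/-- `f : 2^X → ℝ` is submodular. -/
def IsSubmodular {X : Type*} [DecidableEq X] (f : Finset X → ℝ) : Prop :=
  ∀ A B : Finset X, f (A ∩ B) + f (A ∪ B) ≤ f A + f B

/-- The multilinear extension of a set function: the expectation of `f S` when every `i` is put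
into `S` independently with probability `x i`. It is only used on the cube `[0,1]^X`. -/
def multilinearExtension {X : Type*} [Fintype X] [DecidableEq X] (f : Finset X → ℝ)
    (x : X → ℝ) : ℝ :=
  ∑ S : Finset X, f S * ((∏ i ∈ S, x i) * ∏ i ∈ Sᶜ, (1 - x i))

/-- The matroid polytope: the convex hull of the indicator vectors of the independent sets. -/
def matroidPolytope {X : Type*} (M : Matroid X) : Set (X → ℝ) :=
  convexHull ℝ {v : X → ℝ | ∃ S : Set X, M.Indep S ∧ v = S.indicator 1}

/-- All coordinates are integers. -/
def IsIntegralPoint {X : Type*} (x : X → ℝ) : Prop :=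
  ∀ i, ∃ k : ℤ, x i = k

/-- `F` has integrality gap `α` relative to `P`: the maximum of `F` over `P` and the maximum over
the integral points of `P` both exist, and the first is `α` times the second. -/
def HasIntegralityGap {X : Type*} (F : (X → ℝ) → ℝ) (P : Set (X → ℝ)) (α : ℝ) : Prop :=
  ∃ m m' : ℝ, IsGreatest (F '' P) m ∧ IsGreatest (F '' {x ∈ P | IsIntegralPoint x}) m' ∧
    m = α * m'

/-- No integrality gap: integrality gap one. -/
def HasNoIntegralityGap {X : Type*} (F : (X → ℝ) → ℝ) (P : Set (X → ℝ)) : Prop :=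
  HasIntegralityGap F P 1

/-! ## A machine model: integer random access programs with oracles and logarithmic cost -/

/-- Binary length of an integer, including a sign bit. -/
def bitLength (z : ℤ) : ℕ := Nat.size z.natAbs + 1

/-- Binary length of a rational number: numerator and denominator. -/
def ratLength (q : ℚ) : ℕ := bitLength q.num + bitLength q.den

/-- The memory of a program: integer variables and integer arrays, both named by numbers. -/
structure Memory where
  var : ℕ → ℤ
  arr : ℕ → ℕ → ℤ

/-- Assign the value `z` to the variable `v`. -/
def Memory.setVar (s : Memory) (v : ℕ) (z : ℤ) : Memory :=
  { s with var := Function.update s.var v z }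

/-- Store the value `z` in cell `i` of the array `k`. -/
def Memory.setArr (s : Memory) (k i : ℕ) (z : ℤ) : Memory :=
  { s with arr := Function.update s.arr k (Function.update (s.arr k) i z) }

/-- Integer expressions: literals, variables, array cells and arithmetic. -/
inductive Expr where
  | lit (c : ℤ) : Expr
  | var (v : ℕ) : Expr
  | arr (k : ℕ) (i : Expr) : Expr
  | add (a b : Expr) : Expr
  | sub (a b : Expr) : Expr
  | mul (a b : Expr) : Expr
  | div (a b : Expr) : Expr

/-- The value of an expression (`div` is integer division; a negative array index is read as
`0`). -/
def Expr.eval (s : Memory) : Expr → ℤ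
  | .lit c => c
  | .var v => s.var v
  | .arr k i => s.arr k (i.eval s).toNat
  | .add a b => a.eval s + b.eval s
  | .sub a b => a.eval s - b.eval s
  | .mul a b => a.eval s * b.eval s
  | .div a b => a.eval s / b.eval s

/-- The logarithmic cost of evaluating an expression: every node costs the binary length of its
value, so that an operation is charged for its operands and for its result. -/
def Expr.cost (s : Memory) : Expr → ℕ
  | .lit c => bitLength c
  | .var v => bitLength (s.var v)
  | .arr k i => i.cost s + bitLength (s.arr k (i.eval s).toNat)
  | .add a b => a.cost s + b.cost s + bitLength (a.eval s + b.eval s)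
  | .sub a b => a.cost s + b.cost s + bitLength (a.eval s - b.eval s)
  | .mul a b => a.cost s + b.cost s + bitLength (a.eval s * b.eval s)
  | .div a b => a.cost s + b.cost s + bitLength (a.eval s / b.eval s)

/-- Programs. The last two commands are the oracle queries:
`askIndep v k` asks whether the set of the `i` with a nonzero entry in array `k` is independent;
`askLe v p q p' q'` asks whether `F y ≤ F z`, where `y` and `z` are the points of the cube with the
rational coordinates `p[i] / q[i]` and `p'[i] / q'[i]`. The answer, `1` or `0`, is put into the
variable `v`. -/
inductive Program where
  | skip : Program
  | assign (v : ℕ) (e : Expr) : Program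
  | write (k : ℕ) (i e : Expr) : Program
  | seq (a b : Program) : Program
  | ifPos (e : Expr) (a b : Program) : Program
  | whilePos (e : Expr) (a : Program) : Program
  | askIndep (v k : ℕ) : Program
  | askLe (v p q p' q' : ℕ) : Program

/-- The set described by the array `k`. -/
def Memory.querySet (s : Memory) (n k : ℕ) : Set (Fin n) := {i | s.arr k i ≠ 0}

/-- The rational vector described by the arrays `p` (numerators) and `q` (denominators). -/
noncomputable def Memory.queryPoint (s : Memory) (n p q : ℕ) : Fin n → ℝ :=
  fun i => (s.arr p i : ℝ) / (s.arr q i : ℝ)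

/-- The binary length of the first `n` entries of the array `k`. -/
def Memory.arrLength (s : Memory) (n k : ℕ) : ℕ := ∑ i ∈ Finset.range n, bitLength (s.arr k i)

open Classical in
/-- The answer of the independence oracle. -/
noncomputable def indepAnswer {n : ℕ} (M : Matroid (Fin n)) (S : Set (Fin n)) : ℤ :=
  if M.Indep S then 1 else 0

open Classical in
/-- The answer of the comparison oracle for the multilinear extension `F` of `f`: whether
`F y ≤ F z`. A query with a point outside the cube `[0,1]^n`, the domain of `F`, is answered by
`0`. -/
noncomputable def leAnswer {n : ℕ} (f : Finset (Fin n) → ℝ) (y z : Fin n → ℝ) : ℤ :=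
  if y ∈ Set.Icc 0 1 ∧ z ∈ Set.Icc 0 1 ∧ multilinearExtension f y ≤ multilinearExtension f z
    then 1 else 0

/-- `Exec f M c s s' t`: with the oracles given by `f` and `M`, the program `c` started in the
memory `s` halts in the memory `s'` after time `t` (logarithmic cost; a query costs the length of
what is asked). -/
inductive Exec {n : ℕ} (f : Finset (Fin n) → ℝ) (M : Matroid (Fin n)) :
    Program → Memory → Memory → ℕ → Prop where
  | skip (s : Memory) : Exec f M .skip s s 1
  | assign (s : Memory) (v : ℕ) (e : Expr) :
      Exec f M (.assign v e) s (s.setVar v (e.eval s)) (e.cost s + 1)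
  | write (s : Memory) (k : ℕ) (i e : Expr) :
      Exec f M (.write k i e) s (s.setArr k (i.eval s).toNat (e.eval s)) (i.cost s + e.cost s + 1)
  | seq {s s₁ s₂ : Memory} {t₁ t₂ : ℕ} {a b : Program} :
      Exec f M a s s₁ t₁ → Exec f M b s₁ s₂ t₂ → Exec f M (.seq a b) s s₂ (t₁ + t₂ + 1)
  | ifTrue {s s₁ : Memory} {t : ℕ} {e : Expr} {a b : Program} :
      0 < e.eval s → Exec f M a s s₁ t → Exec f M (.ifPos e a b) s s₁ (e.cost s + t + 1)
  | ifFalse {s s₁ : Memory} {t : ℕ} {e : Expr} {a b : Program} :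
      ¬ 0 < e.eval s → Exec f M b s s₁ t → Exec f M (.ifPos e a b) s s₁ (e.cost s + t + 1)
  | whileTrue {s s₁ s₂ : Memory} {t₁ t₂ : ℕ} {e : Expr} {a : Program} :
      0 < e.eval s → Exec f M a s s₁ t₁ → Exec f M (.whilePos e a) s₁ s₂ t₂ →
        Exec f M (.whilePos e a) s s₂ (e.cost s + t₁ + t₂ + 1)
  | whileFalse {s : Memory} {e : Expr} {a : Program} :
      ¬ 0 < e.eval s → Exec f M (.whilePos e a) s s (e.cost s + 1)
  | askIndep (s : Memory) (v k : ℕ) :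
      Exec f M (.askIndep v k) s (s.setVar v (indepAnswer M (s.querySet n k)))
        (s.arrLength n k + 1)
  | askLe (s : Memory) (v p q p' q' : ℕ) :
      Exec f M (.askLe v p q p' q') s
        (s.setVar v (leAnswer f (s.queryPoint n p q) (s.queryPoint n p' q')))
        (s.arrLength n p + s.arrLength n q + s.arrLength n p' + s.arrLength n q' + 1)

/-- The input memory for `x ∈ ℚ^n`: variable `0` holds `n`, arrays `0` and `1` hold the numerators
and the denominators of `x`, everything else is `0`. -/
def inputMemory {n : ℕ} (x : Fin n → ℚ) : Memory where
  var := fun v => if v = 0 then (n : ℤ) else 0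
  arr := fun k i =>
    if h : i < n then
      (if k = 0 then (x ⟨i, h⟩).num else if k = 1 then ((x ⟨i, h⟩).den : ℤ) else 0)
    else 0

/-- The output of a run on `n` elements: the integral vector in array `2`. -/
noncomputable def outputPoint (n : ℕ) (s : Memory) : Fin n → ℝ := fun i => (s.arr 2 i : ℝ)

/-- The input length: `n` plus the binary length of `x`. -/
def inputLength {n : ℕ} (x : Fin n → ℚ) : ℕ := n + ∑ i, ratLength (x i)

/-! ## Binary lengths and syntactic cost bounds -/

/-! Along a direction `e_k - e_i` the extension `F` is a quadratic whose leading coefficient is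
minus its mixed second difference. For submodular `f` this difference is nonpositive, so `F` is
convex along the line, and of two opposite moves one does not decrease it
(`IsSubmodular.le_moveMass_or`). In a single coordinate `F` is affine.

Existence. Write `x` as a convex combination of independent sets and enlarge each to a base, which
gives a point `z ≥ x`. By affinity every coordinate can in turn be raised from `x i` to `z i` or
dropped to `0` without decreasing `F` (`exists_le_maskOut`). If `R` is the set of dropped
coordinates, `F` at the masked point is the extension of the submodular function `S ↦ f (S \ R)` at
`z`. There the bases are merged by swap rounding: for bases `A ≠ B`, symmetric exchange gives `i ∈ A
\ B` and `k ∈ B \ A` such that `A - i + k` and `B - k + i` are bases. The two exchanges move the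
point oppositely along `e_k - e_i`, so one of them is harmless, and either removes `i` from `A \ B`
(`exists_isBase_merge_two`). The last base `C` yields the independent set `C \ R`.

Algorithm. The same rounding works once a short combination of bases dominating `x` is known. In
integers scaled by a common denominator `D`, a push-relabel method finds one. It keeps a combination
`z` of bases and levels of the elements such that elements with excess have level `0` and an
exchange bringing in `v` for `u` climbs at most one level. A deficient element of highest level is
either pushed into a base in place of an element one level below, or lifted. A deficient element on
the top level would yield a violated rank inequality (`State.Inv.level_lt`). A polynomially bounded
potential drops in every round and also limits the number of bases.

Running time. If all cells stay below `U`, their lengths and all loop counts below `L`, then the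
time is at most a polynomial in `L` read off from the program text (`Program.bound`). Each program
thus needs only a proof of its postcondition, of boundedness and of its loop counts, organized by
`WP`. -/

theorem bitLength_le_of_natAbs_le {z : ℤ} {U : ℕ} (h : z.natAbs ≤ U) :
    bitLength z ≤ Nat.size U + 1 :=
  Nat.succ_le_succ (Nat.size_le_size h)

theorem Nat.size_add_le_add (a b : ℕ) : Nat.size (a + b) ≤ Nat.size a + Nat.size b + 1 := by
  rw [Nat.size_le]
  have ha := Nat.lt_size_self a
  have hb := Nat.lt_size_self b
  have h1 : 2 ^ a.size ≤ 2 ^ (a.size + b.size) := Nat.pow_le_pow_right (by norm_num) (by omega)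
  have h2 : 2 ^ b.size ≤ 2 ^ (a.size + b.size) := Nat.pow_le_pow_right (by norm_num) (by omega)
  rw [pow_succ]
  omega

theorem Nat.size_mul_le_add (a b : ℕ) : Nat.size (a * b) ≤ Nat.size a + Nat.size b := by
  rw [Nat.size_le, pow_add]
  exact Nat.mul_lt_mul'' (Nat.lt_size_self a) (Nat.lt_size_self b)

theorem bitLength_add_le (a b : ℤ) : bitLength (a + b) ≤ bitLength a + bitLength b := by
  have h := Nat.size_le_size (Int.natAbs_add_le a b)
  have := Nat.size_add_le_add a.natAbs b.natAbs
  unfold bitLength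
  omega

theorem bitLength_neg (a : ℤ) : bitLength (-a) = bitLength a := by
  simp [bitLength]

theorem bitLength_sub_le (a b : ℤ) : bitLength (a - b) ≤ bitLength a + bitLength b := by
  rw [sub_eq_add_neg, ← bitLength_neg b]
  exact bitLength_add_le a (-b)

theorem bitLength_mul_le (a b : ℤ) : bitLength (a * b) ≤ bitLength a + bitLength b := by
  have := Nat.size_mul_le_add a.natAbs b.natAbs
  unfold bitLength
  rw [Int.natAbs_mul]
  omega

theorem bitLength_div_le (a b : ℤ) : bitLength (a / b) ≤ bitLength a + bitLength b := by
  have h := Nat.size_le_size (Int.natAbs_ediv_le_natAbs a b)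
  unfold bitLength
  omega

/-- The cost of an expression is at most this polynomial in a bound for the binary length of the
memory cells. -/
noncomputable def Expr.bound : Expr → Polynomial ℕ
  | .lit c => Polynomial.C (bitLength c)
  | .var _ => Polynomial.X
  | .arr _ i => i.bound + Polynomial.X
  | .add a b => 2 * (a.bound + b.bound)
  | .sub a b => 2 * (a.bound + b.bound)
  | .mul a b => 2 * (a.bound + b.bound)
  | .div a b => 2 * (a.bound + b.bound)

/-- The cost of a program is at most this polynomial in `L` if the memory cells have binary length
at most `L`, there are at most `L` elements, and no loop makes more than `L` rounds. -/
noncomputable def Program.bound : Program → Polynomial ℕ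
  | .skip => 1
  | .assign _ e => e.bound + 1
  | .write _ i e => i.bound + e.bound + 1
  | .seq a b => a.bound + b.bound + 1
  | .ifPos e a b => e.bound + (a.bound + b.bound) + 1
  | .whilePos e a => (Polynomial.X + 1) * (e.bound + a.bound + 1)
  | .askIndep _ _ => Polynomial.X * Polynomial.X + 1
  | .askLe _ _ _ _ _ => 4 * (Polynomial.X * Polynomial.X) + 1

/-- All cells of the memory are at most `U` in absolute value. -/
def Memory.Bounded (U : ℕ) (s : Memory) : Prop :=
  (∀ v, (s.var v).natAbs ≤ U) ∧ ∀ k i, (s.arr k i).natAbs ≤ U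

theorem Expr.bitLength_eval_le_cost (s : Memory) (e : Expr) : bitLength (e.eval s) ≤ e.cost s := by
  cases e <;> simp [Expr.eval, Expr.cost]

/-- The length of a result is at most the sum of the operand lengths, hence of the operand costs;
this is where the factor 2 in `Expr.bound` comes from. -/
theorem Expr.cost_le_bound {U L : ℕ} (hL : Nat.size U + 1 ≤ L) {s : Memory} (hs : s.Bounded U)
    (e : Expr) : e.cost s ≤ e.bound.eval L := by
  have hv (v : ℕ) : bitLength (s.var v) ≤ L := (bitLength_le_of_natAbs_le (hs.1 v)).trans hL
  have ha (k i : ℕ) : bitLength (s.arr k i) ≤ L := (bitLength_le_of_natAbs_le (hs.2 k i)).trans hL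
  induction e with
  | lit c => simp [Expr.cost, Expr.bound]
  | var v => simpa [Expr.cost, Expr.bound] using hv v
  | arr k i ih =>
    have := ha k (i.eval s).toNat
    simp only [Expr.cost, Expr.bound, Polynomial.eval_add, Polynomial.eval_X]
    omega
  | add a b iha ihb =>
    have h := bitLength_add_le (a.eval s) (b.eval s)
    have h1 := a.bitLength_eval_le_cost s
    have h2 := b.bitLength_eval_le_cost s
    simp only [Expr.cost, Expr.bound, Polynomial.eval_mul, Polynomial.eval_add,
      Polynomial.eval_ofNat]
    omega
  | sub a b iha ihb =>
    have h := bitLength_sub_le (a.eval s) (b.eval s)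
    have h1 := a.bitLength_eval_le_cost s
    have h2 := b.bitLength_eval_le_cost s
    simp only [Expr.cost, Expr.bound, Polynomial.eval_mul, Polynomial.eval_add,
      Polynomial.eval_ofNat]
    omega
  | mul a b iha ihb =>
    have h := bitLength_mul_le (a.eval s) (b.eval s)
    have h1 := a.bitLength_eval_le_cost s
    have h2 := b.bitLength_eval_le_cost s
    simp only [Expr.cost, Expr.bound, Polynomial.eval_mul, Polynomial.eval_add,
      Polynomial.eval_ofNat]
    omega
  | div a b iha ihb =>
    have h := bitLength_div_le (a.eval s) (b.eval s)
    have h1 := a.bitLength_eval_le_cost s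
    have h2 := b.bitLength_eval_le_cost s
    simp only [Expr.cost, Expr.bound, Polynomial.eval_mul, Polynomial.eval_add,
      Polynomial.eval_ofNat]
    omega

theorem Memory.Bounded.arrLength_le {n U L : ℕ} (hL : Nat.size U + 1 ≤ L) (hn : n ≤ L)
    {s : Memory} (hs : s.Bounded U) (k : ℕ) : s.arrLength n k ≤ L * L := by
  refine (Finset.sum_le_card_nsmul _ _ L fun i _ =>
    (bitLength_le_of_natAbs_le (hs.2 k i)).trans hL).trans ?_
  simpa using Nat.mul_le_mul_right L hn

/-! ## Memory updates -/

@[simp] theorem Memory.setVar_var (s : Memory) (v : ℕ) (z : ℤ) (w : ℕ) :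
    (s.setVar v z).var w = if w = v then z else s.var w := by
  simp [Memory.setVar, Function.update_apply]

@[simp] theorem Memory.setVar_arr (s : Memory) (v : ℕ) (z : ℤ) : (s.setVar v z).arr = s.arr := rfl

@[simp] theorem Memory.setArr_var (s : Memory) (k i : ℕ) (z : ℤ) : (s.setArr k i z).var = s.var :=
  rfl

@[simp] theorem Memory.setArr_arr (s : Memory) (k i : ℕ) (z : ℤ) (k' i' : ℕ) :
    (s.setArr k i z).arr k' i' = if k' = k ∧ i' = i then z else s.arr k' i' := by
  by_cases hk : k' = k
  · subst hk
    simp [Memory.setArr, Function.update_apply]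
  · simp [Memory.setArr, hk]

theorem Memory.Bounded.setVar {U : ℕ} {s : Memory} (hs : s.Bounded U) (v : ℕ) {z : ℤ}
    (hz : z.natAbs ≤ U) : (s.setVar v z).Bounded U := by
  refine ⟨fun w => ?_, hs.2⟩
  rw [Memory.setVar_var]
  split_ifs
  exacts [hz, hs.1 w]

theorem Memory.Bounded.setArr {U : ℕ} {s : Memory} (hs : s.Bounded U) (k i : ℕ) {z : ℤ}
    (hz : z.natAbs ≤ U) : (s.setArr k i z).Bounded U := by
  refine ⟨hs.1, fun k' i' => ?_⟩
  rw [Memory.setArr_arr]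
  split_ifs
  exacts [hz, hs.2 k' i']

/-- The variables that a program assigns to. -/
def Program.modVar : Program → ℕ → Bool
  | .skip, _ => false
  | .assign v _, w => w == v
  | .write _ _ _, _ => false
  | .seq a b, w => a.modVar w || b.modVar w
  | .ifPos _ a b, w => a.modVar w || b.modVar w
  | .whilePos _ a, w => a.modVar w
  | .askIndep v _, w => w == v
  | .askLe v _ _ _ _, w => w == v

/-- The arrays that a program writes to. -/
def Program.modArr : Program → ℕ → Bool
  | .skip, _ => false
  | .assign _ _, _ => false
  | .write k _ _, w => w == k
  | .seq a b, w => a.modArr w || b.modArr w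
  | .ifPos _ a b, w => a.modArr w || b.modArr w
  | .whilePos _ a, w => a.modArr w
  | .askIndep _ _, _ => false
  | .askLe _ _ _ _ _, _ => false

/-- The memory `s'` differs from `s` only in places that the program `c` may change. -/
structure Frame (c : Program) (s s' : Memory) : Prop where
  var : ∀ v, c.modVar v = false → s'.var v = s.var v
  arr : ∀ k, c.modArr k = false → s'.arr k = s.arr k

theorem Frame.refl (c : Program) (s : Memory) : Frame c s s := ⟨fun _ _ => rfl, fun _ _ => rfl⟩

theorem Frame.trans {c : Program} {s s' s'' : Memory} (h : Frame c s s') (h' : Frame c s' s'') :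
    Frame c s s'' :=
  ⟨fun v hv => (h'.var v hv).trans (h.var v hv), fun k hk => (h'.arr k hk).trans (h.arr k hk)⟩

theorem Frame.mono {c c' : Program} {s s' : Memory} (h : Frame c s s')
    (hv : ∀ v, c'.modVar v = false → c.modVar v = false)
    (ha : ∀ k, c'.modArr k = false → c.modArr k = false) : Frame c' s s' :=
  ⟨fun v hv' => h.var v (hv v hv'), fun k hk => h.arr k (ha k hk)⟩

/-- Since `modVar` and `modArr` compute, preservation of a given cell by a concrete program becomes
`hf.var v rfl` or `hf.arr k rfl`. -/
theorem Exec.frame {n : ℕ} {f : Finset (Fin n) → ℝ} {M : Matroid (Fin n)} {c : Program}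
    {s s' : Memory} {t : ℕ} (h : Exec f M c s s' t) : Frame c s s' := by
  induction h with
  | skip s => exact Frame.refl _ _
  | assign s v e => exact ⟨fun w hw => by simp_all [Program.modVar], fun k _ => rfl⟩
  | write s k i e =>
    refine ⟨fun w _ => rfl, fun k' hk' => funext fun i' => ?_⟩
    simp_all [Program.modArr]
  | seq _ _ ih₁ ih₂ =>
    exact (ih₁.mono (by simp +contextual [Program.modVar]) (by simp +contextual [Program.modArr])).trans
      (ih₂.mono (by simp +contextual [Program.modVar]) (by simp +contextual [Program.modArr]))
  | ifTrue _ _ ih =>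
    exact ih.mono (by simp +contextual [Program.modVar]) (by simp +contextual [Program.modArr])
  | ifFalse _ _ ih =>
    exact ih.mono (by simp +contextual [Program.modVar]) (by simp +contextual [Program.modArr])
  | whileTrue _ _ _ ih₁ ih₂ =>
    exact (ih₁.mono (by simp [Program.modVar]) (by simp [Program.modArr])).trans ih₂
  | whileFalse => exact Frame.refl _ _
  | askIndep s v k => exact ⟨fun w hw => by simp_all [Program.modVar], fun k _ => rfl⟩
  | askLe s v p q p' q' => exact ⟨fun w hw => by simp_all [Program.modVar], fun k _ => rfl⟩

/-! ## Weakest preconditions with time bounds -/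

/-- `n` elements, memory cells of absolute value at most `U` and binary length at most `L`, and
loops of at most `L` rounds. -/
structure Bounds (n U L : ℕ) : Prop where
  size_le : Nat.size U + 1 ≤ L
  mul_le : L * (n + 1) ≤ U
  card_le : n ≤ L

theorem Bounds.one_le {n U L : ℕ} (h : Bounds n U L) : 1 ≤ U :=
  (Nat.mul_le_mul (show 1 ≤ L by have := h.size_le; omega) (show 1 ≤ n + 1 by omega)).trans h.mul_le

theorem Bounds.card_le_bound {n U L : ℕ} (h : Bounds n U L) : n ≤ U :=
  (Nat.mul_le_mul (show 1 ≤ L by have := h.size_le; omega) (show n ≤ n + 1 by omega)).trans' (by omega)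
    |>.trans h.mul_le

theorem Bounds.length_le_bound {n U L : ℕ} (h : Bounds n U L) : L ≤ U :=
  (Nat.le_mul_of_pos_right L (Nat.succ_pos n)).trans h.mul_le

/-- Started in the memory `s`, the program `c` halts within its time bound in a memory with the
property `Q`, and the memory stays bounded. -/
def WP {n : ℕ} (f : Finset (Fin n) → ℝ) (M : Matroid (Fin n)) (U L : ℕ) (c : Program) (s : Memory)
    (Q : Memory → Prop) : Prop :=
  Bounds n U L → s.Bounded U →
    ∃ s' t, Exec f M c s s' t ∧ t ≤ c.bound.eval L ∧ s'.Bounded U ∧ Q s'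

section WPRules

variable {n : ℕ} {f : Finset (Fin n) → ℝ} {M : Matroid (Fin n)} {U L : ℕ} {s : Memory}
  {Q : Memory → Prop}

/-- The frame and the boundedness of the final memory come for free here, so specifications need to
mention only what changes. -/
theorem WP.mono {c : Program} {Q' : Memory → Prop} (h : WP f M U L c s Q')
    (hQ : ∀ s', Frame c s s' → s'.Bounded U → Q' s' → Q s') : WP f M U L c s Q := by
  intro hB hs
  obtain ⟨s', t, he, ht, hs', hQ'⟩ := h hB hs
  exact ⟨s', t, he, ht, hs', hQ s' he.frame hs' hQ'⟩

theorem WP.skip (h : Q s) : WP f M U L .skip s Q :=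
  fun _ hs => ⟨s, 1, .skip s, by simp [Program.bound], hs, h⟩

theorem WP.assign {v : ℕ} {e : Expr} (he : s.Bounded U → (e.eval s).natAbs ≤ U)
    (h : Q (s.setVar v (e.eval s))) : WP f M U L (.assign v e) s Q :=
  fun hB hs => ⟨_, _, .assign s v e, by
    simpa [Program.bound] using e.cost_le_bound hB.size_le hs, hs.setVar v (he hs), h⟩

theorem WP.write {k : ℕ} {i e : Expr} (he : s.Bounded U → (e.eval s).natAbs ≤ U)
    (h : Q (s.setArr k (i.eval s).toNat (e.eval s))) : WP f M U L (.write k i e) s Q :=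
  fun hB hs => ⟨_, _, .write s k i e, by
    have h1 := e.cost_le_bound hB.size_le hs
    have h2 := i.cost_le_bound hB.size_le hs
    simp only [Program.bound, Polynomial.eval_add, Polynomial.eval_one]
    omega, hs.setArr k _ (he hs), h⟩

theorem WP.seq {a b : Program} (h : WP f M U L a s fun s' => WP f M U L b s' Q) :
    WP f M U L (.seq a b) s Q := by
  intro hB hs
  obtain ⟨s₁, t₁, he₁, ht₁, hs₁, h₁⟩ := h hB hs
  obtain ⟨s₂, t₂, he₂, ht₂, hs₂, h₂⟩ := h₁ hB hs₁
  refine ⟨s₂, _, .seq he₁ he₂, ?_, hs₂, h₂⟩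
  simp only [Program.bound, Polynomial.eval_add, Polynomial.eval_one]
  omega

theorem WP.ifPos {e : Expr} {a b : Program} (ha : 0 < e.eval s → WP f M U L a s Q)
    (hb : ¬ 0 < e.eval s → WP f M U L b s Q) : WP f M U L (.ifPos e a b) s Q := by
  intro hB hs
  have hc := e.cost_le_bound hB.size_le hs
  by_cases h : 0 < e.eval s
  · obtain ⟨s', t, he, ht, hs', hQ⟩ := ha h hB hs
    refine ⟨s', _, .ifTrue h he, ?_, hs', hQ⟩
    simp only [Program.bound, Polynomial.eval_add, Polynomial.eval_one]
    omega
  · obtain ⟨s', t, he, ht, hs', hQ⟩ := hb h hB hs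
    refine ⟨s', _, .ifFalse h he, ?_, hs', hQ⟩
    simp only [Program.bound, Polynomial.eval_add, Polynomial.eval_one]
    omega

theorem WP.askIndep {v k : ℕ} (h : Q (s.setVar v (indepAnswer M (s.querySet n k)))) :
    WP f M U L (.askIndep v k) s Q :=
  fun hB hs => ⟨_, _, .askIndep s v k, by
    simpa [Program.bound] using hs.arrLength_le hB.size_le hB.card_le k,
    hs.setVar v (by
      have := hB.one_le
      unfold indepAnswer
      split_ifs <;> simp [this]), h⟩

theorem WP.askLe {v p q p' q' : ℕ}
    (h : Q (s.setVar v (leAnswer f (s.queryPoint n p q) (s.queryPoint n p' q')))) :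
    WP f M U L (.askLe v p q p' q') s Q :=
  fun hB hs => ⟨_, _, .askLe s v p q p' q', by
    have h1 := hs.arrLength_le hB.size_le hB.card_le p
    have h2 := hs.arrLength_le hB.size_le hB.card_le q
    have h3 := hs.arrLength_le hB.size_le hB.card_le p'
    have h4 := hs.arrLength_le hB.size_le hB.card_le q'
    simp only [Program.bound, Polynomial.eval_add, Polynomial.eval_one, Polynomial.eval_mul,
      Polynomial.eval_X, Polynomial.eval_ofNat]
    omega,
    hs.setVar v (by
      have := hB.one_le
      unfold leAnswer
      split_ifs <;> simp [this]), h⟩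

/-- A loop whose variant, the index of the invariant, decreases in every round and is at most `L` in
the beginning. -/
theorem WP.whilePos {e : Expr} {a : Program} (Inv : ℕ → Memory → Prop) {m : ℕ}
    (h₀ : Inv m s) (hm : m ≤ L)
    (hstep : ∀ k s, Inv k s → 0 < e.eval s → WP f M U L a s fun s' => ∃ k' < k, Inv k' s')
    (hQ : ∀ k s, Inv k s → ¬ 0 < e.eval s → Q s) : WP f M U L (.whilePos e a) s Q := by
  intro hB hs
  -- Induction on an upper bound `N` of the variant instead of the variant itself, because a round
  -- may lower the variant by more than one.
  suffices H : ∀ N k s, k ≤ N → s.Bounded U → Inv k s → ∃ s' t, Exec f M (.whilePos e a) s s' t ∧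
      t ≤ (N + 1) * (e.bound.eval L + a.bound.eval L + 1) ∧ s'.Bounded U ∧ Q s' by
    obtain ⟨s', t, he, ht, h⟩ := H L m s hm hs h₀
    exact ⟨s', t, he, by simpa [Program.bound] using ht, h⟩
  intro N
  induction N with
  | zero =>
    intro k s hk hs hI
    have hc := e.cost_le_bound hB.size_le hs
    by_cases h : 0 < e.eval s
    · obtain ⟨s₁, t₁, -, -, -, k', hlt, -⟩ := hstep k s hI h hB hs
      omega
    · exact ⟨s, _, .whileFalse h, by omega, hs, hQ k s hI h⟩
  | succ N ih =>
    intro k s hk hs hI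
    have hc := e.cost_le_bound hB.size_le hs
    by_cases h : 0 < e.eval s
    · obtain ⟨s₁, t₁, he₁, ht₁, hs₁, k', hlt, hI₁⟩ := hstep k s hI h hB hs
      obtain ⟨s', t, he, ht, hs', hQ'⟩ := ih k' s₁ (by omega) hs₁ hI₁
      refine ⟨s', _, .whileTrue h he₁ he, ?_, hs', hQ'⟩
      rw [add_mul (N + 1)]
      omega
    · refine ⟨s, _, .whileFalse h, ?_, hs, hQ k s hI h⟩
      have : 1 * (e.bound.eval L + a.bound.eval L + 1) ≤
          (N + 1 + 1) * (e.bound.eval L + a.bound.eval L + 1) := Nat.mul_le_mul_right _ (by omega)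
      omega

/-- `for i in [0, b) do a`. -/
def Program.forRange (i b : ℕ) (a : Program) : Program :=
  .seq (.assign i (.lit 0))
    (.whilePos (.sub (.var b) (.var i)) (.seq a (.assign i (.add (.var i) (.lit 1)))))

/-- The variant is `m - k`. The body may not touch the counter or the limit, so both are known in
every round. The invariant is demanded after the counter update because the loop writes the counter
last. -/
theorem WP.forRange {i b m : ℕ} {a : Program} (Inv : ℕ → Memory → Prop) (hb : s.var b = m)
    (hmL : m ≤ L) (hmU : m ≤ U) (hia : a.modVar i = false) (hba : a.modVar b = false)
    (hbi : b ≠ i) (h₀ : Inv 0 (s.setVar i 0))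
    (hstep : ∀ k < m, ∀ s', Frame (Program.forRange i b a) s s' → s'.var i = k → Inv k s' →
      WP f M U L a s' fun s'' => Inv (k + 1) (s''.setVar i (k + 1 : ℕ)))
    (hQ : ∀ s', Frame (Program.forRange i b a) s s' → s'.Bounded U → Inv m s' → Q s') :
    WP f M U L (Program.forRange i b a) s Q := by
  suffices H : WP f M U L (Program.forRange i b a) s fun s' => Inv m s' from H.mono hQ
  refine .seq (.assign (by simp [Expr.eval]) ?_)
  have hfr : Frame (Program.forRange i b a) s (s.setVar i 0) :=
    ⟨fun w hw => by simp_all [Program.modVar, Program.forRange], fun _ _ => rfl⟩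
  refine .whilePos (fun l s' => Frame (Program.forRange i b a) s s' ∧
    ∃ k ≤ m, l = m - k ∧ s'.var i = k ∧ Inv k s') (m := m)
    ⟨by simpa [Expr.eval] using hfr, 0, by omega, by simp, by simp [Expr.eval],
      by simpa [Expr.eval] using h₀⟩ hmL ?_ ?_
  · rintro l s' ⟨hf, k, hk, rfl, hki, hI⟩ hpos
    have hb' : s'.var b = m := by
      rw [hf.var b (by simp [Program.forRange, Program.modVar, hba, hbi]), hb]
    simp only [Expr.eval, hb', hki] at hpos
    refine .seq ((hstep k (by omega) s' hf hki hI).mono fun s'' hf' hs'' hI' => ?_)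
    have hi : s''.var i = k := by rw [hf'.var i hia, hki]
    refine .assign (by simp only [Expr.eval, hi]; omega) ?_
    have hev : Expr.eval s'' (.add (.var i) (.lit 1)) = ((k + 1 : ℕ) : ℤ) := by
      simp [Expr.eval, hi]
    rw [hev]
    refine ⟨m - (k + 1), by omega, hf.trans ⟨fun w hw => ?_, fun w hw => ?_⟩, k + 1, by omega, rfl,
      by simp, hI'⟩
    · simp only [Program.forRange, Program.modVar, Bool.or_eq_false_iff, beq_eq_false_iff_ne] at hw
      simp [hw.1, hf'.var w hw.2.1]
    · simp only [Program.forRange, Program.modArr, Bool.or_eq_false_iff] at hw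
      simp [hf'.arr w hw.2.1]
  · rintro l s' ⟨hf, k, hk, -, hki, hI⟩ hpos
    have hb' : s'.var b = m := by
      rw [hf.var b (by simp [Program.forRange, Program.modVar, hba, hbi]), hb]
    simp only [Expr.eval, hb', hki] at hpos
    obtain rfl : k = m := by omega
    exact hI

end WPRules

/-! ## The multilinear extension -/

/-- Coordinates fixed at zero are absorbed into the set function (see
`multilinearExtension_maskOut`), so swap rounding applies unchanged to masked points. -/
theorem IsSubmodular.sdiff {X : Type*} [DecidableEq X] {f : Finset X → ℝ} (hf : IsSubmodular f) (R : Finset X) :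
    IsSubmodular fun S => f (S \ R) := fun A B => by
  have h := hf (A \ R) (B \ R)
  have h1 : A \ R ∩ (B \ R) = (A ∩ B) \ R := by
    ext i
    simp only [Finset.mem_inter, Finset.mem_sdiff]
    tauto
  have h2 : A \ R ∪ B \ R = (A ∪ B) \ R := by
    ext i
    simp only [Finset.mem_union, Finset.mem_sdiff]
    tauto
  rwa [h1, h2] at h

section MultilinearExtension

variable {X : Type*} [Fintype X] [DecidableEq X]

/-- The probability weight of a set `t` not containing `i`, without the factor of `i`. -/
def weightAway (x : X → ℝ) (i : X) (t : Finset X) : ℝ :=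
  (∏ j ∈ t, x j) * ∏ j ∈ Finset.univ.erase i \ t, (1 - x j)

/-- Conditioning on whether `i` is drawn: the sets are paired as `t` and `insert i t`. -/
theorem multilinearExtension_eq_sum_weightAway (f : Finset X → ℝ) (x : X → ℝ) (i : X) :
    multilinearExtension f x = ∑ t ∈ (Finset.univ.erase i).powerset,
      weightAway x i t * ((1 - x i) * f t + x i * f (insert i t)) := by
  have hi : i ∉ Finset.univ.erase i := Finset.notMem_erase i _
  unfold multilinearExtension
  have hsum := Finset.sum_powerset_insert hi
    fun S => f S * ((∏ j ∈ S, x j) * ∏ j ∈ Sᶜ, (1 - x j))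
  rw [Finset.insert_erase (Finset.mem_univ i), Finset.powerset_univ] at hsum
  rw [hsum, ← Finset.sum_add_distrib]
  refine Finset.sum_congr rfl fun t ht => ?_
  have hit : i ∉ t := fun h => hi (Finset.mem_powerset.1 ht h)
  have h1 : tᶜ = insert i (Finset.univ.erase i \ t) := by
    ext j
    by_cases hj : j = i <;> simp [hj, hit]
  have h2 : (insert i t)ᶜ = Finset.univ.erase i \ t := by
    ext j
    by_cases hj : j = i <;> simp [hj]
  rw [h1, h2, Finset.prod_insert hit, Finset.prod_insert (by simp), weightAway]
  ring

theorem weightAway_update (x : X → ℝ) (i : X) (c : ℝ) {t : Finset X}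
    (ht : t ∈ (Finset.univ.erase i).powerset) :
    weightAway (Function.update x i c) i t = weightAway x i t := by
  have hit : i ∉ t := fun h => Finset.notMem_erase i _ (Finset.mem_powerset.1 ht h)
  unfold weightAway
  congr 1
  · exact Finset.prod_congr rfl fun j hj => by
      rw [Function.update_of_ne (ne_of_mem_of_not_mem hj hit)]
  · exact Finset.prod_congr rfl fun j hj => by
      rw [Function.update_of_ne (by simp at hj; exact hj.1)]

/-- Fixing a coordinate changes the set function and not the point, so inequalities between such
values reduce to pointwise inequalities of set functions. -/
theorem multilinearExtension_update_zero (f : Finset X → ℝ) (x : X → ℝ) (i : X) :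
    multilinearExtension f (Function.update x i 0) =
      multilinearExtension (fun S => f (S.erase i)) x := by
  rw [multilinearExtension_eq_sum_weightAway _ _ i, multilinearExtension_eq_sum_weightAway _ x i]
  refine Finset.sum_congr rfl fun t ht => ?_
  have hit : i ∉ t := fun h => Finset.notMem_erase i _ (Finset.mem_powerset.1 ht h)
  rw [weightAway_update x i 0 ht, Finset.erase_insert hit, Finset.erase_eq_of_notMem hit]
  simp
  left
  ring

theorem multilinearExtension_update_one (f : Finset X → ℝ) (x : X → ℝ) (i : X) :
    multilinearExtension f (Function.update x i 1) =
      multilinearExtension (fun S => f (insert i S)) x := by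
  rw [multilinearExtension_eq_sum_weightAway _ _ i, multilinearExtension_eq_sum_weightAway _ x i]
  refine Finset.sum_congr rfl fun t ht => ?_
  rw [weightAway_update x i 1 ht, Finset.insert_idem]
  simp
  left
  ring

/-- The multilinear extension is affine in every coordinate. -/
theorem multilinearExtension_update (f : Finset X → ℝ) (x : X → ℝ) (i : X) (c : ℝ) :
    multilinearExtension f (Function.update x i c) =
      (1 - c) * multilinearExtension f (Function.update x i 0) +
        c * multilinearExtension f (Function.update x i 1) := by
  simp only [multilinearExtension_eq_sum_weightAway f (Function.update x i _) i, Finset.mul_sum]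
  rw [← Finset.sum_add_distrib]
  refine Finset.sum_congr rfl fun t ht => ?_
  simp only [weightAway_update x i _ ht, Function.update_self]
  ring

theorem multilinearExtension_nonneg {g : Finset X → ℝ} (hg : ∀ S, 0 ≤ g S) {x : X → ℝ}
    (hx : x ∈ Set.Icc (0 : X → ℝ) 1) : 0 ≤ multilinearExtension g x :=
  Finset.sum_nonneg fun S _ => mul_nonneg (hg S) (mul_nonneg
    (Finset.prod_nonneg fun i _ => hx.1 i)
    (Finset.prod_nonneg fun i _ => sub_nonneg.2 (hx.2 i)))

theorem multilinearExtension_add_sub (g₁ g₂ g₃ g₄ : Finset X → ℝ) (x : X → ℝ) :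
    multilinearExtension (fun S => g₁ S + g₂ S - g₃ S - g₄ S) x =
      multilinearExtension g₁ x + multilinearExtension g₂ x - multilinearExtension g₃ x -
        multilinearExtension g₄ x := by
  unfold multilinearExtension
  rw [← Finset.sum_add_distrib, ← Finset.sum_sub_distrib, ← Finset.sum_sub_distrib]
  exact Finset.sum_congr rfl fun S _ => by ring

theorem continuous_multilinearExtension (f : Finset X → ℝ) :
    Continuous (multilinearExtension f) := by
  unfold multilinearExtension
  fun_prop

/-- The mixed second difference of the multilinear extension of a submodular function is
nonpositive. -/
theorem IsSubmodular.multilinearExtension_mixed {f : Finset X → ℝ} (hf : IsSubmodular f)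
    {x : X → ℝ} (hx : x ∈ Set.Icc (0 : X → ℝ) 1) (i k : X) :
    multilinearExtension f (Function.update (Function.update x i 0) k 0) +
        multilinearExtension f (Function.update (Function.update x i 1) k 1) ≤
      multilinearExtension f (Function.update (Function.update x i 1) k 0) +
        multilinearExtension f (Function.update (Function.update x i 0) k 1) := by
  simp only [multilinearExtension_update_zero, multilinearExtension_update_one]
  -- The difference of the two sides is the expectation of the submodularity defect of `S - k + i`
  -- (without `k`) and `S - i + k`.
  have h := multilinearExtension_nonneg (x := x) (g := fun S => f ((insert i S).erase k) +
    f (insert k (S.erase i)) - f ((S.erase i).erase k) - f (insert k (insert i S)))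
    (fun S => by
      have h := hf ((insert i S).erase k) (insert k (S.erase i))
      have h1 : (insert i S).erase k ∩ insert k (S.erase i) = (S.erase i).erase k := by
        ext j
        simp only [Finset.mem_inter, Finset.mem_erase, Finset.mem_insert]
        tauto
      have h2 : (insert i S).erase k ∪ insert k (S.erase i) = insert k (insert i S) := by
        ext j
        simp only [Finset.mem_union, Finset.mem_erase, Finset.mem_insert]
        tauto
      rw [h1, h2] at h
      linarith) hx
  rw [multilinearExtension_add_sub] at h
  linarith

/-- The point with weight `c` moved from coordinate `i` to coordinate `k`. -/
def moveMass (x : X → ℝ) (i k : X) (c : ℝ) : X → ℝ :=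
  Function.update (Function.update x i (x i - c)) k (x k + c)

/-- The multilinear extension is convex in the directions `e_k - e_i`: from every point of the cube
one of two opposite moves does not decrease it. -/
theorem IsSubmodular.le_moveMass_or {f : Finset X → ℝ} (hf : IsSubmodular f)
    {x : X → ℝ} (hx : x ∈ Set.Icc (0 : X → ℝ) 1) {i k : X} (hik : i ≠ k) {α β : ℝ}
    (hα : 0 ≤ α) (hβ : 0 ≤ β) :
    multilinearExtension f x ≤ multilinearExtension f (moveMass x i k α) ∨
      multilinearExtension f x ≤ multilinearExtension f (moveMass x i k (-β)) := by
  -- On the plane of the coordinates `i` and `k` the function is bilinear, given by its four corner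
  -- values.
  have key (c : ℝ) : multilinearExtension f (moveMass x i k c) =
      (1 - (x k + c)) * ((1 - (x i - c)) *
          multilinearExtension f (Function.update (Function.update x i 0) k 0) +
        (x i - c) * multilinearExtension f (Function.update (Function.update x i 1) k 0)) +
      (x k + c) * ((1 - (x i - c)) *
          multilinearExtension f (Function.update (Function.update x i 0) k 1) +
        (x i - c) * multilinearExtension f (Function.update (Function.update x i 1) k 1)) := by
    rw [moveMass, multilinearExtension_update, Function.update_comm hik,
      Function.update_comm hik, multilinearExtension_update,
      multilinearExtension_update f (Function.update x k 1)]
    simp only [Function.update_comm hik.symm]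
  have hx0 : moveMass x i k 0 = x := by simp [moveMass]
  have h0 := key 0
  rw [hx0] at h0
  have hm := hf.multilinearExtension_mixed hx i k
  rw [key, key, h0]
  generalize multilinearExtension f (Function.update (Function.update x i 0) k 0) = a at *
  generalize multilinearExtension f (Function.update (Function.update x i 1) k 0) = b at *
  generalize multilinearExtension f (Function.update (Function.update x i 0) k 1) = c at *
  generalize multilinearExtension f (Function.update (Function.update x i 1) k 1) = d at *
  generalize x i = p at *
  generalize x k = q at *
  by_contra! hcon
  obtain ⟨h1, h2⟩ := hcon
  have hs : 0 ≤ b + c - a - d := by linarith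
  -- The increments are `α (m + α s)` and `β (-m + β s)`, with slope `m` and curvature `s = b + c -
  -- a - d ≥ 0`. Were both negative, adding the brackets would give `(α + β) s < 0`.
  have e1 : (1 - (q + α)) * ((1 - (p - α)) * a + (p - α) * b) +
      (q + α) * ((1 - (p - α)) * c + (p - α) * d) -
      ((1 - (q + 0)) * ((1 - (p - 0)) * a + (p - 0) * b) +
      (q + 0) * ((1 - (p - 0)) * c + (p - 0) * d)) =
      α * ((1 - q) * (a - b) + (c - a) + p * (a + d - b - c) + q * (c - d)
        + α * (b + c - a - d)) := by ring
  have e2 : (1 - (q + -β)) * ((1 - (p - -β)) * a + (p - -β) * b) +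
      (q + -β) * ((1 - (p - -β)) * c + (p - -β) * d) -
      ((1 - (q + 0)) * ((1 - (p - 0)) * a + (p - 0) * b) +
      (q + 0) * ((1 - (p - 0)) * c + (p - 0) * d)) =
      β * (-((1 - q) * (a - b) + (c - a) + p * (a + d - b - c) + q * (c - d))
        + β * (b + c - a - d)) := by ring
  generalize (1 - q) * (a - b) + (c - a) + p * (a + d - b - c) + q * (c - d) = m at *
  have h1' : α * (m + α * (b + c - a - d)) < 0 := by linarith
  have h2' : β * (-m + β * (b + c - a - d)) < 0 := by linarith
  have h3 : m + α * (b + c - a - d) < 0 := by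
    by_contra! h
    exact absurd (mul_nonneg hα h) (not_le.2 h1')
  have h4 : -m + β * (b + c - a - d) < 0 := by
    by_contra! h
    exact absurd (mul_nonneg hβ h) (not_le.2 h2')
  have := mul_nonneg hα hs
  have := mul_nonneg hβ hs
  linarith

/-- Raising a coordinate or setting it to zero does not decrease the multilinear extension. -/
theorem multilinearExtension_le_update_zero (f : Finset X → ℝ) {x : X → ℝ} {i : X} {c : ℝ}
    (h0 : 0 ≤ x i) (hc : x i ≤ c)
    (h : multilinearExtension f (Function.update x i c) < multilinearExtension f x) :
    multilinearExtension f x ≤ multilinearExtension f (Function.update x i 0) := by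
  have h1 := multilinearExtension_update f x i c
  have h2 := multilinearExtension_update f x i (x i)
  rw [Function.update_eq_self] at h2
  generalize multilinearExtension f (Function.update x i 0) = a at *
  generalize multilinearExtension f (Function.update x i 1) = b at *
  rw [h1, h2] at h
  rw [h2]
  -- A decrease on raising the coordinate forces a nonpositive slope, so lowering the coordinate to
  -- zero cannot hurt.
  have hba : b ≤ a := by
    by_contra! hlt
    nlinarith [mul_nonneg (sub_nonneg.2 hc) (sub_nonneg.2 hlt.le)]
  nlinarith [mul_nonneg h0 (sub_nonneg.2 hba)]

/-- The point `x` with the coordinates in `R` set to zero. -/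
def maskOut (R : Finset X) (x : X → ℝ) : X → ℝ := fun i => if i ∈ R then 0 else x i

theorem multilinearExtension_maskOut (f : Finset X → ℝ) (R : Finset X) (x : X → ℝ) :
    multilinearExtension f (maskOut R x) = multilinearExtension (fun S => f (S \ R)) x := by
  induction R using Finset.induction_on generalizing x with
  | empty =>
    have h : maskOut ∅ x = x := by
      funext i
      simp [maskOut]
    simp [h]
  | insert a R ha ih =>
    have h : maskOut (insert a R) x = maskOut R (Function.update x a 0) := by
      funext i
      by_cases hi : i = a
      · subst hi
        simp [maskOut]
      · simp [maskOut, hi]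
    rw [h, ih, multilinearExtension_update_zero]
    congr 1
    funext S
    congr 1
    ext i
    simp only [Finset.mem_sdiff, Finset.mem_erase, Finset.mem_insert]
    tauto

end MultilinearExtension

/-! ## Exchanges of bases -/

theorem Matroid.exists_isBase_finset {X : Type*} [Finite X] (M : Matroid X) : ∃ B : Finset X, M.IsBase B := by
  obtain ⟨B, hB⟩ := M.exists_isBase
  exact ⟨B.toFinite.toFinset, by simpa using hB⟩

theorem Matroid.Indep.exists_isBase_finset_superset {X : Type*} [Finite X] {M : Matroid X}
    {I : Set X} (hI : M.Indep I) :
    ∃ B : Finset X, M.IsBase B ∧ I ⊆ B := by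
  obtain ⟨B, hB, hIB⟩ := hI.exists_isBase_superset
  exact ⟨B.toFinite.toFinset, by simpa using hB, by simpa using hIB⟩

theorem Matroid.IsBase.finset_eq_of_subset {X : Type*} {M : Matroid X} {A B : Finset X}
    (hA : M.IsBase A) (hB : M.IsBase B) (h : A ⊆ B) : A = B :=
  Finset.coe_injective (hA.eq_of_subset_isBase hB (by exact_mod_cast h))

section Matroid

variable {X : Type*} [DecidableEq X] {M : Matroid X}

theorem Matroid.IsBase.insert_erase_of_indep {B : Finset X} (hB : M.IsBase B) {u v : X}
    (hv : v ∉ B) (h : M.Indep (insert v (B.erase u) : Finset X)) :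
    M.IsBase (insert v (B.erase u) : Finset X) := by
  simp only [Finset.coe_insert, Finset.coe_erase] at h ⊢
  exact hB.exchange_isBase_of_indep (by simpa using hv) h

/-- The symmetric exchange property of bases. -/
theorem Matroid.IsBase.symmetric_exchange {A B : Finset X} (hA : M.IsBase A) (hB : M.IsBase B)
    {i : X} (hiA : i ∈ A) (hiB : i ∉ B) :
    ∃ k ∈ B, k ∉ A ∧ M.IsBase (insert k (A.erase i) : Finset X) ∧
      M.IsBase (insert i (B.erase k) : Finset X) := by
  have hiE : i ∈ M.E := hA.subset_ground (by simpa using hiA)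
  have hiB' : i ∉ (B : Set X) := by simpa using hiB
  have hC := hB.fundCircuit_isCircuit hiE hiB'
  have hiC := hC.mem_closure_sdiff_singleton_of_mem (M.mem_fundCircuit i B)
  have hi := hA.indep.notMem_closure_sdiff_of_mem (e := i) (by simpa using hiA)
  -- If the fundamental circuit of `i` in `B`, minus `i`, lay in the closure of `A \ {i}`, then so
  -- would `i`, against the independence of `A`. Any `k` of the circuit outside that closure serves
  -- both exchanges.
  obtain ⟨k, hkC, hk⟩ : ∃ k ∈ M.fundCircuit i B \ {i}, k ∉ M.closure (A \ {i}) := by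
    by_contra! h
    exact hi (M.closure_subset_closure_of_subset_closure h hiC)
  have hki : k ≠ i := hkC.2
  have hkB : k ∈ B := by
    have := M.fundCircuit_subset_insert i B hkC.1
    simpa [hki] using this
  have hkE : k ∈ M.E := hB.subset_ground (by simpa using hkB)
  refine ⟨k, hkB, fun hkA => hk (M.mem_closure_of_mem' ⟨by simpa using hkA, hki⟩ hkE), ?_, ?_⟩
  · simpa using hA.exchange_base_of_notMem_closure (by simpa using hiA) hk hkE
  · refine hB.insert_erase_of_indep hiB ?_
    have := (hB.indep.mem_fundCircuit_iff (by rwa [hB.closure_eq]) hiB').1 hkC.1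
    rwa [← Set.insert_sdiff_singleton_comm hki.symm, ← Finset.coe_erase, ← Finset.coe_insert] at this

/-- With the next lemma: whichever of the two bases is exchanged, `A \ B` loses exactly `i`. This
drives the termination of the merging. -/
theorem insert_erase_sdiff {A B : Finset X} {i k : X} (hk : k ∈ B) :
    insert k (A.erase i) \ B = (A \ B).erase i := by
  ext j
  by_cases hj : j = k
  · simp [hj, hk]
  · simp only [Finset.mem_sdiff, Finset.mem_insert, Finset.mem_erase]
    tauto

theorem sdiff_insert_erase {A B : Finset X} {i k : X} (hk : k ∉ A) :
    A \ insert i (B.erase k) = (A \ B).erase i := by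
  ext j
  by_cases hj : j = k
  · simp [hj, hk]
  · simp only [Finset.mem_sdiff, Finset.mem_insert, Finset.mem_erase]
    tauto

end Matroid

/-! ## Rounding a convex combination of bases -/

theorem indicator_mem_matroidPolytope {X : Type*} {M : Matroid X} {S : Set X} (hS : M.Indep S) :
    S.indicator 1 ∈ matroidPolytope M :=
  subset_convexHull ℝ _ ⟨S, hS, rfl⟩

theorem isIntegralPoint_indicator {X : Type*} (S : Set X) : IsIntegralPoint (S.indicator 1 : X → ℝ) := by
  classical
  intro i
  by_cases hi : i ∈ S
  · exact ⟨1, by simp [hi]⟩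
  · exact ⟨0, by simp [hi]⟩

section Rounding

variable {X : Type*} [Fintype X] [DecidableEq X] {M : Matroid X} {f : Finset X → ℝ}

/-- Induction on `|A \ B|`. Exchanging in `A` moves mass `α` from `i` to `k`, exchanging in `B`
moves mass `β` back from `k` to `i`; convexity permits one of them. The offset `r` carries the bases
not involved. -/
theorem exists_isBase_merge_two (hf : IsSubmodular f) {r : X → ℝ} {α β : ℝ} (hα : 0 ≤ α)
    (hβ : 0 ≤ β) (hr0 : ∀ i, 0 ≤ r i) (hr1 : ∀ i, r i + α + β ≤ 1) {A B : Finset X}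
    (hA : M.IsBase A) (hB : M.IsBase B) :
    ∃ C : Finset X, M.IsBase C ∧
      multilinearExtension f
        (fun j => r j + (if j ∈ A then α else 0) + (if j ∈ B then β else 0)) ≤
      multilinearExtension f (fun j => r j + (if j ∈ C then α + β else 0)) := by
  induction hn : (A \ B).card generalizing A B with
  | zero =>
    rw [Finset.card_eq_zero, Finset.sdiff_eq_empty_iff_subset] at hn
    obtain rfl := hA.finset_eq_of_subset hB hn
    refine ⟨A, hA, le_of_eq ?_⟩
    congr 1
    funext j
    split_ifs <;> ring
  | succ m ih =>
    obtain ⟨i, hi⟩ : (A \ B).Nonempty := Finset.card_pos.1 (by omega)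
    obtain ⟨hiA, hiB⟩ := Finset.mem_sdiff.1 hi
    obtain ⟨k, hkB, hkA, hA', hB'⟩ := hA.symmetric_exchange hB hiA hiB
    have hik : i ≠ k := fun h => hiB (h ▸ hkB)
    have hcard : ((A \ B).erase i).card = m := by rw [Finset.card_erase_of_mem hi, hn]; rfl
    have hx : (fun j => r j + (if j ∈ A then α else 0) + (if j ∈ B then β else 0)) ∈
        Set.Icc (0 : X → ℝ) 1 := by
      constructor <;> intro j <;> have h0 := hr0 j <;> have h1 := hr1 j <;> simp only <;>
        split_ifs <;> simp <;> linarith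
    rcases hf.le_moveMass_or hx hik hα hβ with h | h
    · obtain ⟨C, hC, hle⟩ := ih hA' hB (by rw [insert_erase_sdiff hkB, hcard])
      refine ⟨C, hC, (h.trans (le_of_eq ?_)).trans hle⟩
      congr 1
      funext j
      by_cases hj : j = k
      · subst hj
        simp [moveMass, hkA, hkB]
        ring
      · by_cases hj' : j = i
        · subst hj'
          simp [moveMass, hik, hiA, hiB]
        · simp [moveMass, hj, hj']
    · obtain ⟨C, hC, hle⟩ := ih hA hB' (by rw [sdiff_insert_erase hkA, hcard])
      refine ⟨C, hC, (h.trans (le_of_eq ?_)).trans hle⟩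
      congr 1
      funext j
      by_cases hj : j = k
      · subst hj
        simp [moveMass, hkA, hkB, hik.symm]
      · by_cases hj' : j = i
        · subst hj'
          simp [moveMass, hik, hiA, hiB]
        · simp [moveMass, hj, hj']

theorem exists_isBase_merge (hf : IsSubmodular f) {ι : Type*} (s : Finset ι)
    {w : ι → ℝ} {B : ι → Finset X} (hw : ∀ j ∈ s, 0 ≤ w j) (hB : ∀ j ∈ s, M.IsBase (B j))
    {r : X → ℝ} (hr0 : ∀ i, 0 ≤ r i) (hr1 : ∀ i, r i + ∑ j ∈ s, w j ≤ 1) :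
    ∃ C : Finset X, M.IsBase C ∧
      multilinearExtension f (fun i => r i + ∑ j ∈ s, if i ∈ B j then w j else 0) ≤
      multilinearExtension f (fun i => r i + if i ∈ C then ∑ j ∈ s, w j else 0) := by
  classical
  induction s using Finset.induction_on generalizing r with
  | empty =>
    obtain ⟨C, hC⟩ := M.exists_isBase_finset
    exact ⟨C, hC, by simp⟩
  | insert a s ha ih =>
    simp only [Finset.mem_insert, forall_eq_or_imp] at hw hB
    simp only [Finset.sum_insert ha] at hr1 ⊢
    have hs : 0 ≤ ∑ j ∈ s, w j := Finset.sum_nonneg hw.2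
    -- The base `B a` is parked in the offset while the others are merged into `C`; then `B a` and
    -- `C` are merged.
    obtain ⟨C, hC, hle⟩ := ih hw.2 hB.2 (r := fun i => r i + if i ∈ B a then w a else 0)
      (fun i => by
        have := hr0 i
        have := hw.1
        split_ifs <;> linarith)
      (fun i => by
        have := hr1 i
        have := hw.1
        split_ifs <;> linarith)
    obtain ⟨C', hC', hle'⟩ := exists_isBase_merge_two hf hw.1 hs hr0
      (fun i => by have := hr1 i; linarith) hB.1 hC
    refine ⟨C', hC', le_trans (le_of_eq ?_) (hle.trans hle')⟩
    congr 1
    funext i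
    ring

/-- Every point below a point `z` of the cube is dominated by `z` with some coordinates set to
zero. -/
theorem exists_le_maskOut (f : Finset X → ℝ) {x z : X → ℝ} (hx : ∀ i, 0 ≤ x i)
    (hxz : ∀ i, x i ≤ z i) :
    ∃ R, multilinearExtension f x ≤ multilinearExtension f (maskOut R z) := by
  -- Generalized to the stage at which only the coordinates in `s` have been treated.
  suffices H : ∀ s : Finset X, ∃ R ⊆ s, multilinearExtension f x ≤
      multilinearExtension f (fun i => if i ∈ s then maskOut R z i else x i) by
    obtain ⟨R, -, hR⟩ := H Finset.univ
    exact ⟨R, by simpa using hR⟩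
  intro s
  induction s using Finset.induction_on with
  | empty => exact ⟨∅, by simp, by simp⟩
  | insert a s ha ih =>
    obtain ⟨R, hRs, hR⟩ := ih
    have haR : a ∉ R := fun h => ha (hRs h)
    set y : X → ℝ := fun i => if i ∈ s then maskOut R z i else x i with hy
    have hya : y a = x a := by simp [hy, ha]
    by_cases h : multilinearExtension f y ≤ multilinearExtension f (Function.update y a (z a))
    · refine ⟨R, hRs.trans (Finset.subset_insert _ _), (hR.trans h).trans (le_of_eq ?_)⟩
      congr 1
      funext i
      by_cases hi : i = a
      · subst hi
        simp [maskOut, haR]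
      · simp [hi, hy]
    · refine ⟨insert a R, Finset.insert_subset_insert _ hRs, (hR.trans
        (multilinearExtension_le_update_zero f (by rw [hya]; exact hx a) (by rw [hya]; exact hxz a)
          (not_le.1 h))).trans (le_of_eq ?_)⟩
      congr 1
      funext i
      by_cases hi : i = a
      · subst hi
        simp [maskOut]
      · simp [hi, hy, maskOut]

/-- Enlarging the sets to bases is what makes exchanges available. It raises the point, which the
masking by `R` compensates, since `F` need not be monotone. -/
theorem exists_integral_ge (hf : IsSubmodular f) {x : X → ℝ} (hx : x ∈ matroidPolytope M) :
    ∃ x' ∈ matroidPolytope M, IsIntegralPoint x' ∧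
      multilinearExtension f x ≤ multilinearExtension f x' := by
  obtain ⟨ι, _, w, v, hw0, hw1, hv, rfl⟩ := mem_convexHull_iff_exists_fintype.1 hx
  choose S hS hvS using hv
  choose B hB hSB using fun j => (hS j).exists_isBase_finset_superset
  have hv01 (j : ι) (i : X) : 0 ≤ v j i ∧ v j i ≤ if i ∈ B j then 1 else 0 := by
    rw [hvS j]
    by_cases hi : i ∈ S j
    · have : i ∈ B j := hSB j hi
      simp [hi, this]
    · simp only [Set.indicator_of_notMem hi]
      split_ifs <;> simp
  obtain ⟨R, hR⟩ := exists_le_maskOut f (x := ∑ j, w j • v j)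
    (z := fun i => ∑ j, if i ∈ B j then w j else 0)
    (fun i => by
      simp only [Finset.sum_apply, Pi.smul_apply, smul_eq_mul]
      exact Finset.sum_nonneg fun j _ => mul_nonneg (hw0 j) (hv01 j i).1)
    (fun i => by
      simp only [Finset.sum_apply, Pi.smul_apply, smul_eq_mul]
      refine Finset.sum_le_sum fun j _ => ?_
      have := mul_le_mul_of_nonneg_left (hv01 j i).2 (hw0 j)
      simpa using this)
  obtain ⟨C, hC, hle⟩ := exists_isBase_merge (hf.sdiff R) Finset.univ (fun j _ => hw0 j)
    (fun j _ => hB j) (r := 0) (fun _ => le_rfl) (by simp [hw1])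
  refine ⟨(↑(C \ R) : Set X).indicator 1,
    indicator_mem_matroidPolytope (hC.indep.subset (by simp)), isIntegralPoint_indicator _,
    hR.trans ?_⟩
  rw [multilinearExtension_maskOut]
  simp only [Pi.zero_apply, zero_add] at hle
  refine hle.trans (le_of_eq ?_)
  rw [hw1, ← multilinearExtension_maskOut]
  congr 1
  funext i
  by_cases h1 : i ∈ C <;> by_cases h2 : i ∈ R <;> simp [maskOut, h1, h2]

/-- A maximizer exists by compactness; rounding it gives an integral maximizer, so both maxima are
attained at the same point. -/
theorem hasNoIntegralityGap (hf : IsSubmodular f) :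
    HasNoIntegralityGap (multilinearExtension f) (matroidPolytope M) := by
  have hne : (matroidPolytope M).Nonempty :=
    ⟨_, indicator_mem_matroidPolytope M.empty_indep⟩
  have hfin : {v : X → ℝ | ∃ S : Set X, M.Indep S ∧ v = S.indicator 1}.Finite :=
    (Set.finite_range fun S : Set X => (S.indicator 1 : X → ℝ)).subset (by
      rintro _ ⟨S, -, rfl⟩
      exact ⟨S, rfl⟩)
  obtain ⟨y, hy, hmax⟩ := (hfin.isCompact_convexHull (𝕜 := ℝ)).exists_isMaxOn hne
    (continuous_multilinearExtension f).continuousOn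
  obtain ⟨x', hx', hint, hle⟩ := exists_integral_ge hf hy
  have hub : ∀ z ∈ matroidPolytope M, multilinearExtension f z ≤ multilinearExtension f x' :=
    fun z hz => (hmax hz).trans hle
  refine ⟨multilinearExtension f x', multilinearExtension f x', ⟨⟨x', hx', rfl⟩, ?_⟩,
    ⟨⟨x', ⟨hx', hint⟩, rfl⟩, ?_⟩, by ring⟩
  · rintro _ ⟨z, hz, rfl⟩
    exact hub z hz
  · rintro _ ⟨z, hz, rfl⟩
    exact hub z hz.1

end Rounding

/-! ## Integral combinations of bases -/

section Combination

variable {X : Type*} [DecidableEq X] {M : Matroid X}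

/-- `z` is the combination of the bases `B j`, `lo ≤ j < N`, with nonnegative coefficients `w j` of
sum `D`. -/
structure IsComb (M : Matroid X) (D : ℤ) (lo N : ℕ) (B : ℕ → Finset X) (w : ℕ → ℤ) (z : X → ℤ) :
    Prop where
  base : ∀ j, lo ≤ j → j < N → M.IsBase (B j)
  nonneg : ∀ j, lo ≤ j → j < N → 0 ≤ w j
  sum : ∑ j ∈ Finset.Ico lo N, w j = D
  eq : ∀ i, z i = ∑ j ∈ Finset.Ico lo N, if i ∈ B j then w j else 0

variable {D : ℤ} {lo N : ℕ} {B : ℕ → Finset X} {w : ℕ → ℤ} {z : X → ℤ}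

theorem IsComb.weight_le (h : IsComb M D lo N B w z) {j : ℕ} (hj : lo ≤ j) (hjN : j < N) :
    w j ≤ D := by
  rw [← h.sum]
  exact Finset.single_le_sum (fun k hk => h.nonneg k (Finset.mem_Ico.1 hk).1 (Finset.mem_Ico.1 hk).2)
    (Finset.mem_Ico.2 ⟨hj, hjN⟩)

theorem IsComb.point_nonneg (h : IsComb M D lo N B w z) (i : X) : 0 ≤ z i := by
  rw [h.eq]
  refine Finset.sum_nonneg fun k hk => ?_
  have := h.nonneg k (Finset.mem_Ico.1 hk).1 (Finset.mem_Ico.1 hk).2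
  split_ifs <;> simp [this]

theorem IsComb.point_le (h : IsComb M D lo N B w z) (i : X) : z i ≤ D := by
  rw [h.eq, ← h.sum]
  refine Finset.sum_le_sum fun k hk => ?_
  have := h.nonneg k (Finset.mem_Ico.1 hk).1 (Finset.mem_Ico.1 hk).2
  split_ifs <;> simp [this]

theorem IsComb.swap (h : IsComb M D lo N B w z) {b : ℕ} (hb : lo ≤ b) (hbN : b < N) {u v : X}
    (hu : u ∈ B b) (hv : v ∉ B b) (hbase : M.IsBase (insert v ((B b).erase u) : Finset X)) :
    IsComb M D lo N (Function.update B b (insert v ((B b).erase u))) w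
      (Function.update (Function.update z u (z u - w b)) v (z v + w b)) := by
  have huv : u ≠ v := fun e => hv (e ▸ hu)
  refine ⟨fun j hj hjN => ?_, h.nonneg, h.sum, fun i => ?_⟩
  · by_cases hjb : j = b
    · subst hjb
      simpa using hbase
    · simpa [hjb] using h.base j hj hjN
  · have hmem : b ∈ Finset.Ico lo N := Finset.mem_Ico.2 ⟨hb, hbN⟩
    have hz := h.eq i
    rw [← Finset.add_sum_erase _ _ hmem] at hz ⊢
    have hrest : (∑ j ∈ (Finset.Ico lo N).erase b,
        if i ∈ Function.update B b (insert v ((B b).erase u)) j then w j else 0) =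
        ∑ j ∈ (Finset.Ico lo N).erase b, if i ∈ B j then w j else 0 :=
      Finset.sum_congr rfl fun j hj => by
        rw [Function.update_of_ne (Finset.ne_of_mem_erase hj)]
    rw [hrest, Function.update_self]
    by_cases hiv : i = v
    · subst hiv
      simp only [hv, if_false] at hz
      simp
      linarith
    · by_cases hiu : i = u
      · subst hiu
        simp only [hu, if_true] at hz
        simp [huv]
        linarith
      · simpa [hiv, hiu] using hz

theorem IsComb.split (h : IsComb M D lo N B w z) {b : ℕ} (hb : lo ≤ b) (hbN : b < N) {d : ℤ}
    (hd : 0 ≤ d) (hdw : d ≤ w b) :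
    IsComb M D lo (N + 1) (Function.update B N (B b))
      (Function.update (Function.update w b d) N (w b - d)) z := by
  -- Stated for a predicate on bases so that `True` gives the total weight and `i ∈ ·` gives the
  -- coordinate `i`.
  have key (g : Finset X → Prop) [DecidablePred g] :
      (∑ j ∈ Finset.Ico lo (N + 1), if g (Function.update B N (B b) j) then
        Function.update (Function.update w b d) N (w b - d) j else 0) =
      ∑ j ∈ Finset.Ico lo N, if g (B j) then w j else 0 := by
    have hmem : b ∈ Finset.Ico lo N := Finset.mem_Ico.2 ⟨hb, hbN⟩
    rw [Finset.sum_Ico_succ_top (by omega), ← Finset.add_sum_erase _ _ hmem,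
      ← Finset.add_sum_erase _ _ hmem]
    have hrest : (∑ j ∈ (Finset.Ico lo N).erase b, if g (Function.update B N (B b) j) then
        Function.update (Function.update w b d) N (w b - d) j else 0) =
        ∑ j ∈ (Finset.Ico lo N).erase b, if g (B j) then w j else 0 :=
      Finset.sum_congr rfl fun j hj => by
        have h1 := Finset.ne_of_mem_erase hj
        have h2 := (Finset.mem_Ico.1 (Finset.mem_of_mem_erase hj)).2
        rw [Function.update_of_ne h2.ne, Function.update_of_ne h2.ne, Function.update_of_ne h1]
    rw [hrest]
    simp only [Function.update_self, Function.update_of_ne hbN.ne]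
    split_ifs <;> ring
  refine ⟨fun j hj hjN => ?_, fun j hj hjN => ?_, ?_, fun i => ?_⟩
  · by_cases hjN' : j = N
    · subst hjN'
      simpa using h.base b hb hbN
    · simpa [hjN'] using h.base j hj (by omega)
  · by_cases hjN' : j = N
    · subst hjN'
      simpa using hdw
    · by_cases hjb : j = b
      · subst hjb
        simpa [hjN'] using hd
      · simpa [hjN', hjb] using h.nonneg j hj (by omega)
  · simpa [h.sum] using key fun _ => True
  · rw [h.eq i, key fun S => i ∈ S]

end Combination

/-! ## The push-relabel algorithm for matroid polytopes -/

section PushRelabel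

variable {X : Type*} [DecidableEq X] {M : Matroid X}

/-- Otherwise `B ∩ S` could be augmented by some `v ∈ S \ B` and then completed from `B` to a base
`B - u + v`. The lost element `u` lies outside `S`, against the closedness of `S` under exchanges.
-/
theorem Matroid.IsBase.card_inter_le {B : Finset X} (hB : M.IsBase B) {S : Finset X}
    (hS : ∀ v ∈ S, v ∉ B → ∀ u ∈ B, M.IsBase (insert v (B.erase u) : Finset X) → u ∈ S)
    {I : Finset X} (hI : M.Indep I) : (I ∩ S).card ≤ (B ∩ S).card := by
  by_contra! hlt
  obtain ⟨v, hv, hvB, hind⟩ := (hB.indep.subset (I := ((B ∩ S : Finset X) : Set X))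
    (by simp)).augment_finset (hI.subset (I := ((I ∩ S : Finset X) : Set X)) (by simp)) hlt
  have hvS : v ∈ S := (Finset.mem_inter.1 hv).2
  have hvB' : v ∉ B := fun h => hvB (Finset.mem_inter.2 ⟨h, hvS⟩)
  obtain ⟨B', hB', hsub, hsub'⟩ := hind.exists_isBase_subset_union_isBase hB
  obtain ⟨u, huB, huB'⟩ : ∃ u ∈ (B : Set X), u ∉ B' := by
    by_contra! h
    have h' : (B : Set X) = B' := hB.eq_of_subset_isBase hB' h
    exact hvB' (by simpa [← h'] using hsub (Set.mem_insert v _))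
  have huS : u ∉ S := fun h => huB' (hsub (Set.mem_insert_of_mem _ (by simp_all)))
  refine huS (hS v hvS hvB' u huB (hB.insert_erase_of_indep hvB' ?_))
  have hvB'' : v ∈ B' := hsub (Set.mem_insert v _)
  have hcard := hB.encard_sdiff_comm hB'
  have h1 : B' \ (B : Set X) = {v} := by
    ext y
    simp only [Set.mem_sdiff, Finset.mem_coe, Set.mem_singleton_iff]
    constructor
    · rintro ⟨hy, hyB⟩
      rcases hsub' hy with h | h
      · rcases h with h | h
        · exact h
        · exact absurd (Finset.mem_inter.1 (by simpa using h)).1 hyB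
      · exact absurd (by simpa using h) hyB
    · rintro rfl
      exact ⟨hvB'', hvB'⟩
  -- Two bases have differences of equal size, so `B` loses just one element.
  rw [h1, Set.encard_singleton, Set.encard_eq_one] at hcard
  obtain ⟨u', hu'⟩ := hcard
  have hu1 : u = u' := by
    have : u ∈ (B : Set X) \ B' := ⟨huB, huB'⟩
    rwa [hu'] at this
  refine hB'.indep.subset fun y hy => ?_
  simp only [Finset.coe_insert, Finset.coe_erase, Set.mem_insert_iff, Set.mem_sdiff,
    Finset.mem_coe, Set.mem_singleton_iff] at hy
  rcases hy with rfl | ⟨hyB, hyu⟩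
  · exact hvB''
  · by_contra hyB'
    have : y ∈ (B : Set X) \ B' := ⟨hyB, hyB'⟩
    rw [hu'] at this
    exact hyu (this.trans hu1.symm)

/-- The state of the push-relabel algorithm: `N` bases with coefficients, their combination, and
the levels of the elements. -/
structure State (X : Type*) where
  N : ℕ
  B : ℕ → Finset X
  w : ℕ → ℤ
  z : X → ℤ
  θ : X → ℕ

/-- The exchange of `u` for `v` in the base `j` is possible. -/
def State.CanSwap (M : Matroid X) (σ : State X) (j : ℕ) (u v : X) : Prop :=
  u ∈ σ.B j ∧ v ∉ σ.B j ∧ M.IsBase (insert v ((σ.B j).erase u) : Finset X)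

/-- Give a copy of the base `b` the part `d` of its coefficient. -/
def State.split (σ : State X) (b : ℕ) (d : ℤ) : State X where
  N := σ.N + 1
  B := Function.update σ.B σ.N (σ.B b)
  w := Function.update (Function.update σ.w b d) σ.N (σ.w b - d)
  z := σ.z
  θ := σ.θ

/-- Exchange `u` for `v` in the base `b`. -/
def State.push (σ : State X) (b : ℕ) (u v : X) : State X where
  N := σ.N
  B := Function.update σ.B b (insert v ((σ.B b).erase u))
  w := σ.w
  z := Function.update (Function.update σ.z u (σ.z u - σ.w b)) v (σ.z v + σ.w b)
  θ := σ.θ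

/-- Raise the level of `v`. -/
def State.lift (σ : State X) (v : X) : State X :=
  { σ with θ := Function.update σ.θ v (σ.θ v + 1) }

variable [Fintype X]

/-- The invariant of the push-relabel algorithm with target `a`. -/
structure State.Inv (M : Matroid X) (D : ℤ) (a : X → ℤ) (σ : State X) : Prop where
  pos : 0 < σ.N
  comb : IsComb M D 0 σ.N σ.B σ.w σ.z
  excess : ∀ i, a i < σ.z i → σ.θ i = 0
  level : ∀ j < σ.N, ∀ u v, σ.CanSwap M j u v → σ.θ v ≤ σ.θ u + 1
  level_le : ∀ i, σ.θ i ≤ Fintype.card X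

/-- The vector `a / D` satisfies the rank inequalities of the matroid polytope. -/
def SatisfiesRank (M : Matroid X) (D : ℤ) (a : X → ℤ) : Prop :=
  ∀ (S : Finset X) (c : ℕ), (∀ I : Finset X, M.Indep I → (I ∩ S).card ≤ c) → ∑ i ∈ S, a i ≤ D * c

variable {D : ℤ} {a : X → ℤ} {σ : State X}

/-- The gap argument. If `v` were on level `n = |X|`, the other `n - 1` elements would miss some
level `l < n`. By the level condition the set `S` above the gap is closed under exchanges in every
base, so every base meets `S` in as many elements as possible and `z(S)` is at least `D` times that
number. Elements of `S` have positive level, hence no excess, and `v ∈ S` is deficient: `a(S) >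
z(S)` violates the rank inequality. -/
theorem State.Inv.level_lt (h : σ.Inv M D a) (ha : SatisfiesRank M D a) {v : X}
    (hv : σ.z v < a v) : σ.θ v < Fintype.card X := by
  by_contra! hge
  obtain ⟨l, hl, hgap⟩ : ∃ l < Fintype.card X, ∀ i, σ.θ i ≠ l := by
    by_contra! hall
    have hsub : Finset.range (Fintype.card X) ⊆ (Finset.univ.erase v).image σ.θ := fun l hl => by
      obtain ⟨i, hi⟩ := hall l (Finset.mem_range.1 hl)
      have : i ≠ v := by
        rintro rfl
        have := Finset.mem_range.1 hl
        omega
      exact Finset.mem_image.2 ⟨i, by simp [this], hi⟩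
    have h1 := (Finset.card_le_card hsub).trans Finset.card_image_le
    have h2 : 0 < Fintype.card X := Fintype.card_pos_iff.2 ⟨v⟩
    rw [Finset.card_range, Finset.card_erase_of_mem (Finset.mem_univ v), Finset.card_univ] at h1
    omega
  set S : Finset X := Finset.univ.filter fun i => l < σ.θ i with hS
  have hmax : ∀ j < σ.N, ∀ I : Finset X, M.Indep I → (I ∩ S).card ≤ (σ.B j ∩ S).card :=
    fun j hj I hI => (h.comb.base j (Nat.zero_le _) hj).card_inter_le (fun y hy hyB u hu hbase => by
      have h1 := h.level j hj u y ⟨hu, hyB, hbase⟩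
      have h2 := hgap u
      simp only [hS, Finset.mem_filter, Finset.mem_univ, true_and] at hy ⊢
      omega) hI
  have h1 := ha S _ (hmax 0 h.pos)
  have h2 : ∑ i ∈ S, σ.z i < ∑ i ∈ S, a i := by
    refine Finset.sum_lt_sum (fun i hi => ?_) ⟨v, ?_, hv⟩
    · by_contra! hlt
      have := h.excess i hlt
      simp only [hS, Finset.mem_filter] at hi
      omega
    · simp only [hS, Finset.mem_filter, Finset.mem_univ, true_and]
      omega
  have h3 : ∑ i ∈ S, σ.z i = ∑ j ∈ Finset.Ico 0 σ.N, σ.w j * (σ.B j ∩ S).card := by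
    simp only [h.comb.eq]
    rw [Finset.sum_comm]
    refine Finset.sum_congr rfl fun j _ => ?_
    rw [← Finset.sum_filter, Finset.sum_const, nsmul_eq_mul, mul_comm,
      Finset.filter_mem_eq_inter, Finset.inter_comm]
  have h4 : D * (σ.B 0 ∩ S).card ≤ ∑ j ∈ Finset.Ico 0 σ.N, σ.w j * (σ.B j ∩ S).card := by
    rw [← h.comb.sum, Finset.sum_mul]
    refine Finset.sum_le_sum fun j hj => ?_
    have hjN := (Finset.mem_Ico.1 hj).2
    exact mul_le_mul_of_nonneg_left (by
      exact_mod_cast hmax j hjN _ (h.comb.base 0 le_rfl h.pos).indep)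
      (h.comb.nonneg j (Nat.zero_le _) hjN)
  linarith

/-- Only exchanges that bring in `v` are at risk, and those have slack because none of them climbs a
full level. Being deficient, `v` has no excess and may leave level 0. -/
theorem State.Inv.lift (h : σ.Inv M D a) (ha : SatisfiesRank M D a) {v : X} (hv : σ.z v < a v)
    (hno : ∀ j < σ.N, ∀ u, σ.CanSwap M j u v → σ.θ v ≠ σ.θ u + 1) : (σ.lift v).Inv M D a := by
  refine ⟨h.pos, h.comb, fun i hi => ?_, fun j hj u y hs => ?_, fun i => ?_⟩
  · have hiv : i ≠ v := by
      rintro rfl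
      exact absurd hi (not_lt.2 hv.le)
    simpa [State.lift, hiv] using h.excess i hi
  · have hs' : σ.CanSwap M j u y := hs
    have huy : u ≠ y := fun e => hs'.2.1 (e ▸ hs'.1)
    have h1 := h.level j hj u y hs'
    simp only [State.lift, Function.update_apply]
    split_ifs with e1 e2 e2
    · exact absurd (e2.trans e1.symm) huy
    · subst e1
      have := hno j hj u hs'
      omega
    · subst e2
      omega
    · exact h1
  · have h1 := h.level_le i
    simp only [State.lift, Function.update_apply]
    split_ifs with e
    · subst e
      exact h.level_lt ha hv
    · exact h1

theorem State.Inv.split (h : σ.Inv M D a) {b : ℕ} (hb : b < σ.N) {d : ℤ} (hd : 0 ≤ d)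
    (hdw : d ≤ σ.w b) : (σ.split b d).Inv M D a := by
  refine ⟨Nat.succ_pos _, h.comb.split (Nat.zero_le _) hb hd hdw, h.excess, fun j hj u v hs => ?_,
    h.level_le⟩
  simp only [State.split] at hj
  by_cases hjN : j = σ.N
  · subst hjN
    exact h.level b hb u v (by simpa [State.split, State.CanSwap] using hs)
  · exact h.level j (by omega) u v (by simpa [State.split, State.CanSwap, hjN] using hs)

/-- An exchange of `t` for `y` in the new base `B - u + v` comes from exchanges already possible in
`B`, and `θ v = θ u + 1` makes the level bounds compose. The condition on `w b` keeps `v` from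
getting excess. -/
theorem State.Inv.push (h : σ.Inv M D a) {b : ℕ} (hb : b < σ.N) {u v : X}
    (hs : σ.CanSwap M b u v) (hθ : σ.θ v = σ.θ u + 1) (hw : σ.w b ≤ a v - σ.z v) :
    (σ.push b u v).Inv M D a := by
  obtain ⟨hu, hv, hbase⟩ := hs
  have huv : u ≠ v := fun e => hv (e ▸ hu)
  refine ⟨h.pos, h.comb.swap (Nat.zero_le _) hb hu hv hbase, fun i hi => ?_,
    fun j hj t y hs => ?_, h.level_le⟩
  · have hwb := h.comb.nonneg b (Nat.zero_le _) hb
    simp only [State.push, Function.update_apply] at hi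
    split_ifs at hi with e1 e2
    · subst e1
      omega
    · subst e2
      exact h.excess i (by omega)
    · exact h.excess i hi
  · by_cases hjb : j = b
    swap
    · exact h.level j hj t y (by simpa [State.push, State.CanSwap, hjb] using hs)
    subst hjb
    have hlev := h.level j hb
    simp only [State.CanSwap, State.push, Function.update_self] at hs
    obtain ⟨ht, hy, hB2⟩ := hs
    change σ.θ y ≤ σ.θ t + 1
    have hyv : y ≠ v := fun e => hy (by simp [e])
    by_cases hyu : y = u
    · subst hyu
      by_cases htv : t = v
      · subst htv
        omega
      · have htB : t ∈ σ.B j := by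
          simp only [Finset.mem_insert, Finset.mem_erase] at ht
          tauto
        have hty : t ≠ y := by
          rintro rfl
          exact hy ht
        have := hlev t v ⟨htB, hv, by
          convert hB2 using 2
          ext k
          simp only [Finset.mem_insert, Finset.mem_erase]
          by_cases hk : k = y
          · simp [hk, hu, hty.symm]
          · simp only [hk]
            by_cases hkv : k = v
            · simp [hkv, Ne.symm htv]
            · simp [hkv, hk]⟩
        omega
    · have hyB : y ∉ σ.B j := fun hyB => hy (by simp [hyu, hyB])
      by_cases htv : t = v
      · subst htv
        have := hlev u y ⟨hu, hyB, by
          convert hB2 using 2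
          rw [Finset.erase_insert (by simp [hv])]⟩
        omega
      · have htB : t ∈ σ.B j ∧ t ≠ u := by
          simp only [Finset.mem_insert, Finset.mem_erase] at ht
          tauto
        have hBj := h.comb.base j (Nat.zero_le _) hb
        -- Symmetric exchange between `B - u + v - t + y` and `B` itself: the element returned for
        -- `y` can only be `u` or `t`. For `t`, the exchange of `t` for `y` was possible before; for
        -- `u`, both `u` for `y` and `t` for `v` were, so `θ y ≤ θ u + 1 = θ v ≤ θ t + 1`.
        obtain ⟨k, hkB, hk2, hb1, hb2⟩ := hB2.symmetric_exchange hBj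
          (Finset.mem_insert_self y _) hyB
        have hk : k = u ∨ k = t := by
          by_contra! hne
          exact hk2 (by simp [hkB, hne.1, hne.2])
        rcases hk with rfl | rfl
        · have h1 := hlev k y ⟨hu, hyB, hb2⟩
          have h2 := hlev t v ⟨htB.1, hv, by
            convert hb1 using 2
            ext l
            simp only [Finset.mem_insert, Finset.mem_erase]
            by_cases hlk : l = k
            · simp [hlk, hu, htB.2.symm]
            · by_cases hlv : l = v
              · simp [hlv, Ne.symm htv, Ne.symm hyv]
              · simp only [hlk, hlv, false_or, ne_eq, not_false_eq_true, true_and]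
                constructor
                · rintro ⟨h1, h2⟩
                  exact ⟨fun e => hyB (e ▸ h2), Or.inr ⟨h1, h2⟩⟩
                · rintro ⟨h1, h2⟩
                  exact h2.resolve_left h1⟩
          omega
        · exact hlev k y ⟨htB.1, hyB, hb2⟩

/-! ### The potential -/

open Classical in
/-- The elements that are deficient or of lower level than a deficient element. -/
noncomputable def State.active (a : X → ℤ) (σ : State X) : Finset X :=
  Finset.univ.filter fun i => σ.z i < a i ∨ ∃ v, σ.z v < a v ∧ σ.θ i < σ.θ v

/-- The total distance of the elements from the highest level. -/
def State.gap (σ : State X) : ℕ := ∑ i, (Fintype.card X - σ.θ i)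

/-- The total distance of the elements of the bases from the highest level. -/
def State.baseGap (σ : State X) : ℕ :=
  ∑ j ∈ Finset.range σ.N, ∑ i ∈ σ.B j, (Fintype.card X - σ.θ i)

/-- The potential that decreases in every round of the push-relabel algorithm. -/
noncomputable def State.potential (a : X → ℤ) (σ : State X) : ℕ :=
  (σ.gap * (Fintype.card X + 1) + (σ.active a).card) * (Fintype.card X ^ 2 + 1) + σ.baseGap

theorem State.sum_gap_le {X : Type*} [Fintype X] (σ : State X) (S : Finset X) :
    ∑ i ∈ S, (Fintype.card X - σ.θ i) ≤ Fintype.card X ^ 2 := by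
  refine (Finset.sum_le_card_nsmul _ _ (Fintype.card X) fun i _ => Nat.sub_le _ _).trans ?_
  rw [smul_eq_mul, sq]
  exact Nat.mul_le_mul_right _ (Finset.card_le_univ S)

/-- The potential is lexicographic: the unit lost in `gap` outweighs any growth of the active set,
and `baseGap` cannot grow. -/
theorem State.potential_lift (σ : State X) {v : X} (hv : σ.θ v < Fintype.card X)
    (hva : σ.z v < a v) : (σ.lift v).potential a < σ.potential a := by
  have h1 : (σ.lift v).gap + 1 = σ.gap := by
    unfold State.gap
    rw [← Finset.add_sum_erase _ _ (Finset.mem_univ v),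
      ← Finset.add_sum_erase _ _ (Finset.mem_univ v)]
    have : ∑ i ∈ Finset.univ.erase v, (Fintype.card X - (σ.lift v).θ i) =
        ∑ i ∈ Finset.univ.erase v, (Fintype.card X - σ.θ i) :=
      Finset.sum_congr rfl fun i hi => by
        simp [State.lift, Function.update_of_ne (Finset.ne_of_mem_erase hi)]
    rw [this]
    simp only [State.lift, Function.update_self]
    omega
  have h2 : (σ.lift v).baseGap ≤ σ.baseGap := by
    refine Finset.sum_le_sum fun j _ => Finset.sum_le_sum fun i _ => ?_
    have : σ.θ i ≤ (σ.lift v).θ i := by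
      simp only [State.lift, Function.update_apply]
      split_ifs with e
      · subst e
        omega
      · rfl
    omega
  have h3 : ((σ.lift v).active a).card ≤ Fintype.card X := Finset.card_le_univ _
  have h4 : 0 < (σ.active a).card := Finset.card_pos.2 ⟨v, by simp [State.active, hva]⟩
  unfold State.potential
  rw [← h1]
  have h5 : (σ.lift v).gap * (Fintype.card X + 1) + ((σ.lift v).active a).card + 1 ≤
      ((σ.lift v).gap + 1) * (Fintype.card X + 1) + (σ.active a).card := by
    rw [add_mul]
    omega
  have h6 := Nat.mul_le_mul_right (Fintype.card X ^ 2 + 1) h5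
  rw [add_mul _ 1] at h6
  omega

theorem State.baseGap_push (σ : State X) {b : ℕ} (hb : b < σ.N) {u v : X} (hu : u ∈ σ.B b)
    (hv : v ∉ σ.B b) (hθ : σ.θ v = σ.θ u + 1) (hv' : σ.θ v ≤ Fintype.card X) :
    (σ.push b u v).baseGap + 1 = σ.baseGap := by
  unfold State.baseGap
  have hmem : b ∈ Finset.range σ.N := Finset.mem_range.2 hb
  change (∑ j ∈ Finset.range σ.N, ∑ i ∈ Function.update σ.B b (insert v ((σ.B b).erase u)) j,
    (Fintype.card X - σ.θ i)) + 1 = _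
  rw [← Finset.add_sum_erase _ _ hmem, ← Finset.add_sum_erase _ _ hmem]
  have hrest : ∑ j ∈ (Finset.range σ.N).erase b,
      ∑ i ∈ Function.update σ.B b (insert v ((σ.B b).erase u)) j, (Fintype.card X - σ.θ i) =
      ∑ j ∈ (Finset.range σ.N).erase b, ∑ i ∈ σ.B j, (Fintype.card X - σ.θ i) :=
    Finset.sum_congr rfl fun j hj => by
      rw [Function.update_of_ne (Finset.ne_of_mem_erase hj)]
  rw [hrest, Function.update_self, Finset.sum_insert (by simp [hv]),
    ← Finset.add_sum_erase (σ.B b) _ hu]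
  omega

/-- The push may make `u` deficient, but `u` lies below the deficient `v` and was already active, as
was everything below `u`. This is why active elements, and not deficient ones, are counted. -/
theorem State.active_push_subset (σ : State X) {b : ℕ} {u v : X} (hθ : σ.θ v = σ.θ u + 1)
    (hva : σ.z v < a v) : (σ.push b u v).active a ⊆ σ.active a := by
  intro i hi
  have hdef : ∀ i, (σ.push b u v).z i < a i → σ.z i < a i ∨ i = u := fun i hi => by
    simp only [State.push, Function.update_apply] at hi
    split_ifs at hi with e1 e2
    · subst e1
      exact Or.inl hva
    · exact Or.inr e2
    · exact Or.inl hi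
  simp only [State.active, Finset.mem_filter, Finset.mem_univ, true_and] at hi ⊢
  rcases hi with hi | ⟨y, hy, hiy⟩
  · rcases hdef i hi with h | rfl
    · exact Or.inl h
    · exact Or.inr ⟨v, hva, by omega⟩
  · change σ.θ i < σ.θ y at hiy
    rcases hdef y hy with h | rfl
    · exact Or.inr ⟨y, h, hiy⟩
    · exact Or.inr ⟨v, hva, by omega⟩

theorem State.potential_push (σ : State X) {b : ℕ} (hb : b < σ.N) {u v : X} (hu : u ∈ σ.B b)
    (hv : v ∉ σ.B b) (hθ : σ.θ v = σ.θ u + 1) (hv' : σ.θ v ≤ Fintype.card X)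
    (hva : σ.z v < a v) : (σ.push b u v).potential a < σ.potential a := by
  have h1 := σ.baseGap_push hb hu hv hθ hv'
  have h2 := Finset.card_le_card (σ.active_push_subset (b := b) hθ hva)
  have h3 : (σ.push b u v).gap = σ.gap := rfl
  unfold State.potential
  rw [h3]
  have := Nat.mul_le_mul_right (Fintype.card X ^ 2 + 1)
    (Nat.add_le_add_left h2 (σ.gap * (Fintype.card X + 1)))
  omega

/-- The new copy may add up to `n ^ 2` to `baseGap`, where `n = |X|`, but `v` becomes saturated.
Having had the highest level among the deficient elements, it leaves the active set, which pays for
the copy. This is the reason for choosing a deficient element of highest level. -/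
theorem State.potential_split_push (σ : State X) {b : ℕ} (hb : b < σ.N) {u v : X} (hu : u ∈ σ.B b)
    (hv : v ∉ σ.B b) (hθ : σ.θ v = σ.θ u + 1) (hv' : σ.θ v ≤ Fintype.card X)
    (hva : σ.z v < a v) (hmax : ∀ i, σ.z i < a i → σ.θ i ≤ σ.θ v) :
    ((σ.split b (a v - σ.z v)).push b u v).potential a < σ.potential a := by
  set τ := σ.split b (a v - σ.z v) with hτ
  have huv : u ≠ v := fun e => hv (e ▸ hu)
  have hBb : τ.B b = σ.B b := by simp [hτ, State.split, hb.ne]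
  have hwb : τ.w b = a v - σ.z v := by simp [hτ, State.split, hb.ne]
  have h1 := τ.baseGap_push (b := b) (u := u) (v := v) (Nat.lt_succ_of_lt hb) (by rwa [hBb])
    (by rwa [hBb]) hθ hv'
  have h2 : τ.baseGap ≤ σ.baseGap + Fintype.card X ^ 2 := by
    unfold State.baseGap
    change ∑ j ∈ Finset.range (σ.N + 1), ∑ i ∈ Function.update σ.B σ.N (σ.B b) j,
      (Fintype.card X - σ.θ i) ≤ _
    rw [Finset.sum_range_succ, Function.update_self]
    refine add_le_add (le_of_eq (Finset.sum_congr rfl fun j hj => ?_)) (σ.sum_gap_le _)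
    rw [Function.update_of_ne (Finset.mem_range.1 hj).ne]
  have hsub : (τ.push b u v).active a ⊆ τ.active a :=
    τ.active_push_subset (b := b) hθ hva
  have hact : τ.active a = σ.active a := rfl
  rw [hact] at hsub
  have h3 : ((τ.push b u v).active a).card < (σ.active a).card := by
    refine Finset.card_lt_card ⟨hsub, fun hcon => ?_⟩
    have hvmem : v ∈ (τ.push b u v).active a := hcon (by simp [State.active, hva])
    have hz : τ.z = σ.z := rfl
    have hθτ : (τ.push b u v).θ = σ.θ := rfl
    simp only [State.active, Finset.mem_filter, Finset.mem_univ, true_and, hθτ] at hvmem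
    rcases hvmem with h | ⟨y, hy, hvy⟩
    · simp [State.push, hwb, hz] at h
    · simp only [State.push, Function.update_apply, hwb, hz] at hy
      split_ifs at hy with e1 e2
      · subst e1
        omega
      · subst e2
        omega
      · have := hmax y hy
        omega
  have h4 : (τ.push b u v).gap = σ.gap := rfl
  unfold State.potential
  rw [h4]
  have h5 := Nat.mul_le_mul_right (Fintype.card X ^ 2 + 1)
    (Nat.succ_le_of_lt (Nat.add_lt_add_left h3 (σ.gap * (Fintype.card X + 1))))
  rw [Nat.succ_eq_add_one, add_mul _ 1] at h5
  omega

theorem State.potential_le {X : Type*} [Fintype X] {a : X → ℤ} (σ : State X) (hN : σ.N = 1) :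
    σ.potential a ≤ (Fintype.card X ^ 2 * (Fintype.card X + 1) + Fintype.card X) *
      (Fintype.card X ^ 2 + 1) + Fintype.card X ^ 2 := by
  have h1 : σ.baseGap ≤ Fintype.card X ^ 2 := by
    unfold State.baseGap
    rw [hN, Finset.sum_range_one]
    exact σ.sum_gap_le _
  have h2 : σ.gap ≤ Fintype.card X ^ 2 := σ.sum_gap_le _
  have h3 : (σ.active a).card ≤ Fintype.card X := Finset.card_le_univ _
  unfold State.potential
  gcongr

end PushRelabel

/-! ## Asking for an exchange -/

@[simp] theorem Int.toNat_natCast_mul_add (a b c : ℕ) : ((a : ℤ) * b + c).toNat = a * b + c := by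
  exact_mod_cast Int.toNat_natCast (a * b + c)

/-- Put the row at offset `off` of array 6, with the element `o` exchanged for the element `i`, into
array 8 and ask whether it is independent. -/
def Program.askSwap (off o i : ℕ) : Program :=
  .seq (.forRange 5 0 (.write 8 (.var 5) (.arr 6 (.add (.var off) (.var 5)))))
    (.seq (.write 8 (.var o) (.lit 0)) (.seq (.write 8 (.var i) (.lit 1)) (.askIndep 8 8)))

section Specs

variable {n : ℕ} {f : Finset (Fin n) → ℝ} {M : Matroid (Fin n)} {U L : ℕ} {s : Memory}

theorem WP.askSwap (hbd : Bounds n U L) {off o i offN : ℕ} {B : Finset (Fin n)} {o' i' : Fin n}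
    (hn : s.var 0 = n) (hoff : s.var off = offN) (ho : s.var o = (o' : ℕ))
    (hi : s.var i = (i' : ℕ))
    (hrow : ∀ k : Fin n, s.arr 6 (offN + k) = if k ∈ B then 1 else 0)
    (hoff5 : off ≠ 5) (ho5 : o ≠ 5) (hi5 : i ≠ 5) :
    WP f M U L (.askSwap off o i) s fun s' =>
      s'.var 8 = indepAnswer M (insert i' (B.erase o') : Finset (Fin n)) := by
  refine .seq (.forRange (m := n)
    (fun k s' => ∀ j : Fin n, j.val < k → s'.arr 8 j = if j ∈ B then 1 else 0)
    hn hbd.card_le hbd.card_le_bound rfl rfl (by decide) (by simp) ?_ ?_)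
  · intro k hk s' hf hki hI
    have h6 : s'.arr 6 = s.arr 6 := hf.arr 6 rfl
    have h1 : s'.var off = s.var off := hf.var off (by simp [Program.forRange, Program.modVar, hoff5])
    refine .write (fun hb => hb.2 _ _) fun j hj => ?_
    have e1 : (Expr.eval s' (.var 5)).toNat = k := by simp [Expr.eval, hki]
    have e2 : Expr.eval s' (.arr 6 (.add (.var off) (.var 5))) = s.arr 6 (offN + k) := by
      have : ((offN : ℤ) + k).toNat = offN + k := by omega
      simp [Expr.eval, hki, h6, h1, hoff, this]
    rw [e1, e2]
    by_cases hjk : j.val = k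
    · simp only [Memory.setVar_arr, Memory.setArr_arr, hjk]
      rw [← hjk, hrow j]
      simp
    · simpa [hjk] using hI j (by omega)
  · intro s' hf _ hI
    have h1 : s'.var o = s.var o := hf.var o (by simp [Program.forRange, Program.modVar, ho5])
    have h2 : s'.var i = s.var i := hf.var i (by simp [Program.forRange, Program.modVar, hi5])
    -- The removal is written before the insertion, in agreement with `insert i' (B.erase o')` even
    -- if the two elements coincide.
    refine .seq (.write (by simp [Expr.eval]) (.seq (.write (fun _ => by simpa [Expr.eval] using hbd.one_le)
      (.askIndep ?_))))
    simp only [Memory.setVar_var, if_true]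
    congr 1
    ext j
    simp only [Memory.querySet, Expr.eval, Memory.setArr_arr, Memory.setArr_var, true_and, h1, h2, ho,
      hi, Int.toNat_natCast, Finset.coe_insert, Finset.coe_erase, Set.mem_insert_iff, Set.mem_sdiff,
      Finset.mem_coe, Set.mem_singleton_iff, Fin.val_inj, Set.mem_ofPred_eq]
    rw [hI j j.isLt]
    split_ifs with e1 e2 e3 <;> simp_all

/-! ## A round of the push-relabel algorithm -/

/-- The memory holds the state `σ`: the bases are the rows of array 6, the coefficients are in array
7, their combination in array 9, and the levels in array 5. -/
structure Stores (s : Memory) (σ : State (Fin n)) : Prop where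
  card : s.var 0 = n
  N : s.var 2 = σ.N
  B : ∀ j < σ.N, ∀ i : Fin n, s.arr 6 (j * n + i) = if i ∈ σ.B j then 1 else 0
  w : ∀ j < σ.N, s.arr 7 j = σ.w j
  z : ∀ i : Fin n, s.arr 9 i = σ.z i
  θ : ∀ i : Fin n, s.arr 5 i = σ.θ i

theorem Stores.of_frame {s' : Memory} {σ : State (Fin n)} (h : Stores s σ) {c : Program}
    (hf : Frame c s s') (h0 : c.modVar 0 = false) (h2 : c.modVar 2 = false)
    (h5 : c.modArr 5 = false) (h6 : c.modArr 6 = false) (h7 : c.modArr 7 = false)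
    (h9 : c.modArr 9 = false) : Stores s' σ := by
  refine ⟨?_, ?_, ?_, ?_, ?_, ?_⟩
  · rw [hf.var 0 h0, h.card]
  · rw [hf.var 2 h2, h.N]
  · rw [hf.arr 6 h6]
    exact h.B
  · rw [hf.arr 7 h7]
    exact h.w
  · rw [hf.arr 9 h9]
    exact h.z
  · rw [hf.arr 5 h5]
    exact h.θ

/-- Look for a deficient element of highest level: it is put into variable 6 and its level into
variable 9, which gets `-1` if there is none. -/
def Program.findDeficient : Program :=
  .seq (.assign 9 (.lit (-1))) (.forRange 3 0
    (.ifPos (.sub (.arr 3 (.var 3)) (.arr 9 (.var 3)))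
      (.ifPos (.sub (.arr 5 (.var 3)) (.var 9))
        (.seq (.assign 6 (.var 3)) (.assign 9 (.arr 5 (.var 3)))) .skip) .skip))

theorem WP.findDeficient (hbd : Bounds n U L) {σ : State (Fin n)} (hσ : Stores s σ) {a : Fin n → ℤ}
    (ha : ∀ i : Fin n, s.arr 3 i = a i) :
    WP f M U L .findDeficient s fun s' => (s'.var 9 = -1 ∧ ∀ i, a i ≤ σ.z i) ∨
      ∃ v : Fin n, s'.var 6 = (v : ℕ) ∧ s'.var 9 = σ.θ v ∧ σ.z v < a v ∧
        ∀ i, σ.z i < a i → σ.θ i ≤ σ.θ v := by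
  refine .seq (.assign (fun _ => by simpa [Expr.eval] using hbd.one_le) ?_)
  refine .forRange (m := n) (fun k s' =>
      (s'.var 9 = -1 ∧ ∀ i : Fin n, i.val < k → a i ≤ σ.z i) ∨
      ∃ v : Fin n, s'.var 6 = (v : ℕ) ∧ s'.var 9 = σ.θ v ∧ σ.z v < a v ∧
        ∀ i : Fin n, i.val < k → σ.z i < a i → σ.θ i ≤ σ.θ v)
    (by simp [hσ.card]) hbd.card_le hbd.card_le_bound rfl rfl (by decide)
    (Or.inl ⟨by simp [Expr.eval], by simp⟩) ?_ ?_
  · intro k hk s' hf hki hI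
    have h3 : s'.arr 3 = s.arr 3 := hf.arr 3 rfl
    have h5 : s'.arr 5 = s.arr 5 := hf.arr 5 rfl
    have h9 : s'.arr 9 = s.arr 9 := hf.arr 9 rfl
    have ea : s.arr 3 k = a ⟨k, hk⟩ := ha ⟨k, hk⟩
    have ez : s.arr 9 k = σ.z ⟨k, hk⟩ := hσ.z ⟨k, hk⟩
    have eθ : s.arr 5 k = σ.θ ⟨k, hk⟩ := hσ.θ ⟨k, hk⟩
    have hlt (i : Fin n) (hi : i.val < k + 1) : i.val < k ∨ i = ⟨k, hk⟩ := by
      rcases Nat.lt_succ_iff_lt_or_eq.1 hi with h | h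
      · exact Or.inl h
      · exact Or.inr (Fin.ext h)
    refine .ifPos (fun hd => ?_) (fun hd => .skip ?_)
    · simp only [Expr.eval, hki, Int.toNat_natCast, h3, h9, ea, ez] at hd
      refine .ifPos (fun hl => ?_) (fun hl => .skip ?_)
      · simp only [Expr.eval, hki, Int.toNat_natCast, h5, eθ] at hl
        refine .seq (.assign (fun hb => hb.1 _) (.assign (fun hb => hb.2 _ _) ?_))
        refine Or.inr ⟨⟨k, hk⟩, by simp [Expr.eval, hki], by simp [Expr.eval, hki, h5, eθ],
          by omega, fun i hi hia => ?_⟩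
        rcases hlt i hi with h | rfl
        · rcases hI with ⟨-, hI⟩ | ⟨v, -, hv, -, hI⟩
          · exact absurd hia (not_lt.2 (hI i h))
          · have := hI i h hia
            omega
        · rfl
      · simp only [Expr.eval, hki, Int.toNat_natCast, h5, eθ] at hl
        rcases hI with ⟨h, -⟩ | ⟨v, hv6, hv9, hva, hI⟩
        · omega
        · refine Or.inr ⟨v, by simpa using hv6, by simpa using hv9, hva, fun i hi hia => ?_⟩
          rcases hlt i hi with h | rfl
          · exact hI i h hia
          · omega
    · simp only [Expr.eval, hki, Int.toNat_natCast, h3, h9, ea, ez] at hd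
      rcases hI with ⟨h, hI⟩ | ⟨v, hv6, hv9, hva, hI⟩
      · refine Or.inl ⟨by simpa using h, fun i hi => ?_⟩
        rcases hlt i hi with h | rfl
        · exact hI i h
        · omega
      · refine Or.inr ⟨v, by simpa using hv6, by simpa using hv9, hva, fun i hi hia => ?_⟩
        rcases hlt i hi with h | rfl
        · exact hI i h hia
        · omega
  · intro s' _ _ hI
    rcases hI with ⟨h, hI⟩ | ⟨v, hv6, hv9, hva, hI⟩
    · exact Or.inl ⟨h, fun i => hI i i.isLt⟩
    · exact Or.inr ⟨v, hv6, hv9, hva, fun i => hI i i.isLt⟩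

/-- Whether the element in variable 6 may be pushed: positive if and only if the exchange of the
element in variable 3 for it, in the row at the offset in variable 12, is possible and goes one
level down. -/
def canPush : Expr :=
  .mul (.var 8) (.mul (.mul (.sub (.lit 1) (.arr 6 (.add (.var 12) (.var 6))))
    (.arr 6 (.add (.var 12) (.var 3))))
    (.sub (.lit 1) (.mul (.sub (.sub (.arr 5 (.var 6)) (.arr 5 (.var 3))) (.lit 1))
      (.sub (.sub (.arr 5 (.var 6)) (.arr 5 (.var 3))) (.lit 1)))))

/-- Look for a base and an element to push out of it for the element in variable 6: they are put
into the variables 10 and 11, and variable 10 gets `-1` if there are none. -/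
def Program.findPush : Program :=
  .seq (.assign 10 (.lit (-1))) (.forRange 4 2
    (.seq (.assign 12 (.mul (.var 4) (.var 0)))
      (.forRange 3 0 (.seq (.askSwap 12 3 6)
        (.ifPos canPush (.seq (.assign 10 (.var 4)) (.assign 11 (.var 3))) .skip)))))

/-- Programs can only test positivity: a product of indicators expresses a conjunction, and `1 - d *
d` tests whether the integer `d` is zero. -/
theorem mul_indicator_pos_iff {p q r : Prop} [Decidable p] [Decidable q] [Decidable r] {d : ℤ} :
    0 < (if p then (1 : ℤ) else 0) * (((1 - if q then 1 else 0) * if r then 1 else 0) *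
      (1 - d * d)) ↔ p ∧ ¬ q ∧ r ∧ d = 0 := by
  have hd : 0 < 1 - d * d ↔ d = 0 := by
    constructor
    · intro h
      have h1 : d < 1 := by nlinarith
      have h2 : -1 < d := by nlinarith
      omega
    · rintro rfl
      norm_num
  split_ifs <;> simp_all

theorem WP.findPush (hbd : Bounds n U L) {σ : State (Fin n)} (hσ : Stores s σ) (hN : σ.N ≤ L)
    (hbase : ∀ j < σ.N, M.IsBase (σ.B j)) {v : Fin n} (hv : s.var 6 = (v : ℕ)) :
    WP f M U L .findPush s fun s' =>
      (s'.var 10 = -1 ∧ ∀ j < σ.N, ∀ u, σ.CanSwap M j u v → σ.θ v ≠ σ.θ u + 1) ∨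
      ∃ b < σ.N, ∃ u : Fin n, s'.var 10 = b ∧ s'.var 11 = (u : ℕ) ∧ σ.CanSwap M b u v ∧
        σ.θ v = σ.θ u + 1 := by
  set P : ℕ → Fin n → Prop := fun j u => σ.CanSwap M j u v ∧ σ.θ v = σ.θ u + 1 with hP
  refine .seq (.assign (fun _ => by simpa [Expr.eval] using hbd.one_le) ?_)
  set s₀ := s.setVar 10 (Expr.eval s (.lit (-1))) with hs₀
  have hσ₀ : Stores s₀ σ := ⟨by simp [hs₀, hσ.card], by simp [hs₀, hσ.N], hσ.B, hσ.w, hσ.z, hσ.θ⟩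
  refine .forRange (m := σ.N) (fun k s' => (s'.var 10 = -1 ∧ ∀ j < k, ∀ u, ¬ P j u) ∨
      ∃ b < σ.N, ∃ u : Fin n, s'.var 10 = b ∧ s'.var 11 = (u : ℕ) ∧ P b u)
    hσ₀.N hN (hN.trans hbd.length_le_bound) rfl rfl (by decide)
    (Or.inl ⟨by simp [hs₀, Expr.eval], by simp⟩) ?_ ?_
  · intro j hj s₁ hf hkj hI
    have hσ₁ : Stores s₁ σ := hσ₀.of_frame hf rfl rfl rfl rfl rfl rfl
    have hv₁ : s₁.var 6 = (v : ℕ) := by rw [hf.var 6 rfl]; simp [hs₀, hv]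
    have hjn : Expr.eval s₁ (.mul (.var 4) (.var 0)) = ((j * n : ℕ) : ℤ) := by
      simp [Expr.eval, hkj, hσ₁.card]
    -- The offset of a row has to fit into a cell; `Bounds.mul_le` provides for this.
    have hjnU : j * n ≤ U :=
      (Nat.mul_le_mul (hj.le.trans hN) (Nat.le_succ n)).trans hbd.mul_le
    refine .seq (.assign (fun _ => by rw [hjn]; exact_mod_cast hjnU) ?_)
    rw [hjn]
    refine .forRange (m := n) (fun k s' =>
        (s'.var 10 = -1 ∧ (∀ j' < j, ∀ u, ¬ P j' u) ∧ ∀ u : Fin n, u.val < k → ¬ P j u) ∨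
        ∃ b < σ.N, ∃ u : Fin n, s'.var 10 = b ∧ s'.var 11 = (u : ℕ) ∧ P b u)
      (by simp [hσ₁.card]) hbd.card_le hbd.card_le_bound rfl rfl (by decide) ?_ ?_ ?_
    · rcases hI with ⟨h, hI⟩ | ⟨b, hb, u, hb10, hu11, hI⟩
      · exact Or.inl ⟨by simpa using h, hI, by simp⟩
      · exact Or.inr ⟨b, hb, u, by simpa using hb10, by simpa using hu11, hI⟩
    · intro k hk s₂ hf₂ hk₂ hI₂
      have hσ₂ : Stores s₂ σ := Stores.of_frame
        (s := s₁.setVar 12 ((j * n : ℕ) : ℤ))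
        ⟨by simp [hσ₁.card], by simp [hσ₁.N], hσ₁.B, hσ₁.w, hσ₁.z, hσ₁.θ⟩
        hf₂ rfl rfl rfl rfl rfl rfl
      have hv₂ : s₂.var 6 = (v : ℕ) := by rw [hf₂.var 6 rfl]; simp [hv₁]
      have h12 : s₂.var 12 = ((j * n : ℕ) : ℤ) := by rw [hf₂.var 12 rfl]; simp
      have h4 : s₂.var 4 = j := by rw [hf₂.var 4 rfl]; simp [hkj]
      refine .seq ((WP.askSwap hbd (o' := ⟨k, hk⟩) (i' := v) hσ₂.card h12 hk₂ hv₂ (hσ₂.B j hj)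
        (by decide) (by decide) (by decide)).mono fun s₃ hf₃ _ h8 => ?_)
      have hσ₃ : Stores s₃ σ := hσ₂.of_frame hf₃ rfl rfl rfl rfl rfl rfl
      have hv₃ : s₃.var 6 = (v : ℕ) := by rw [hf₃.var 6 rfl, hv₂]
      have h12₃ : s₃.var 12 = ((j * n : ℕ) : ℤ) := by rw [hf₃.var 12 rfl, h12]
      have hk₃ : s₃.var 3 = k := by rw [hf₃.var 3 rfl, hk₂]
      have h4₃ : s₃.var 4 = j := by rw [hf₃.var 4 rfl, h4]
      have h10₃ : s₃.var 10 = s₂.var 10 := hf₃.var 10 rfl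
      have h11₃ : s₃.var 11 = s₂.var 11 := hf₃.var 11 rfl
      have e1 : s₃.arr 6 (j * n + k) = if (⟨k, hk⟩ : Fin n) ∈ σ.B j then 1 else 0 :=
        hσ₃.B j hj ⟨k, hk⟩
      have e2 : s₃.arr 5 k = σ.θ ⟨k, hk⟩ := hσ₃.θ ⟨k, hk⟩
      have hcond : 0 < canPush.eval s₃ ↔ P j ⟨k, hk⟩ := by
        simp only [canPush, Expr.eval, h8, h12₃, hv₃, hk₃, Int.toNat_natCast, Nat.cast_mul,
          Int.toNat_natCast_mul_add, e1, e2, hσ₃.B j hj v, hσ₃.θ v, indepAnswer]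
        classical
        rw [mul_indicator_pos_iff]
        simp only [hP, State.CanSwap]
        -- The oracle tells only independence; a swap in a base that stays independent is again a
        -- base.
        constructor
        · rintro ⟨h1, h2, h3, h4⟩
          exact ⟨⟨h3, h2, (hbase j hj).insert_erase_of_indep h2 h1⟩, by omega⟩
        · rintro ⟨⟨h3, h2, h1⟩, h4⟩
          exact ⟨h1.indep, h2, h3, by omega⟩
      refine .ifPos (fun h => ?_) (fun h => .skip ?_)
      · refine .seq (.assign (fun hb => hb.1 _) (.assign (fun hb => hb.1 _) ?_))
        exact Or.inr ⟨j, hj, ⟨k, hk⟩, by simp [Expr.eval, h4₃], by simp [Expr.eval, hk₃],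
          hcond.1 h⟩
      · rw [hcond] at h
        rcases hI₂ with ⟨h', hI, hI'⟩ | ⟨b, hb, u, hb10, hu11, hI⟩
        · refine Or.inl ⟨by simpa [h10₃] using h', hI, fun u hu => ?_⟩
          rcases Nat.lt_succ_iff_lt_or_eq.1 hu with h' | h'
          · exact hI' u h'
          · obtain rfl : u = ⟨k, hk⟩ := Fin.ext h'
            exact h
        · exact Or.inr ⟨b, hb, u, by simpa [h10₃] using hb10, by simpa [h11₃] using hu11, hI⟩
    · intro s₂ _ _ hI₂
      rcases hI₂ with ⟨h', hI, hI'⟩ | ⟨b, hb, u, hb10, hu11, hI⟩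
      · refine Or.inl ⟨by simpa using h', fun j' hj' u => ?_⟩
        rcases Nat.lt_succ_iff_lt_or_eq.1 hj' with h | rfl
        · exact hI j' h u
        · exact hI' u u.isLt
      · exact Or.inr ⟨b, hb, u, by simpa using hb10, by simpa using hu11, hI⟩
  · intro s' _ _ hI
    rcases hI with ⟨h, hI⟩ | ⟨b, hb, u, hb10, hu11, hI⟩
    · exact Or.inl ⟨h, fun j hj u hs hθ => hI j hj u ⟨hs, hθ⟩⟩
    · exact Or.inr ⟨b, hb, u, hb10, hu11, hI.1, hI.2⟩

end Specs

/-! ### Row addressing, splitting and pushing in memory -/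

theorem mul_add_lt_mul {b N n i : ℕ} (hb : b < N) (hi : i < n) : b * n + i < N * n := by
  have := Nat.mul_le_mul_right n (Nat.succ_le_of_lt hb)
  rw [Nat.succ_mul] at this
  omega

theorem mul_add_inj {n j j' : ℕ} {i i' : Fin n} :
    j * n + i = j' * n + i' ↔ j = j' ∧ i = i' := by
  constructor
  · intro h
    rcases lt_trichotomy j j' with hj | rfl | hj
    · have := mul_add_lt_mul hj i.isLt
      omega
    · exact ⟨rfl, Fin.ext (by omega)⟩
    · have := mul_add_lt_mul hj i'.isLt
      omega
  · rintro ⟨rfl, rfl⟩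
    rfl

/-- The deficit of the element in variable 6. -/
def Expr.deficit : Expr := .sub (.arr 3 (.var 6)) (.arr 9 (.var 6))

/-- Split off a new copy of the base in variable 10, leaving it the deficit of the element in variable
6 as its coefficient. -/
def Program.split : Program :=
  .seq (.forRange 5 0 (.write 6 (.add (.mul (.var 2) (.var 0)) (.var 5))
      (.arr 6 (.add (.mul (.var 10) (.var 0)) (.var 5)))))
    (.seq (.write 7 (.var 2) (.sub (.arr 7 (.var 10)) .deficit))
      (.seq (.write 7 (.var 10) .deficit) (.assign 2 (.add (.var 2) (.lit 1)))))

/-- Exchange the element in variable 11 for the element in variable 6 in the base in variable 10. -/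
def Program.push : Program :=
  .seq (.write 9 (.var 11) (.sub (.arr 9 (.var 11)) (.arr 7 (.var 10))))
    (.seq (.write 9 (.var 6) (.add (.arr 9 (.var 6)) (.arr 7 (.var 10))))
      (.seq (.write 6 (.add (.mul (.var 10) (.var 0)) (.var 11)) (.lit 0))
        (.write 6 (.add (.mul (.var 10) (.var 0)) (.var 6)) (.lit 1))))

/-- A round of the push-relabel algorithm; variable 13 gets `0` if no element is deficient. -/
def Program.pushRelabelRound : Program :=
  .seq .findDeficient (.ifPos (.add (.var 9) (.lit 1))
    (.seq .findPush (.ifPos (.add (.var 10) (.lit 1))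
      (.seq (.ifPos (.sub (.arr 7 (.var 10)) .deficit) .split .skip) .push)
      (.write 5 (.var 6) (.add (.arr 5 (.var 6)) (.lit 1)))))
    (.assign 13 (.lit 0)))

/-- The push-relabel algorithm. -/
def Program.pushRelabel : Program :=
  .seq (.assign 13 (.lit 1)) (.whilePos (.var 13) .pushRelabelRound)

section Specs

variable {n : ℕ} {f : Finset (Fin n) → ℝ} {M : Matroid (Fin n)} {U L : ℕ} {s : Memory}

theorem WP.split (hbd : Bounds n U L) {σ : State (Fin n)} (hσ : Stores s σ) {a : Fin n → ℤ}
    (ha : ∀ i : Fin n, s.arr 3 i = a i) {b : ℕ} (hb : b < σ.N) {v : Fin n} (hb10 : s.var 10 = b)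
    (hv6 : s.var 6 = (v : ℕ)) (hN : σ.N < L) (hd : 0 ≤ a v - σ.z v)
    (hdw : a v - σ.z v ≤ σ.w b) :
    WP f M U L .split s fun s' => Stores s' (σ.split b (a v - σ.z v)) := by
  refine .seq (.forRange (m := n) (fun k s' => (∀ l < σ.N * n, s'.arr 6 l = s.arr 6 l) ∧
      ∀ i < k, s'.arr 6 (σ.N * n + i) = s.arr 6 (b * n + i))
    hσ.card hbd.card_le hbd.card_le_bound rfl rfl (by decide) (by simp) ?_ ?_)
  · intro k hk s' hf hki hI
    have h2 : s'.var 2 = σ.N := by rw [hf.var 2 rfl, hσ.N]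
    have h0 : s'.var 0 = n := by rw [hf.var 0 rfl, hσ.card]
    have h10 : s'.var 10 = b := by rw [hf.var 10 rfl, hb10]
    refine .write (fun hb => hb.2 _ _) ?_
    simp only [Expr.eval, h2, h0, h10, hki, Int.toNat_natCast_mul_add, Memory.setVar_arr,
      Memory.setArr_arr, true_and]
    refine ⟨fun l hl => ?_, fun i hi => ?_⟩
    · rw [if_neg (by omega), hI.1 l hl]
    · by_cases hik : i = k
      · subst hik
        rw [if_pos rfl]
        exact hI.1 _ (mul_add_lt_mul hb hk)
      · rw [if_neg (by omega)]
        exact hI.2 i (by omega)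
  · intro s' hf hB' hI
    have h2 : s'.var 2 = σ.N := by rw [hf.var 2 rfl, hσ.N]
    have h0 : s'.var 0 = n := by rw [hf.var 0 rfl, hσ.card]
    have h10 : s'.var 10 = b := by rw [hf.var 10 rfl, hb10]
    have h6 : s'.var 6 = (v : ℕ) := by rw [hf.var 6 rfl, hv6]
    have h7 : s'.arr 7 = s.arr 7 := hf.arr 7 rfl
    have h3 : s'.arr 3 = s.arr 3 := hf.arr 3 rfl
    have h9 : s'.arr 9 = s.arr 9 := hf.arr 9 rfl
    have h5 : s'.arr 5 = s.arr 5 := hf.arr 5 rfl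
    have e7 := hσ.w b hb
    have e3 := ha v
    have e9 := hσ.z v
    have hbN : b ≠ σ.N := hb.ne
    have hbU := hB'.2 7 b
    rw [h7, e7] at hbU
    -- The coefficient of the copy is written first because it reads the old coefficient of `b`.
    -- Both parts lie between `0` and `σ.w b`, hence within the bound.
    refine .seq (.write (fun _ => ?_) (.seq (.write (fun _ => ?_) (.assign (fun _ => ?_) ?_))))
    · simp only [Expr.eval, Expr.deficit, h10, h6, h7, h3, h9, Int.toNat_natCast, e7, e3, e9]
      omega
    · simp only [Expr.eval, Expr.deficit, h6, Int.toNat_natCast, Memory.setArr_arr,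
        Memory.setArr_var, show ¬ ((3 : ℕ) = 7) by decide, show ¬ ((9 : ℕ) = 7) by decide,
        false_and, if_false, h3, h9, e3, e9]
      omega
    · have := hbd.length_le_bound
      simp only [Expr.eval, Memory.setArr_var, h2]
      omega
    · simp only [Expr.eval, Expr.deficit, Memory.setArr_var, h10, h6, h2, h7, h3, h9,
        Int.toNat_natCast, e7, e3, e9, Memory.setArr_arr]
      simp only [show ¬ ((3 : ℕ) = 7) by decide, show ¬ ((9 : ℕ) = 7) by decide, false_and,
        if_false]
      refine ⟨by simp [h0], by simp [State.split], fun j hj i => ?_, fun j hj => ?_, fun i => ?_,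
        fun i => ?_⟩
      · simp only [State.split] at hj
        simp only [Memory.setVar_arr, Memory.setArr_arr, show ¬ ((6 : ℕ) = 7) by decide, false_and,
          if_false]
        by_cases hjN : j = σ.N
        · subst hjN
          rw [hI.2 i i.isLt, hσ.B b hb i]
          simp [State.split]
        · rw [hI.1 _ (mul_add_lt_mul (by omega) i.isLt), hσ.B j (by omega) i]
          simp [State.split, hjN]
      · simp only [State.split] at hj
        by_cases hjN : j = σ.N
        · subst hjN
          simp [State.split, hbN.symm]
        · by_cases hjb : j = b
          · subst hjb
            simp [State.split, hjN]
          · simp [State.split, hjN, hjb, h7, hσ.w j (by omega)]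
      · simp [h9, hσ.z i, State.split]
      · simp [h5, hσ.θ i, State.split]

theorem WP.push (hbd : Bounds n U L) {σ : State (Fin n)} (hσ : Stores s σ) {b : ℕ} (hb : b < σ.N)
    {u v : Fin n} (huv : u ≠ v) (hb10 : s.var 10 = b) (hu11 : s.var 11 = (u : ℕ))
    (hv6 : s.var 6 = (v : ℕ)) (hz : ∀ i, ((σ.push b u v).z i).natAbs ≤ U) :
    WP f M U L .push s fun s' => Stores s' (σ.push b u v) := by
  have hzu := hz u
  have hzv := hz v
  simp only [State.push, Function.update_self, Function.update_of_ne huv] at hzu hzv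
  have e7 := hσ.w b hb
  have eu := hσ.z u
  have ev := hσ.z v
  have hvu : ¬ (v : ℕ) = u := fun h => huv (Fin.ext h.symm)
  refine .seq (.write (fun _ => ?_) (.seq (.write (fun _ => ?_) (.seq (.write (fun _ => ?_)
    (.write (fun _ => ?_) ?_))))))
  · simpa [Expr.eval, hb10, hu11, e7, eu] using hzu
  · simpa [Expr.eval, hb10, hu11, hv6, e7, ev, hvu] using hzv
  · simp [Expr.eval]
  · simpa [Expr.eval] using hbd.one_le
  · simp only [Expr.eval, Memory.setArr_var, hb10, hu11, hv6, hσ.card, Int.toNat_natCast_mul_add,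
      Int.toNat_natCast, e7, eu, ev, Memory.setArr_arr]
    refine ⟨hσ.card, hσ.N, fun j hj i => ?_, fun j hj => ?_, fun i => ?_, fun i => ?_⟩
    · simp only [Memory.setArr_arr, mul_add_inj, true_and, show ¬ ((6 : ℕ) = 9) by decide, false_and,
        if_false]
      rw [hσ.B j hj i]
      by_cases hjb : j = b
      · subst hjb
        simp only [State.push, Function.update_self, Finset.mem_insert, Finset.mem_erase, true_and]
        by_cases h1 : i = v
        · simp [h1]
        · by_cases h2 : i = u
          · simp [h2, huv]
          · simp [h1, h2]
      · simp [State.push, hjb]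
    · simpa [State.push] using hσ.w j hj
    · simp only [State.push, Function.update_apply, Memory.setArr_arr, true_and, Fin.val_inj,
        show ¬ ((9 : ℕ) = 6) by decide, false_and, if_false]
      by_cases h1 : i = v
      · simp [h1, huv.symm]
      · by_cases h2 : i = u
        · simp [h2, huv]
        · simp [h1, h2, hσ.z i]
    · simpa [State.push] using hσ.θ i

/-- A split adds one base but costs at least one unit of potential, so `σ.N + σ.potential a ≤ K`
persists. Thus `K` bounds the number of bases throughout. -/
theorem WP.pushRelabelRound (hbd : Bounds n U L) {σ : State (Fin n)} (hσ : Stores s σ)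
    {a : Fin n → ℤ} (ha : ∀ i : Fin n, s.arr 3 i = a i) {D : ℤ} (hinv : σ.Inv M D a)
    (hrank : SatisfiesRank M D a) (hD : D ≤ U) {K : ℕ} (hK : σ.N + σ.potential a ≤ K) (hKL : K ≤ L)
    (h13 : s.var 13 = 1) :
    WP f M U L .pushRelabelRound s fun s' =>
      (∃ σ' : State (Fin n), Stores s' σ' ∧ σ'.Inv M D a ∧ σ'.N + σ'.potential a ≤ K ∧
        σ'.potential a < σ.potential a ∧ s'.var 13 = 1) ∨
      (s'.var 13 = 0 ∧ Stores s' σ ∧ ∀ i, a i ≤ σ.z i) := by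
  refine .seq ((WP.findDeficient hbd hσ ha).mono fun s₁ hf₁ _ h₁ => ?_)
  have hσ₁ : Stores s₁ σ := hσ.of_frame hf₁ rfl rfl rfl rfl rfl rfl
  refine .ifPos (fun hpos => ?_) (fun hneg => ?_)
  swap
  · refine .assign (by simp [Expr.eval]) (Or.inr ⟨by simp [Expr.eval], ?_, ?_⟩)
    · exact ⟨by simp [hσ₁.card], by simp [hσ₁.N], hσ₁.B, hσ₁.w, hσ₁.z, hσ₁.θ⟩
    · rcases h₁ with ⟨-, h⟩ | ⟨v, -, h9, -⟩
      · exact h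
      · simp only [Expr.eval, h9] at hneg
        omega
  rcases h₁ with ⟨h9, -⟩ | ⟨v, h6, -, hva, hmax⟩
  · simp [Expr.eval, h9] at hpos
  refine .seq ((WP.findPush (M := M) hbd hσ₁ (by omega)
    (fun j hj => hinv.comb.base j (Nat.zero_le _) hj) h6).mono fun s₂ hf₂ _ h₂ => ?_)
  have hσ₂ : Stores s₂ σ := hσ₁.of_frame hf₂ rfl rfl rfl rfl rfl rfl
  have h6₂ : s₂.var 6 = (v : ℕ) := by rw [hf₂.var 6 rfl, h6]
  have h13₂ : s₂.var 13 = 1 := by rw [hf₂.var 13 rfl, hf₁.var 13 rfl, h13]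
  have ha₂ : ∀ i : Fin n, s₂.arr 3 i = a i := by rwa [hf₂.arr 3 rfl, hf₁.arr 3 rfl]
  have hvlt : σ.θ v < n := by simpa using hinv.level_lt hrank hva
  refine .ifPos (fun hpos => ?_) (fun hneg => ?_)
  swap
  · have hno : ∀ j < σ.N, ∀ u, σ.CanSwap M j u v → σ.θ v ≠ σ.θ u + 1 := by
      rcases h₂ with ⟨-, h⟩ | ⟨b, -, u, h10, -⟩
      · exact h
      · simp only [Expr.eval, h10] at hneg
        omega
    have hev : Expr.eval s₂ (.add (.arr 5 (.var 6)) (.lit 1)) = ((σ.θ v + 1 : ℕ) : ℤ) := by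
      simp [Expr.eval, h6₂, hσ₂.θ v]
    have hpot := σ.potential_lift (a := a) (by simpa using hvlt) hva
    refine .write (fun _ => ?_) (Or.inl ⟨σ.lift v, ?_, hinv.lift hrank hva hno, ?_, hpot, ?_⟩)
    · rw [hev]
      have := hbd.card_le_bound
      omega
    · rw [hev]
      refine ⟨hσ₂.card, hσ₂.N, hσ₂.B, hσ₂.w, hσ₂.z, fun i => ?_⟩
      simp only [Expr.eval, h6₂, Int.toNat_natCast, Memory.setArr_arr, true_and, Fin.val_inj,
        State.lift, Function.update_apply]
      split_ifs
      · rfl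
      · exact hσ₂.θ i
    · change σ.N + _ ≤ K
      omega
    · simpa using h13₂
  rcases h₂ with ⟨h10, -⟩ | ⟨b, hb, u, h10, h11, hswap, hθ⟩
  · simp [Expr.eval, h10] at hpos
  have huv : u ≠ v := fun e => hswap.2.1 (e ▸ hswap.1)
  have hcond : Expr.eval s₂ (.sub (.arr 7 (.var 10)) .deficit) = σ.w b - (a v - σ.z v) := by
    simp [Expr.eval, Expr.deficit, h10, h6₂, hσ₂.w b hb, hσ₂.z v, ha₂ v]
  have hvle : σ.θ v ≤ Fintype.card (Fin n) := hinv.level_le v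
  have hpush {τ : State (Fin n)} (hτ : (τ.push b u v).Inv M D a) (i : Fin n) :
      ((τ.push b u v).z i).natAbs ≤ U := by
    have h1 := hτ.comb.point_nonneg i
    have h2 := hτ.comb.point_le i
    omega
  refine .seq (.ifPos (fun hlt => ?_) (fun hle => .skip ?_))
  · rw [hcond] at hlt
    have hinv' := hinv.split hb (d := a v - σ.z v) (by omega) (by omega)
    have hswap' : (σ.split b (a v - σ.z v)).CanSwap M b u v := by
      simpa [State.CanSwap, State.split, hb.ne] using hswap
    have hinv'' := hinv'.push (Nat.lt_succ_of_lt hb) hswap' hθ (by simp [State.split, hb.ne])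
    have hpot := σ.potential_split_push (a := a) hb hswap.1 hswap.2.1 hθ hvle hva hmax
    refine (WP.split hbd hσ₂ ha₂ hb h10 h6₂ (by omega) (by omega) (by omega)).mono
      fun s₃ hf₃ _ hσ₃ => ?_
    refine (WP.push hbd hσ₃ (Nat.lt_succ_of_lt hb) huv (by rw [hf₃.var 10 rfl, h10])
      (by rw [hf₃.var 11 rfl, h11]) (by rw [hf₃.var 6 rfl, h6₂]) (hpush hinv'')).mono
      fun s₄ hf₄ _ hσ₄ => Or.inl ⟨_, hσ₄, hinv'', ?_, hpot, ?_⟩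
    · change σ.N + 1 + _ ≤ K
      omega
    · rw [hf₄.var 13 rfl, hf₃.var 13 rfl, h13₂]
  · rw [hcond] at hle
    have hinv' := hinv.push hb hswap hθ (by omega)
    have hpot := σ.potential_push (a := a) hb hswap.1 hswap.2.1 hθ hvle hva
    refine (WP.push hbd hσ₂ hb huv h10 h11 h6₂ (hpush hinv')).mono
      fun s₄ hf₄ _ hσ₄ => Or.inl ⟨_, hσ₄, hinv', ?_, hpot, ?_⟩
    · change σ.N + _ ≤ K
      omega
    · rw [hf₄.var 13 rfl, h13₂]

theorem WP.pushRelabel (hbd : Bounds n U L) {σ : State (Fin n)} (hσ : Stores s σ)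
    {a : Fin n → ℤ} (ha : ∀ i : Fin n, s.arr 3 i = a i) {D : ℤ} (hinv : σ.Inv M D a)
    (hrank : SatisfiesRank M D a) (hD : D ≤ U) {K : ℕ} (hK : σ.N + σ.potential a ≤ K)
    (hKL : K ≤ L) :
    WP f M U L .pushRelabel s fun s' => ∃ σ' : State (Fin n), Stores s' σ' ∧ σ'.Inv M D a ∧
      σ'.N ≤ K ∧ ∀ i, a i ≤ σ'.z i := by
  refine .seq (.assign (fun _ => by simpa [Expr.eval] using hbd.one_le) ?_)
  -- The variant is the potential plus one while the flag is set and `0` afterwards, so the last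
  -- round decreases it too. The extra one fits below `L` because there is at least one base.
  refine .whilePos (fun k s' => ∃ σ' : State (Fin n), Stores s' σ' ∧ σ'.Inv M D a ∧
      σ'.N + σ'.potential a ≤ K ∧ (∀ i : Fin n, s'.arr 3 i = a i) ∧
      ((s'.var 13 = 1 ∧ k = σ'.potential a + 1) ∨
        (s'.var 13 = 0 ∧ k = 0 ∧ ∀ i, a i ≤ σ'.z i))) (m := σ.potential a + 1)
    ⟨σ, ⟨by simp [hσ.card], by simp [hσ.N], hσ.B, hσ.w, hσ.z, hσ.θ⟩, hinv, hK, ha,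
      Or.inl ⟨by simp [Expr.eval], rfl⟩⟩ ?_ ?_ ?_
  · have := hinv.pos
    omega
  · rintro k s' ⟨σ', hσ', hinv', hK', ha', ⟨h13, rfl⟩ | ⟨h13, -⟩⟩ hpos
    · refine (WP.pushRelabelRound hbd hσ' ha' hinv' hrank hD hK' hKL h13).mono
        fun s'' hf _ h => ?_
      have ha'' : ∀ i : Fin n, s''.arr 3 i = a i := by rwa [hf.arr 3 rfl]
      rcases h with ⟨τ, hτ, hτi, hτK, hlt, h13'⟩ | ⟨h13', hτ, hge⟩
      · exact ⟨_, by omega, τ, hτ, hτi, hτK, ha'', Or.inl ⟨h13', rfl⟩⟩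
      · exact ⟨0, by omega, σ', hτ, hinv', hK', ha'', Or.inr ⟨h13', rfl, hge⟩⟩
    · simp [Expr.eval, h13] at hpos
  · rintro k s' ⟨σ', hσ', hinv', hK', ha', ⟨h13, rfl⟩ | ⟨h13, -, hge⟩⟩ hneg
    · simp [Expr.eval, h13] at hneg
    · exact ⟨σ', hσ', hinv', by omega, hge⟩

end Specs

/-! ## Initialization -/

/-- Put the product of the denominators into variable 1. -/
def Program.commonDenominator : Program :=
  .seq (.assign 1 (.lit 1)) (.forRange 3 0 (.assign 1 (.mul (.var 1) (.arr 1 (.var 3)))))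

/-- Scale the input to the common denominator and find a base by the greedy algorithm. -/
def Program.startFlow : Program :=
  .seq .commonDenominator (.seq
    (.forRange 3 0 (.seq (.write 3 (.var 3) (.mul (.arr 0 (.var 3)) (.div (.var 1) (.arr 1 (.var 3)))))
      (.seq (.write 10 (.var 3) (.arr 3 (.var 3)))
      (.seq (.write 4 (.var 3) (.var 1))
      (.seq (.write 6 (.var 3) (.lit 1))
      (.seq (.askIndep 8 6)
      (.seq (.write 6 (.var 3) (.var 8))
      (.write 9 (.var 3) (.mul (.var 1) (.var 8))))))))))
    (.seq (.write 7 (.lit 0) (.var 1)) (.assign 2 (.lit 1))))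

/-- The state with one base. -/
def State.single {X : Type*} [DecidableEq X] (D : ℤ) (B : Finset X) : State X where
  N := 1
  B := fun _ => B
  w := fun _ => D
  z := fun i => if i ∈ B then D else 0
  θ := fun _ => 0

theorem State.inv_single {X : Type*} [DecidableEq X] [Fintype X] {M : Matroid X} {D : ℤ}
    (hD : 0 ≤ D) {B : Finset X} (hB : M.IsBase B) (a : X → ℤ) :
    (State.single D B).Inv M D a := by
  refine ⟨Nat.one_pos, ⟨fun _ _ _ => hB, fun _ _ _ => hD, ?_, fun i => ?_⟩, fun _ _ => rfl,
    fun _ _ _ _ _ => Nat.zero_le _, fun _ => Nat.zero_le _⟩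
  · simp [State.single]
  · rw [State.single, Nat.Ico_zero_eq_range, Finset.sum_range_one]

section Specs

variable {n : ℕ} {f : Finset (Fin n) → ℝ} {M : Matroid (Fin n)} {U L : ℕ} {s : Memory}

theorem WP.commonDenominator (hbd : Bounds n U L) (hn : s.var 0 = n) {d : Fin n → ℕ}
    (hd : ∀ i, 0 < d i) (hs : ∀ i : Fin n, s.arr 1 i = d i) (hU : ∏ i, d i ≤ U) :
    WP f M U L .commonDenominator s fun s' => s'.var 1 = ((∏ i, d i : ℕ) : ℤ) := by
  -- Partial products stay bounded because every denominator is at least 1.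
  have hpart (k : ℕ) : ∏ i : Fin n with i.val < k, d i ≤ U :=
    (Finset.prod_le_prod_of_subset_of_one_le' (Finset.filter_subset _ _)
      fun i _ _ => hd i).trans hU
  refine .seq (.assign (fun _ => by simpa [Expr.eval] using hbd.one_le) ?_)
  refine .forRange (m := n) (fun k s' => s'.var 1 = ((∏ i : Fin n with i.val < k, d i : ℕ) : ℤ))
    (by simp [hn]) hbd.card_le hbd.card_le_bound rfl rfl (by decide) (by simp [Expr.eval]) ?_ ?_
  · intro k hk s' hf hki hI
    have h1 : s'.arr 1 k = d ⟨k, hk⟩ := by rw [hf.arr 1 rfl]; exact hs ⟨k, hk⟩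
    have hset : (Finset.univ.filter fun i : Fin n => i.val < k + 1) =
        insert ⟨k, hk⟩ (Finset.univ.filter fun i : Fin n => i.val < k) := by
      ext i
      simp only [Finset.mem_filter, Finset.mem_univ, true_and, Finset.mem_insert, Fin.ext_iff]
      omega
    have hev : Expr.eval s' (.mul (.var 1) (.arr 1 (.var 3))) =
        ((∏ i : Fin n with i.val < k + 1, d i : ℕ) : ℤ) := by
      rw [hset, Finset.prod_insert (by simp)]
      simp only [Expr.eval, hki, Int.toNat_natCast, h1, hI]
      push_cast
      ring
    refine .assign (fun _ => ?_) ?_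
    · rw [hev]
      exact_mod_cast hpart (k + 1)
    · rw [hev]
      simp
  · intro s' _ _ hI
    rw [hI]
    simp

theorem WP.startFlow (hbd : Bounds n U L) (hn : s.var 0 = n) {p : Fin n → ℤ} {d : Fin n → ℕ}
    (hd : ∀ i, 0 < d i) (hp0 : ∀ i, 0 ≤ p i) (hpd : ∀ i, p i ≤ d i)
    (hs0 : ∀ i : Fin n, s.arr 0 i = p i) (hs1 : ∀ i : Fin n, s.arr 1 i = d i)
    (hs5 : ∀ i : Fin n, s.arr 5 i = 0) (hs6 : ∀ i : Fin n, s.arr 6 i = 0)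
    {D : ℕ} (hD : D = ∏ i, d i) (hU : D ≤ U) :
    WP f M U L .startFlow s fun s' => ∃ B : Finset (Fin n), M.IsBase B ∧
      Stores s' (State.single D B) ∧ ∀ i : Fin n, s'.arr 3 i = p i * (D / d i : ℤ) ∧
        s'.arr 10 i = p i * (D / d i : ℤ) ∧ s'.arr 4 i = D := by
  refine .seq ((WP.commonDenominator hbd hn hd hs1 (hD ▸ hU)).mono fun s₁ hf₁ _ h₁ => ?_)
  rw [← hD] at h₁
  have hn₁ : s₁.var 0 = n := by rw [hf₁.var 0 rfl, hn]
  set a : Fin n → ℤ := fun i => p i * (D / d i : ℤ) with ha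
  have haU (i : Fin n) : (a i).natAbs ≤ U := by
    have h1 : (d i : ℤ) * (D / d i : ℤ) ≤ D := Int.mul_ediv_self_le (by have := hd i; omega)
    have h2 : 0 ≤ (D / d i : ℤ) := by positivity
    have h3 : 0 ≤ a i := mul_nonneg (hp0 i) h2
    have h4 : a i ≤ d i * (D / d i : ℤ) := mul_le_mul_of_nonneg_right (hpd i) h2
    omega
  refine .seq (.forRange (m := n) (fun k s' => ∃ I : Finset (Fin n), M.Indep I ∧
      (∀ i ∈ I, i.val < k) ∧ (∀ i : Fin n, s'.arr 6 i = if i ∈ I then 1 else 0) ∧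
      (∀ i : Fin n, i.val < k → s'.arr 3 i = a i ∧ s'.arr 10 i = a i ∧ s'.arr 4 i = D ∧
        s'.arr 9 i = (if i ∈ I then (D : ℤ) else 0) ∧
        (i ∉ I → ¬ M.Indep (insert i I : Finset (Fin n)))))
    hn₁ hbd.card_le hbd.card_le_bound rfl rfl (by decide) ?_ ?_ ?_)
  · refine ⟨∅, by simp, by simp, fun i => ?_, by simp⟩
    simp [hf₁.arr 6 rfl, hs6 i]
  · rintro k hk s' hf hki ⟨I, hI, hIk, h6, hlow⟩
    have e0 : s'.arr 0 k = p ⟨k, hk⟩ := by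
      rw [hf.arr 0 rfl, hf₁.arr 0 rfl]; exact hs0 ⟨k, hk⟩
    have e1 : s'.arr 1 k = d ⟨k, hk⟩ := by
      rw [hf.arr 1 rfl, hf₁.arr 1 rfl]; exact hs1 ⟨k, hk⟩
    have eD : s'.var 1 = D := by rw [hf.var 1 rfl, h₁]
    have hev : Expr.eval s' (.mul (.arr 0 (.var 3)) (.div (.var 1) (.arr 1 (.var 3)))) =
        a ⟨k, hk⟩ := by
      simp [Expr.eval, hki, e0, e1, eD, ha]
    refine .seq (.write (fun _ => by rw [hev]; exact haU _) ?_)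
    rw [hev]
    refine .seq (.write (fun hb => hb.2 _ _) (.seq (.write (fun hb => hb.1 _)
      (.seq (.write (fun _ => by simpa [Expr.eval] using hbd.one_le) (.seq (.askIndep ?_)))))))
    -- The element `k` is entered tentatively, and the answer of the oracle then overwrites its
    -- entry, so array 6 again describes an independent set.
    set I' : Finset (Fin n) := insert ⟨k, hk⟩ I with hI'
    have hkI : (⟨k, hk⟩ : Fin n) ∉ I := fun h => absurd (hIk _ h) (lt_irrefl k)
    have hq : Memory.querySet ((((s'.setArr 3 (Expr.eval s' (.var 3)).toNat (a ⟨k, hk⟩)).setArr 10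
        (Expr.eval (s'.setArr 3 (Expr.eval s' (.var 3)).toNat (a ⟨k, hk⟩)) (.var 3)).toNat
        (Expr.eval (s'.setArr 3 (Expr.eval s' (.var 3)).toNat (a ⟨k, hk⟩)) (.arr 3 (.var 3)))).setArr
        4 k D).setArr 6 k 1) n 6 = I' := by
      ext i
      simp only [Memory.querySet, Set.mem_ofPred_eq, Memory.setArr_arr, true_and, hI',
        Finset.coe_insert, Set.mem_insert_iff, Finset.mem_coe, Fin.ext_iff]
      by_cases hik : i.val = k
      · simp [hik]
      · simp [hik, h6 i]
    simp only [Expr.eval, Memory.setArr_var, hki, Int.toNat_natCast, eD] at hq ⊢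
    rw [hq]
    have hDr : ((D : ℤ) * indepAnswer M (I' : Set (Fin n))).natAbs ≤ U := by
      unfold indepAnswer
      split_ifs <;> simp [hU]
    refine .seq (.write (fun hb => hb.1 _) (.write (fun _ => ?_) ?_))
    · simpa [Expr.eval, eD] using hDr
    simp only [Expr.eval, Memory.setArr_var, Memory.setVar_var, hki, eD]
    by_cases hind : M.Indep I'
    · rw [show indepAnswer M (I' : Set (Fin n)) = 1 from if_pos hind]
      refine ⟨I', hind, fun i hi => ?_, fun i => ?_, fun i hi => ?_⟩
      · rcases Finset.mem_insert.1 hi with rfl | h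
        · exact Nat.lt_succ_self k
        · exact (hIk i h).trans (Nat.lt_succ_self k)
      · by_cases hik : i.val = k
        · obtain rfl : i = ⟨k, hk⟩ := Fin.ext hik
          simp [hI']
        · have : i ≠ ⟨k, hk⟩ := fun h => hik (by rw [h])
          simp [hik, h6 i, hI', this]
      · by_cases hik : i.val = k
        · obtain rfl : i = ⟨k, hk⟩ := Fin.ext hik
          simp [hI']
        · have hne : i ≠ ⟨k, hk⟩ := fun h => hik (by rw [h])
          obtain ⟨h1, h2, h3, h4, h5⟩ := hlow i (by omega)
          refine ⟨by simp [hik, h1], by simp [hik, h2], by simp [hik, h3],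
            by simp [hik, h4, hI', hne], fun hiI => ?_⟩
          simp only [hI', Finset.mem_insert, not_or] at hiI
          -- An element rejected once stays rejected, since `I` only grows.
          exact fun h => h5 hiI.2 (h.subset (by
            exact_mod_cast Finset.insert_subset_insert _ (Finset.subset_insert _ _)))
    · rw [show indepAnswer M (I' : Set (Fin n)) = 0 from if_neg hind]
      refine ⟨I, hI, fun i hi => (hIk i hi).trans (Nat.lt_succ_self k), fun i => ?_,
        fun i hi => ?_⟩
      · by_cases hik : i.val = k
        · obtain rfl : i = ⟨k, hk⟩ := Fin.ext hik
          simp [hkI]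
        · simp [hik, h6 i]
      · by_cases hik : i.val = k
        · obtain rfl : i = ⟨k, hk⟩ := Fin.ext hik
          exact ⟨by simp, by simp, by simp, by simp [hkI], fun _ => hind⟩
        · obtain ⟨h1, h2, h3, h4, h5⟩ := hlow i (by omega)
          exact ⟨by simp [hik, h1], by simp [hik, h2], by simp [hik, h3], by simp [hik, h4], h5⟩
  · rintro s₂ hf₂ _ ⟨I, hI, -, h6, hlow⟩
    have eD : s₂.var 1 = D := by rw [hf₂.var 1 rfl, h₁]
    have hn₂ : s₂.var 0 = n := by rw [hf₂.var 0 rfl, hn₁]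
    refine .seq (.write (fun hb => hb.1 _) (.assign
      (fun _ => by simpa [Expr.eval] using hbd.one_le) ?_))
    refine ⟨I, hI.isBase_of_forall_insert fun e he h => ?_, ⟨?_, ?_, ?_, ?_, ?_, ?_⟩, fun i => ?_⟩
    · exact (hlow e e.isLt).2.2.2.2 (by simpa using he.2) (by simpa using h)
    · simp [hn₂]
    · simp [Expr.eval, State.single]
    · intro j hj i
      obtain rfl : j = 0 := by simpa [State.single] using hj
      simp only [Memory.setVar_arr, Memory.setArr_arr, Nat.zero_mul, Nat.zero_add,
        show ¬ ((6 : ℕ) = 7) by decide, false_and, if_false]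
      exact h6 i
    · intro j hj
      obtain rfl : j = 0 := by simpa [State.single] using hj
      simp [Expr.eval, eD, State.single]
    · intro i
      simp [(hlow i i.isLt).2.2.2.1, State.single]
    · intro i
      simp [hf₂.arr 5 rfl, hf₁.arr 5 rfl, hs5 i, State.single]
    · obtain ⟨h1, h2, h3, -, -⟩ := hlow i i.isLt
      exact ⟨by simp [h1, ha], by simp [h2, ha], by simp [h3]⟩

end Specs

/-! ## Rounding coordinates up or to zero -/

/-- The point with the coordinates `y i / D`. -/
noncomputable def scalePoint {X : Type*} (D : ℤ) (y : X → ℤ) : X → ℝ := fun i => (y i : ℝ) / D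

theorem scalePoint_mem_Icc {X : Type*} {D : ℤ} (hD : 0 < D) {y : X → ℤ} (h0 : ∀ i, 0 ≤ y i)
    (hy : ∀ i, y i ≤ D) : scalePoint D y ∈ Set.Icc (0 : X → ℝ) 1 := by
  have hD' : (0 : ℝ) < D := by exact_mod_cast hD
  refine ⟨fun i => div_nonneg (Int.cast_nonneg (h0 i)) hD'.le, fun i => ?_⟩
  exact (div_le_one hD').2 (by exact_mod_cast hy i)

theorem scalePoint_update {X : Type*} [DecidableEq X] (D : ℤ) (y : X → ℤ) (i : X) (c : ℤ) :
    scalePoint D (Function.update y i c) = Function.update (scalePoint D y) i ((c : ℝ) / D) := by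
  funext j
  by_cases hj : j = i
  · subst hj
    simp [scalePoint]
  · simp [scalePoint, hj]

theorem leAnswer_of_mem {n : ℕ} (f : Finset (Fin n) → ℝ) {y z : Fin n → ℝ}
    (hy : y ∈ Set.Icc (0 : Fin n → ℝ) 1) (hz : z ∈ Set.Icc (0 : Fin n → ℝ) 1) :
    (multilinearExtension f y ≤ multilinearExtension f z ∧ leAnswer f y z = 1) ∨
      (multilinearExtension f z < multilinearExtension f y ∧ leAnswer f y z = 0) := by
  by_cases h : multilinearExtension f y ≤ multilinearExtension f z
  · exact Or.inl ⟨h, if_pos ⟨hy, hz, h⟩⟩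
  · exact Or.inr ⟨not_le.1 h, if_neg fun h' => h h'.2.2⟩

/-- Replace every coordinate of the point in array 3 by that in array 9 or by zero, and record in
array 11 which coordinates are kept. -/
def Program.roundUpOrZero : Program :=
  .forRange 3 0 (.seq (.write 10 (.var 3) (.arr 9 (.var 3)))
    (.seq (.askLe 8 3 4 10 4)
    (.seq (.write 3 (.var 3) (.mul (.arr 9 (.var 3)) (.var 8)))
    (.seq (.write 10 (.var 3) (.arr 3 (.var 3))) (.write 11 (.var 3) (.var 8))))))

/-- Once two consecutive bases agree, the lower index can be dropped from the range, its weight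
going to the next one. -/
theorem IsComb.merge {X : Type*} [DecidableEq X] {M : Matroid X} {D : ℤ} {j N : ℕ}
    {B : ℕ → Finset X} {w : ℕ → ℤ} {z : X → ℤ} (h : IsComb M D j N B w z) (hj : j + 1 < N)
    (hB : B j = B (j + 1)) :
    IsComb M D (j + 1) N B (Function.update w (j + 1) (w j + w (j + 1))) z := by
  have key (g : Finset X → Prop) [DecidablePred g] :
      (∑ k ∈ Finset.Ico (j + 1) N,
        if g (B k) then Function.update w (j + 1) (w j + w (j + 1)) k else 0) =
      ∑ k ∈ Finset.Ico j N, if g (B k) then w k else 0 := by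
    rw [Finset.sum_eq_sum_Ico_succ_bot hj, Finset.sum_eq_sum_Ico_succ_bot (by omega : j < N),
      Finset.sum_eq_sum_Ico_succ_bot hj, ← add_assoc, Function.update_self, hB]
    congr 1
    · split_ifs <;> simp
    · refine Finset.sum_congr rfl fun k hk => ?_
      have := (Finset.mem_Ico.1 hk).1
      rw [Function.update_of_ne (by omega)]
  refine ⟨fun k hk hkN => h.base k (by omega) hkN, fun k hk hkN => ?_, ?_, fun i => ?_⟩
  · rw [Function.update_apply]
    split_ifs
    · exact add_nonneg (h.nonneg j le_rfl (by omega)) (h.nonneg (j + 1) (by omega) hj)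
    · exact h.nonneg k (by omega) hkN
  · simpa [h.sum] using key fun _ => True
  · rw [h.eq i, key fun S => i ∈ S]

/-- Links the integer bookkeeping to the moves for which convexity is known. -/
theorem State.scalePoint_push {X : Type*} [DecidableEq X] (σ : State X) (D : ℤ) (b : ℕ) (u v : X) :
    scalePoint D (σ.push b u v).z = moveMass (scalePoint D σ.z) u v ((σ.w b : ℝ) / D) := by
  simp only [State.push, scalePoint_update, moveMass]
  congr 2
  · simp only [scalePoint]
    push_cast
    ring
  · simp only [scalePoint]
    push_cast
    ring

theorem moveMass_swap {X : Type*} [DecidableEq X] (x : X → ℝ) {u v : X} (huv : u ≠ v) (c : ℝ) :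
    moveMass x v u c = moveMass x u v (-c) := by
  rw [moveMass, moveMass, Function.update_comm huv, sub_neg_eq_add, sub_eq_add_neg]

/-! ## Swap rounding -/

/-- Find in variable 7 an element of the base `j + 1` that can be exchanged in both directions for
the element in variable 3 of the base `j`. -/
def Program.findMate : Program :=
  .seq (.assign 7 (.lit (-1))) (.forRange 16 0
    (.seq (.askSwap 12 3 16) (.seq (.assign 14 (.var 8)) (.seq (.askSwap 17 16 3)
      (.ifPos (.mul (.mul (.var 14) (.var 8))
          (.mul (.arr 6 (.add (.var 17) (.var 16)))
            (.sub (.lit 1) (.arr 6 (.add (.var 12) (.var 16))))))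
        (.assign 7 (.var 16)) .skip)))))

/-- Write the two points that arise from the possible exchanges into the arrays 12 and 13. -/
def Program.preparePoints : Program :=
  .seq (.forRange 5 0 (.seq (.write 12 (.var 5) (.mul (.arr 9 (.var 5)) (.arr 11 (.var 5))))
      (.write 13 (.var 5) (.mul (.arr 9 (.var 5)) (.arr 11 (.var 5))))))
    (.seq (.write 12 (.var 3) (.mul (.sub (.arr 9 (.var 3)) (.arr 7 (.var 4))) (.arr 11 (.var 3))))
    (.seq (.write 12 (.var 7) (.mul (.add (.arr 9 (.var 7)) (.arr 7 (.var 4))) (.arr 11 (.var 7))))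
    (.seq (.write 13 (.var 7) (.mul (.sub (.arr 9 (.var 7)) (.arr 7 (.add (.var 4) (.lit 1))))
      (.arr 11 (.var 7))))
    (.write 13 (.var 3) (.mul (.add (.arr 9 (.var 3)) (.arr 7 (.add (.var 4) (.lit 1))))
      (.arr 11 (.var 3)))))))

/-- Make the exchange that leads to the larger value. -/
def Program.exchange : Program :=
  .seq .findMate (.seq .preparePoints (.seq (.askLe 8 12 4 13 4)
    (.seq (.ifPos (.var 8)
      (.seq (.assign 10 (.add (.var 4) (.lit 1))) (.seq (.assign 11 (.var 7)) (.assign 6 (.var 3))))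
      (.seq (.assign 10 (.var 4)) (.seq (.assign 11 (.var 3)) (.assign 6 (.var 7))))) .push)))

/-- Merge the base `j`, for the number `j` in variable 4, into the next one. -/
def Program.mergeNext : Program :=
  .seq (.assign 12 (.mul (.var 4) (.var 0)))
    (.seq (.assign 17 (.mul (.add (.var 4) (.lit 1)) (.var 0)))
    (.seq (.forRange 3 0 (.ifPos (.mul (.arr 6 (.add (.var 12) (.var 3)))
        (.sub (.lit 1) (.arr 6 (.add (.var 17) (.var 3))))) .exchange .skip))
    (.write 7 (.add (.var 4) (.lit 1)) (.add (.arr 7 (.var 4)) (.arr 7 (.add (.var 4) (.lit 1)))))))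

/-- Merge all bases into the last one. -/
def Program.swapRounding : Program :=
  .seq (.assign 15 (.sub (.var 2) (.lit 1))) (.forRange 4 15 .mergeNext)

/-! ### Correctness of the coordinate rounding and of the preparation of an exchange -/

section Specs

variable {n : ℕ} {f : Finset (Fin n) → ℝ} {M : Matroid (Fin n)} {U L : ℕ} {s : Memory}

theorem WP.roundUpOrZero (hbd : Bounds n U L) {σ : State (Fin n)} (hσ : Stores s σ) {D : ℤ}
    (hD : 0 < D) {a : Fin n → ℤ} (ha0 : ∀ i, 0 ≤ a i) (haz : ∀ i, a i ≤ σ.z i)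
    (hzD : ∀ i, σ.z i ≤ D) (h3 : ∀ i : Fin n, s.arr 3 i = a i) (h10 : ∀ i : Fin n, s.arr 10 i = a i)
    (h4 : ∀ i : Fin n, s.arr 4 i = D) :
    WP f M U L .roundUpOrZero s fun s' => ∃ R : Finset (Fin n),
      (∀ i : Fin n, s'.arr 11 i = if i ∈ R then 0 else 1) ∧
      multilinearExtension f (scalePoint D a) ≤
        multilinearExtension f (maskOut R (scalePoint D σ.z)) := by
  refine .forRange (m := n) (fun k s' => ∃ (R : Finset (Fin n)) (y : Fin n → ℤ),
      (∀ i ∈ R, i.val < k) ∧ (∀ i, y i = if i.val < k then (if i ∈ R then 0 else σ.z i) else a i) ∧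
      (∀ i : Fin n, s'.arr 3 i = y i) ∧ (∀ i : Fin n, s'.arr 10 i = y i) ∧
      (∀ i : Fin n, i.val < k → s'.arr 11 i = if i ∈ R then 0 else 1) ∧
      multilinearExtension f (scalePoint D a) ≤ multilinearExtension f (scalePoint D y))
    hσ.card hbd.card_le hbd.card_le_bound rfl rfl (by decide)
    ⟨∅, a, by simp, by simp, h3, h10, by simp, le_rfl⟩ ?_ ?_
  · rintro k hk s' hf hki ⟨R, y, hR, hy, hy3, hy10, hm, hle⟩
    have hkR : (⟨k, hk⟩ : Fin n) ∉ R := fun h => absurd (hR _ h) (lt_irrefl k)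
    have h9 (i : Fin n) : s'.arr 9 i = σ.z i := by rw [hf.arr 9 rfl]; exact hσ.z i
    have h4' (i : Fin n) : s'.arr 4 i = D := by rw [hf.arr 4 rfl]; exact h4 i
    have e9 : s'.arr 9 k = σ.z ⟨k, hk⟩ := h9 ⟨k, hk⟩
    have hz0 (i : Fin n) : 0 ≤ σ.z i := (ha0 i).trans (haz i)
    have hy0 (i : Fin n) : 0 ≤ y i := by
      rw [hy i]
      split_ifs
      exacts [le_rfl, hz0 i, ha0 i]
    have hyD (i : Fin n) : y i ≤ D := by
      rw [hy i]
      split_ifs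
      exacts [hD.le, hzD i, (haz i).trans (hzD i)]
    have hyk : y ⟨k, hk⟩ = a ⟨k, hk⟩ := by simp [hy]
    refine .seq (.write (fun hb => hb.2 _ _) (.seq (.askLe ?_)))
    simp only [Expr.eval, hki, Int.toNat_natCast, e9]
    -- Array 10 differs from array 3 only in the raised coordinate `k`; array 4 holds the
    -- denominator `D` of both points.
    have q1 : (s'.setArr 10 k (σ.z ⟨k, hk⟩)).queryPoint n 3 4 = scalePoint D y := by
      funext i
      simp [Memory.queryPoint, scalePoint, hy3 i, h4' i]
    have q2 : (s'.setArr 10 k (σ.z ⟨k, hk⟩)).queryPoint n 10 4 =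
        scalePoint D (Function.update y ⟨k, hk⟩ (σ.z ⟨k, hk⟩)) := by
      funext i
      by_cases hik : i.val = k
      · obtain rfl : i = ⟨k, hk⟩ := Fin.ext hik
        have := h4' ⟨k, hk⟩
        simp only at this
        simp [Memory.queryPoint, scalePoint, this]
      · have : i ≠ ⟨k, hk⟩ := fun h => hik (by rw [h])
        simp [Memory.queryPoint, scalePoint, hy10 i, h4' i, hik, this]
    rw [q1, q2]
    have hup0 (i : Fin n) : 0 ≤ Function.update y ⟨k, hk⟩ (σ.z ⟨k, hk⟩) i := by
      rw [Function.update_apply]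
      split_ifs
      exacts [hz0 _, hy0 i]
    have hupD (i : Fin n) : Function.update y ⟨k, hk⟩ (σ.z ⟨k, hk⟩) i ≤ D := by
      rw [Function.update_apply]
      split_ifs
      exacts [hzD _, hyD i]
    have hD' : (0 : ℝ) < D := by exact_mod_cast hD
    rcases leAnswer_of_mem f (scalePoint_mem_Icc hD hy0 hyD) (scalePoint_mem_Icc hD hup0 hupD) with
      ⟨hF, hr⟩ | ⟨hF, hr⟩
    · rw [hr]
      refine .seq (.write (fun hb => ?_) (.seq (.write (fun hb => hb.2 _ _)
        (.write (fun hb => hb.1 _) ?_))))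
      · have := hb.2 9 k
        simpa [Expr.eval, hki, e9] using this
      · refine ⟨R, Function.update y ⟨k, hk⟩ (σ.z ⟨k, hk⟩),
          fun i hi => (hR i hi).trans (Nat.lt_succ_self k), fun i => ?_, fun i => ?_, fun i => ?_,
          fun i hi => ?_, hle.trans hF⟩
        · by_cases hik : i = ⟨k, hk⟩
          · subst hik
            simp [hkR]
          · have : i.val ≠ k := fun h => hik (Fin.ext h)
            rw [Function.update_of_ne hik, hy i]
            have hiff : i.val < k + 1 ↔ i.val < k := by omega
            simp only [hiff]
        · by_cases hik : i = ⟨k, hk⟩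
          · subst hik
            simp [Expr.eval, hki, e9]
          · have : i.val ≠ k := fun h => hik (Fin.ext h)
            simp [Expr.eval, hki, hik, this, hy3 i]
        · by_cases hik : i = ⟨k, hk⟩
          · subst hik
            simp [Expr.eval, hki, e9]
          · have : i.val ≠ k := fun h => hik (Fin.ext h)
            simp [Expr.eval, hki, hik, this, hy10 i]
        · by_cases hik : i = ⟨k, hk⟩
          · subst hik
            simp [Expr.eval, hki, hkR]
          · have : i.val ≠ k := fun h => hik (Fin.ext h)
            simp [Expr.eval, hki, this, hm i (by omega)]
    · rw [hr]
      refine .seq (.write (fun _ => ?_) (.seq (.write (fun hb => hb.2 _ _)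
        (.write (fun hb => hb.1 _) ?_))))
      · simp [Expr.eval]
      · rw [scalePoint_update] at hF
        -- Both points lie in the cube, so the answer `0` means a strict decrease on raising, and
        -- affinity makes zero a safe value.
        have hzero := multilinearExtension_le_update_zero f (x := scalePoint D y) (i := ⟨k, hk⟩)
          (div_nonneg (by exact_mod_cast hy0 _) hD'.le)
          (by
            refine div_le_div_of_nonneg_right ?_ hD'.le
            rw [hyk]
            exact_mod_cast haz _) hF
        have hupd : Function.update (scalePoint D y) ⟨k, hk⟩ 0 =
            scalePoint D (Function.update y ⟨k, hk⟩ 0) := by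
          rw [scalePoint_update]
          simp
        rw [hupd] at hzero
        refine ⟨insert ⟨k, hk⟩ R, Function.update y ⟨k, hk⟩ 0, fun i hi => ?_, fun i => ?_,
          fun i => ?_, fun i => ?_, fun i hi => ?_, hle.trans hzero⟩
        · rcases Finset.mem_insert.1 hi with rfl | hi
          · exact Nat.lt_succ_self k
          · exact (hR i hi).trans (Nat.lt_succ_self k)
        · by_cases hik : i = ⟨k, hk⟩
          · subst hik
            simp
          · have : i.val ≠ k := fun h => hik (Fin.ext h)
            rw [Function.update_of_ne hik, hy i]
            have hiff : i.val < k + 1 ↔ i.val < k := by omega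
            simp only [hiff, Finset.mem_insert, hik, false_or]
        · by_cases hik : i = ⟨k, hk⟩
          · subst hik
            simp [Expr.eval, hki]
          · have : i.val ≠ k := fun h => hik (Fin.ext h)
            simp [Expr.eval, hki, hik, this, hy3 i]
        · by_cases hik : i = ⟨k, hk⟩
          · subst hik
            simp [Expr.eval, hki]
          · have : i.val ≠ k := fun h => hik (Fin.ext h)
            simp [Expr.eval, hki, hik, this, hy10 i]
        · by_cases hik : i = ⟨k, hk⟩
          · subst hik
            simp [Expr.eval, hki]
          · have : i.val ≠ k := fun h => hik (Fin.ext h)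
            simp [Expr.eval, hki, this, hik, hm i (by omega)]
  · rintro s' hf _ ⟨R, y, -, hy, -, -, hm, hle⟩
    refine ⟨R, fun i => hm i i.isLt, hle.trans (le_of_eq ?_)⟩
    congr 1
    funext i
    simp only [scalePoint, maskOut, hy i, i.isLt, if_true]
    split_ifs <;> simp

theorem WP.findMate (hbd : Bounds n U L) {σ : State (Fin n)} (hσ : Stores s σ) {j : ℕ}
    (hj : j + 1 < σ.N) (hA : M.IsBase (σ.B j)) (hB : M.IsBase (σ.B (j + 1))) {i : Fin n}
    (hi : i ∈ σ.B j) (hi' : i ∉ σ.B (j + 1)) (h3 : s.var 3 = (i : ℕ))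
    (h12 : s.var 12 = (j * n : ℕ)) (h17 : s.var 17 = ((j + 1) * n : ℕ)) :
    WP f M U L .findMate s fun s' => ∃ k : Fin n, s'.var 7 = (k : ℕ) ∧ k ∈ σ.B (j + 1) ∧
      k ∉ σ.B j ∧ M.IsBase (insert k ((σ.B j).erase i) : Finset (Fin n)) ∧
      M.IsBase (insert i ((σ.B (j + 1)).erase k) : Finset (Fin n)) := by
  set P : Fin n → Prop := fun k => k ∈ σ.B (j + 1) ∧
      k ∉ σ.B j ∧ M.IsBase (insert k ((σ.B j).erase i) : Finset (Fin n)) ∧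
      M.IsBase (insert i ((σ.B (j + 1)).erase k) : Finset (Fin n)) with hP
  refine .seq (.assign (fun _ => by simpa [Expr.eval] using hbd.one_le) ?_)
  have hσ₀ : Stores (s.setVar 7 (Expr.eval s (.lit (-1)))) σ :=
    ⟨by simp [hσ.card], by simp [hσ.N], hσ.B, hσ.w, hσ.z, hσ.θ⟩
  refine .forRange (m := n) (fun m s' => (∀ k : Fin n, k.val < m → ¬ P k) ∨
      ∃ k : Fin n, s'.var 7 = (k : ℕ) ∧ P k)
    hσ₀.card hbd.card_le hbd.card_le_bound rfl rfl (by decide) (Or.inl (by simp)) ?_ ?_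
  · intro k hk s₁ hf₁ hki hI
    have hσ₁ : Stores s₁ σ := hσ₀.of_frame hf₁ rfl rfl rfl rfl rfl rfl
    have h3₁ : s₁.var 3 = (i : ℕ) := by rw [hf₁.var 3 rfl]; simp [h3]
    have h12₁ : s₁.var 12 = (j * n : ℕ) := by rw [hf₁.var 12 rfl]; simp [h12]
    have h17₁ : s₁.var 17 = ((j + 1) * n : ℕ) := by rw [hf₁.var 17 rfl]; simp [h17]
    refine .seq ((WP.askSwap hbd (o' := i) (i' := ⟨k, hk⟩) hσ₁.card h12₁ h3₁ hki
      (hσ₁.B j (by omega)) (by decide) (by decide) (by decide)).mono fun s₂ hf₂ _ h8 => ?_)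
    have hσ₂ : Stores s₂ σ := hσ₁.of_frame hf₂ rfl rfl rfl rfl rfl rfl
    refine .seq (.assign (fun hb => hb.1 _) ?_)
    set s₃ := s₂.setVar 14 (Expr.eval s₂ (.var 8)) with hs₃
    have hσ₃ : Stores s₃ σ := ⟨by simp [hs₃, hσ₂.card], by simp [hs₃, hσ₂.N], hσ₂.B, hσ₂.w, hσ₂.z,
      hσ₂.θ⟩
    have h14₃ : s₃.var 14 = indepAnswer M (insert ⟨k, hk⟩ ((σ.B j).erase i) : Finset (Fin n)) := by
      simp [hs₃, Expr.eval, h8]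
    have h3₃ : s₃.var 3 = (i : ℕ) := by simp [hs₃, hf₂.var 3 rfl, h3₁]
    have h16₃ : s₃.var 16 = k := by simp [hs₃, hf₂.var 16 rfl, hki]
    have h12₃ : s₃.var 12 = (j * n : ℕ) := by simp [hs₃, hf₂.var 12 rfl, h12₁]
    have h17₃ : s₃.var 17 = ((j + 1) * n : ℕ) := by simp [hs₃, hf₂.var 17 rfl, h17₁]
    have h7₃ : s₃.var 7 = s₁.var 7 := by simp [hs₃, hf₂.var 7 rfl]
    refine .seq ((WP.askSwap hbd (o' := ⟨k, hk⟩) (i' := i) hσ₃.card h17₃ h16₃ h3₃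
      (hσ₃.B (j + 1) hj) (by decide) (by decide) (by decide)).mono fun s₄ hf₄ _ h8₄ => ?_)
    have hσ₄ : Stores s₄ σ := hσ₃.of_frame hf₄ rfl rfl rfl rfl rfl rfl
    have h14₄ := (hf₄.var 14 rfl).trans h14₃
    have h16₄ := (hf₄.var 16 rfl).trans h16₃
    have h12₄ := (hf₄.var 12 rfl).trans h12₃
    have h17₄ := (hf₄.var 17 rfl).trans h17₃
    have h7₄ := (hf₄.var 7 rfl).trans h7₃
    have eA : s₄.arr 6 (j * n + k) = if (⟨k, hk⟩ : Fin n) ∈ σ.B j then 1 else 0 :=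
      hσ₄.B j (by omega) ⟨k, hk⟩
    have eB : s₄.arr 6 ((j + 1) * n + k) = if (⟨k, hk⟩ : Fin n) ∈ σ.B (j + 1) then 1 else 0 :=
      hσ₄.B (j + 1) hj ⟨k, hk⟩
    have hcond : 0 < Expr.eval s₄ (.mul (.mul (.var 14) (.var 8))
          (.mul (.arr 6 (.add (.var 17) (.var 16)))
            (.sub (.lit 1) (.arr 6 (.add (.var 12) (.var 16)))))) ↔ P ⟨k, hk⟩ := by
      simp only [Expr.eval, h14₄, h8₄, h17₄, h16₄, h12₄, Nat.cast_mul, Int.toNat_natCast_mul_add,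
        eA, eB, indepAnswer, hP]
      constructor
      · intro h
        split_ifs at h with c1 c2 c3 c4
        all_goals first
          | exact ⟨c3, c4, hA.insert_erase_of_indep c4 c1, hB.insert_erase_of_indep hi' c2⟩
          | simp at h
      · rintro ⟨c3, c4, c1, c2⟩
        rw [if_pos c1.indep, if_pos c2.indep, if_pos c3, if_neg c4]
        norm_num
    refine .ifPos (fun h => .assign (fun hb => hb.1 _) ?_) (fun h => .skip ?_)
    · exact Or.inr ⟨⟨k, hk⟩, by simp [Expr.eval, h16₄], hcond.1 h⟩
    · rw [hcond] at h
      rcases hI with hI | ⟨k', h7, hk'⟩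
      · refine Or.inl fun k' hk' => ?_
        rcases Nat.lt_succ_iff_lt_or_eq.1 hk' with h' | h'
        · exact hI k' h'
        · obtain rfl : k' = ⟨k, hk⟩ := Fin.ext h'
          exact h
      · exact Or.inr ⟨k', by simpa [h7₄] using h7, hk'⟩
  · rintro s' - - (hI | hI)
    · obtain ⟨k, h1, h2, h3, h4⟩ := hA.symmetric_exchange hB hi hi'
      exact absurd ⟨h1, h2, h3, h4⟩ (hI k k.isLt)
    · exact hI

theorem WP.preparePoints (hbd : Bounds n U L) {σ : State (Fin n)} (hσ : Stores s σ) {j : ℕ}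
    (hj : j + 1 < σ.N) {i k : Fin n} (hik : i ≠ k) (h3 : s.var 3 = (i : ℕ)) (h4 : s.var 4 = j)
    (h7 : s.var 7 = (k : ℕ)) {R : Finset (Fin n)}
    (h11 : ∀ c : Fin n, s.arr 11 c = if c ∈ R then 0 else 1)
    (hU₁ : ∀ c, ((σ.push j i k).z c).natAbs ≤ U)
    (hU₂ : ∀ c, ((σ.push (j + 1) k i).z c).natAbs ≤ U) :
    WP f M U L .preparePoints s fun s' => ∀ c : Fin n,
      s'.arr 12 c = (if c ∈ R then 0 else (σ.push j i k).z c) ∧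
      s'.arr 13 c = (if c ∈ R then 0 else (σ.push (j + 1) k i).z c) := by
  refine .seq (.forRange (m := n) (fun m s' => ∀ c : Fin n, c.val < m →
      s'.arr 12 c = (if c ∈ R then 0 else σ.z c) ∧ s'.arr 13 c = (if c ∈ R then 0 else σ.z c))
    hσ.card hbd.card_le hbd.card_le_bound rfl rfl (by decide) (by simp) ?_ ?_)
  · intro m hm s' hf hki hI
    have e9 : s'.arr 9 m = σ.z ⟨m, hm⟩ := by rw [hf.arr 9 rfl]; exact hσ.z ⟨m, hm⟩
    have e11 : s'.arr 11 m = if (⟨m, hm⟩ : Fin n) ∈ R then 0 else 1 := by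
      rw [hf.arr 11 rfl]; exact h11 ⟨m, hm⟩
    have hb' (hb : s'.Bounded U) : (s'.arr 9 m * s'.arr 11 m).natAbs ≤ U := by
      have := hb.2 9 m
      rw [e11]
      split_ifs <;> simp [this]
    refine .seq (.write (fun hb => by simpa [Expr.eval, hki] using hb' hb) (.write (fun hb => ?_) ?_))
    · have h1 := hb.2 12 m
      simpa [Expr.eval, hki] using h1
    · intro c hc
      by_cases hcm : c.val = m
      · obtain rfl : c = ⟨m, hm⟩ := Fin.ext hcm
        simp [Expr.eval, hki, e9, e11]
      · simpa [Expr.eval, hki, hcm] using hI c (by omega)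
  · intro s' hf _ hI
    have e3 : s'.var 3 = (i : ℕ) := by rw [hf.var 3 rfl, h3]
    have e4 : s'.var 4 = j := by rw [hf.var 4 rfl, h4]
    have e7 : s'.var 7 = (k : ℕ) := by rw [hf.var 7 rfl, h7]
    have hσ' : Stores s' σ := hσ.of_frame hf rfl rfl rfl rfl rfl rfl
    have e11 : s'.arr 11 = s.arr 11 := hf.arr 11 rfl
    have w1 := hσ'.w j (by omega)
    have w2 := hσ'.w (j + 1) hj
    have zi := hσ'.z i
    have zk := hσ'.z k
    have ti := h11 i
    have tk := h11 k
    have hsucc : ((j : ℤ) + 1).toNat = j + 1 := by omega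
    have hik' : ¬ (i : ℕ) = k := fun h => hik (Fin.ext h)
    have a1 := hU₁ i
    have a2 := hU₁ k
    have a3 := hU₂ k
    have a4 := hU₂ i
    simp only [State.push, Function.update_self, Function.update_of_ne hik,
      Function.update_of_ne hik.symm] at a1 a2 a3 a4
    refine .seq (.write (fun _ => ?_) (.seq (.write (fun _ => ?_) (.seq (.write (fun _ => ?_)
      (.write (fun _ => ?_) fun c => ?_))))))
    · simp only [Expr.eval, e3, e4, Int.toNat_natCast, zi, w1, e11, ti]
      split_ifs
      · simp
      · simpa using a1
    · simp only [Expr.eval, Memory.setArr_var, Memory.setArr_arr, e3, e4, e7, Int.toNat_natCast, zk,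
        w1, e11, tk, show ¬ ((9 : ℕ) = 12) by decide, show ¬ ((7 : ℕ) = 12) by decide,
        show ¬ ((11 : ℕ) = 12) by decide, false_and, if_false]
      split_ifs
      · simp
      · simpa using a2
    · simp only [Expr.eval, Memory.setArr_var, Memory.setArr_arr, e4, e7, Int.toNat_natCast, zk,
        hsucc, w2, e11, tk, show ¬ ((9 : ℕ) = 12) by decide, show ¬ ((7 : ℕ) = 12) by decide,
        show ¬ ((11 : ℕ) = 12) by decide, false_and, if_false]
      split_ifs
      · simp
      · simpa using a3
    · simp only [Expr.eval, Memory.setArr_var, Memory.setArr_arr, e3, e4, Int.toNat_natCast, zi,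
        hsucc, w2, e11, ti, show ¬ ((9 : ℕ) = 12) by decide, show ¬ ((7 : ℕ) = 12) by decide,
        show ¬ ((11 : ℕ) = 12) by decide, show ¬ ((9 : ℕ) = 13) by decide,
        show ¬ ((7 : ℕ) = 13) by decide, show ¬ ((11 : ℕ) = 13) by decide, false_and, if_false]
      split_ifs
      · simp
      · simpa using a4
    · obtain ⟨h12, h13⟩ := hI c c.isLt
      simp only [Expr.eval, Memory.setArr_var, Memory.setArr_arr, e3, e4, e7, Int.toNat_natCast, zi,
        zk, hsucc, w1, w2, e11, ti, tk, show ¬ ((9 : ℕ) = 12) by decide,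
        show ¬ ((7 : ℕ) = 12) by decide, show ¬ ((11 : ℕ) = 12) by decide,
        show ¬ ((9 : ℕ) = 13) by decide, show ¬ ((7 : ℕ) = 13) by decide,
        show ¬ ((11 : ℕ) = 13) by decide, show ¬ ((12 : ℕ) = 13) by decide,
        show ¬ ((13 : ℕ) = 12) by decide, false_and, if_false, true_and, Fin.val_inj, State.push]
      by_cases hci : c = i
      · subst hci
        simp [hik]
      · by_cases hck : c = k
        · subst hck
          simp [hci]
        · simp [hci, hck, h12, h13]

end Specs

/-! ### Correctness of the merging of bases -/

section Specs

variable {n : ℕ} {f : Finset (Fin n) → ℝ} {M : Matroid (Fin n)} {U L : ℕ} {s : Memory}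

/-- The two candidates are compared only with each other. By convexity one of them is no worse than
the current point, hence so is the better one. -/
theorem WP.exchange (hbd : Bounds n U L) (hf : IsSubmodular f) {σ : State (Fin n)}
    (hσ : Stores s σ) {D : ℤ} (hD : 0 < D) (hDU : D ≤ U) {j : ℕ} (hj : j + 1 < σ.N)
    (hN : σ.N ≤ L) (hcomb : IsComb M D j σ.N σ.B σ.w σ.z) {i : Fin n} (hi : i ∈ σ.B j) (hi' : i ∉ σ.B (j + 1))
    (h3 : s.var 3 = (i : ℕ)) (h4 : s.var 4 = j) (h12 : s.var 12 = (j * n : ℕ))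
    (h17 : s.var 17 = ((j + 1) * n : ℕ)) (hD4 : ∀ c : Fin n, s.arr 4 c = D) {R : Finset (Fin n)}
    (h11 : ∀ c : Fin n, s.arr 11 c = if c ∈ R then 0 else 1) {y : ℝ}
    (hy : y ≤ multilinearExtension f (maskOut R (scalePoint D σ.z))) :
    WP f M U L .exchange s fun s' => ∃ σ' : State (Fin n), Stores s' σ' ∧ σ'.N = σ.N ∧
      IsComb M D j σ'.N σ'.B σ'.w σ'.z ∧
      y ≤ multilinearExtension f (maskOut R (scalePoint D σ'.z)) ∧
      σ'.B j \ σ'.B (j + 1) = (σ.B j \ σ.B (j + 1)).erase i := by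
  refine .seq ((WP.findMate hbd hσ hj (hcomb.base j le_rfl (by omega))
    (hcomb.base (j + 1) (by omega) hj) hi hi' h3 h12 h17).mono fun s₁ hf₁ _ h₁ => ?_)
  obtain ⟨k, h7, hkB, hkA, hbA, hbB⟩ := h₁
  have hik : i ≠ k := fun h => hi' (h ▸ hkB)
  have hσ₁ : Stores s₁ σ := hσ.of_frame hf₁ rfl rfl rfl rfl rfl rfl
  have hc₁ : IsComb M D j (σ.push j i k).N (σ.push j i k).B (σ.push j i k).w (σ.push j i k).z :=
    hcomb.swap le_rfl (by omega) hi hkA hbA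
  have hc₂ : IsComb M D j (σ.push (j + 1) k i).N (σ.push (j + 1) k i).B (σ.push (j + 1) k i).w
      (σ.push (j + 1) k i).z := hcomb.swap (by omega) hj hkB hi' hbB
  have hU {z : Fin n → ℤ} {B : ℕ → Finset (Fin n)} {w : ℕ → ℤ} {N : ℕ} (h : IsComb M D j N B w z)
      (c : Fin n) : (z c).natAbs ≤ U := by
    have h1 := h.point_nonneg c
    have h2 := h.point_le c
    omega
  have h3₁ : s₁.var 3 = (i : ℕ) := by rw [hf₁.var 3 rfl, h3]
  have h4₁ : s₁.var 4 = j := by rw [hf₁.var 4 rfl, h4]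
  refine .seq ((WP.preparePoints hbd hσ₁ hj hik h3₁ h4₁ h7 (by rwa [hf₁.arr 11 rfl]) (hU hc₁)
    (hU hc₂)).mono fun s₂ hf₂ _ h₂ => ?_)
  have hσ₂ : Stores s₂ σ := hσ₁.of_frame hf₂ rfl rfl rfl rfl rfl rfl
  have h3₂ : s₂.var 3 = (i : ℕ) := by rw [hf₂.var 3 rfl, h3₁]
  have h4₂ : s₂.var 4 = j := by rw [hf₂.var 4 rfl, h4₁]
  have h7₂ : s₂.var 7 = (k : ℕ) := by rw [hf₂.var 7 rfl, h7]
  have hD4₂ (c : Fin n) : s₂.arr 4 c = D := by rw [hf₂.arr 4 rfl, hf₁.arr 4 rfl]; exact hD4 c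
  have q1 : s₂.queryPoint n 12 4 = maskOut R (scalePoint D (σ.push j i k).z) := by
    funext c
    simp only [Memory.queryPoint, (h₂ c).1, hD4₂ c, maskOut, scalePoint]
    split_ifs <;> simp
  have q2 : s₂.queryPoint n 13 4 = maskOut R (scalePoint D (σ.push (j + 1) k i).z) := by
    funext c
    simp only [Memory.queryPoint, (h₂ c).2, hD4₂ c, maskOut, scalePoint]
    split_ifs <;> simp
  have hcube {z : Fin n → ℤ} {B : ℕ → Finset (Fin n)} {w : ℕ → ℤ} {N : ℕ}
      (h : IsComb M D j N B w z) : maskOut R (scalePoint D z) ∈ Set.Icc (0 : Fin n → ℝ) 1 := by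
    have := scalePoint_mem_Icc hD h.point_nonneg h.point_le
    refine ⟨fun c => ?_, fun c => ?_⟩
    · simp only [maskOut]
      split_ifs
      exacts [le_rfl, this.1 c]
    · simp only [maskOut]
      split_ifs
      exacts [zero_le_one, this.2 c]
  have hD' : (0 : ℝ) < D := by exact_mod_cast hD
  -- Convexity is used for `S ↦ f (S \ R)` at the unmasked point and then translated back to masked
  -- points.
  have hchoice := (hf.sdiff R).le_moveMass_or
    (scalePoint_mem_Icc hD hcomb.point_nonneg hcomb.point_le) hik
    (div_nonneg (Int.cast_nonneg (hcomb.nonneg j le_rfl (by omega))) hD'.le)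
    (div_nonneg (Int.cast_nonneg (hcomb.nonneg (j + 1) (by omega) hj)) hD'.le)
  rw [← moveMass_swap _ hik, ← State.scalePoint_push, ← State.scalePoint_push,
    ← multilinearExtension_maskOut, ← multilinearExtension_maskOut,
    ← multilinearExtension_maskOut] at hchoice
  refine .seq (.askLe ?_)
  rw [q1, q2]
  have hσ₃ (r : ℤ) : Stores (s₂.setVar 8 r) σ :=
    ⟨by simp [hσ₂.card], by simp [hσ₂.N], hσ₂.B, hσ₂.w, hσ₂.z, hσ₂.θ⟩
  rcases leAnswer_of_mem f (hcube hc₁) (hcube hc₂) with ⟨hF, hr⟩ | ⟨hF, hr⟩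
  · rw [hr]
    refine .seq (.ifPos (fun _ => ?_) (fun h => by simp [Expr.eval] at h))
    refine .seq (.assign (fun _ => ?_) (.seq (.assign (fun hb => hb.1 _)
      (.assign (fun hb => hb.1 _) ?_))))
    · have := hbd.length_le_bound
      simp only [Expr.eval, Memory.setVar_var, h4₂, show ¬ ((4 : ℕ) = 8) by decide, if_false]
      omega
    · refine (WP.push hbd (σ := σ) ?_ hj hik.symm ?_ ?_ ?_ (hU hc₂)).mono
        fun s₅ _ _ hσ₅ => ⟨_, hσ₅, rfl, hc₂, ?_, ?_⟩
      · exact ⟨by simp [hσ₂.card], by simp [hσ₂.N], hσ₂.B, hσ₂.w, hσ₂.z, hσ₂.θ⟩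
      · simp [Expr.eval, h4₂]
      · simp [Expr.eval, h7₂]
      · simp [Expr.eval, h3₂]
      · rcases hchoice with h | h
        · exact (hy.trans h).trans hF
        · exact hy.trans h
      · simpa [State.push] using sdiff_insert_erase (B := σ.B (j + 1)) hkA
  · rw [hr]
    refine .seq (.ifPos (fun h => by simp [Expr.eval] at h) (fun _ => ?_))
    refine .seq (.assign (fun hb => hb.1 _) (.seq (.assign (fun hb => hb.1 _)
      (.assign (fun hb => hb.1 _) ?_))))
    refine (WP.push hbd (σ := σ) ?_ (by omega) hik ?_ ?_ ?_ (hU hc₁)).mono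
        fun s₅ _ _ hσ₅ => ⟨_, hσ₅, rfl, hc₁, ?_, ?_⟩
    · exact ⟨by simp [hσ₂.card], by simp [hσ₂.N], hσ₂.B, hσ₂.w, hσ₂.z, hσ₂.θ⟩
    · simp [Expr.eval, h4₂]
    · simp [Expr.eval, h3₂]
    · simp [Expr.eval, h7₂]
    · rcases hchoice with h | h
      · exact hy.trans h
      · exact (hy.trans h).trans hF.le
    · simpa [State.push] using insert_erase_sdiff (A := σ.B j) hkB

/-- One pass over the elements suffices: an exchange removes the current element from `σ.B j \ σ.B
(j + 1)` and adds none, so after the pass the first base is contained in the second and equals it.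
-/
theorem WP.mergeNext (hbd : Bounds n U L) (hf : IsSubmodular f) {σ : State (Fin n)}
    (hσ : Stores s σ) {D : ℤ} (hD : 0 < D) (hDU : D ≤ U) {j : ℕ} (hj : j + 1 < σ.N)
    (hN : σ.N ≤ L) (hcomb : IsComb M D j σ.N σ.B σ.w σ.z) (h4 : s.var 4 = j)
    (hD4 : ∀ c : Fin n, s.arr 4 c = D) {R : Finset (Fin n)}
    (h11 : ∀ c : Fin n, s.arr 11 c = if c ∈ R then 0 else 1) {y : ℝ}
    (hy : y ≤ multilinearExtension f (maskOut R (scalePoint D σ.z))) :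
    WP f M U L .mergeNext s fun s' => ∃ σ' : State (Fin n), Stores s' σ' ∧ σ'.N = σ.N ∧
      IsComb M D (j + 1) σ'.N σ'.B σ'.w σ'.z ∧
      y ≤ multilinearExtension f (maskOut R (scalePoint D σ'.z)) := by
  have hjU : (j + 1) * n ≤ U :=
    (Nat.mul_le_mul (hj.le.trans hN) (Nat.le_succ n)).trans hbd.mul_le
  have hjU' : j * n ≤ U := (Nat.mul_le_mul_right n (Nat.le_succ j)).trans hjU
  have e12 : Expr.eval s (.mul (.var 4) (.var 0)) = (j * n : ℕ) := by
    simp [Expr.eval, h4, hσ.card]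
  refine .seq (.assign (fun _ => by rw [e12]; exact_mod_cast hjU') ?_)
  rw [e12]
  have e17 : Expr.eval (s.setVar 12 (j * n : ℕ)) (.mul (.add (.var 4) (.lit 1)) (.var 0)) =
      ((j + 1) * n : ℕ) := by
    simp [Expr.eval, h4, hσ.card]
  refine .seq (.assign (fun _ => by rw [e17]; exact_mod_cast hjU) ?_)
  rw [e17]
  set s₀ := (s.setVar 12 (j * n : ℕ)).setVar 17 ((j + 1) * n : ℕ) with hs₀
  have hσ₀ : Stores s₀ σ :=
    ⟨by simp [hs₀, hσ.card], by simp [hs₀, hσ.N], hσ.B, hσ.w, hσ.z, hσ.θ⟩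
  refine .seq (.forRange (m := n) (fun m s' => ∃ τ : State (Fin n), Stores s' τ ∧ τ.N = σ.N ∧
      IsComb M D j τ.N τ.B τ.w τ.z ∧
      y ≤ multilinearExtension f (maskOut R (scalePoint D τ.z)) ∧
      ∀ i ∈ τ.B j \ τ.B (j + 1), m ≤ i.val)
    hσ₀.card hbd.card_le hbd.card_le_bound rfl rfl (by decide)
    ⟨σ, ⟨by simp [hσ₀.card], by simp [hσ₀.N], hσ₀.B, hσ₀.w, hσ₀.z, hσ₀.θ⟩, rfl, hcomb, hy,
      fun _ _ => Nat.zero_le _⟩ ?_ ?_)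
  · rintro m hm s₁ hf₁ h3 ⟨τ, hτ, hτN, hτc, hτy, hτm⟩
    have h12₁ : s₁.var 12 = (j * n : ℕ) := by rw [hf₁.var 12 rfl]; simp [hs₀]
    have h17₁ : s₁.var 17 = ((j + 1) * n : ℕ) := by rw [hf₁.var 17 rfl]; simp [hs₀]
    have h4₁ : s₁.var 4 = j := by rw [hf₁.var 4 rfl]; simp [hs₀, h4]
    have eA : s₁.arr 6 (j * n + m) = if (⟨m, hm⟩ : Fin n) ∈ τ.B j then 1 else 0 :=
      hτ.B j (by omega) ⟨m, hm⟩
    have eB : s₁.arr 6 ((j + 1) * n + m) = if (⟨m, hm⟩ : Fin n) ∈ τ.B (j + 1) then 1 else 0 :=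
      hτ.B (j + 1) (by omega) ⟨m, hm⟩
    have hcond : 0 < Expr.eval s₁ (.mul (.arr 6 (.add (.var 12) (.var 3)))
        (.sub (.lit 1) (.arr 6 (.add (.var 17) (.var 3))))) ↔
        (⟨m, hm⟩ : Fin n) ∈ τ.B j \ τ.B (j + 1) := by
      simp only [Expr.eval, h12₁, h17₁, h3, Nat.cast_mul, Int.toNat_natCast_mul_add, eA, eB,
        Finset.mem_sdiff]
      split_ifs with c1 c2 c2 <;> simp [c1, c2]
    have hnext (τ' : State (Fin n)) (h : τ'.B j \ τ'.B (j + 1) ⊆ τ.B j \ τ.B (j + 1))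
        (h' : (⟨m, hm⟩ : Fin n) ∉ τ'.B j \ τ'.B (j + 1)) (i : Fin n)
        (hi : i ∈ τ'.B j \ τ'.B (j + 1)) : m + 1 ≤ i.val := by
      have h1 := hτm i (h hi)
      have h2 : i.val ≠ m := fun e => h' (by rwa [show (⟨m, hm⟩ : Fin n) = i from Fin.ext e.symm])
      omega
    refine .ifPos (fun h => ?_) (fun h => .skip ?_)
    · rw [hcond] at h
      refine (WP.exchange hbd hf hτ hD hDU (by omega) (by omega) hτc (Finset.mem_sdiff.1 h).1
        (Finset.mem_sdiff.1 h).2 h3 h4₁ h12₁ h17₁ (by rwa [hf₁.arr 4 rfl]) (by rwa [hf₁.arr 11 rfl])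
        hτy).mono ?_
      rintro s₂ - - ⟨τ', hτ', hN', hc', hy', hB'⟩
      refine ⟨τ', ⟨by simp [hτ'.card], by simp [hτ'.N], hτ'.B, hτ'.w, hτ'.z, hτ'.θ⟩,
        hN'.trans hτN, hc', hy', hnext τ' (by rw [hB']; exact Finset.erase_subset _ _)
          (by rw [hB']; exact Finset.notMem_erase _ _)⟩
    · rw [hcond] at h
      exact ⟨τ, ⟨by simp [hτ.card], by simp [hτ.N], hτ.B, hτ.w, hτ.z, hτ.θ⟩, hτN, hτc, hτy,
        hnext τ (Finset.Subset.refl _) h⟩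
  · rintro s₁ hf₁ - ⟨τ, hτ, hτN, hτc, hτy, hτm⟩
    have hsub : τ.B j ⊆ τ.B (j + 1) := fun i hi => by
      by_contra hi'
      have := hτm i (Finset.mem_sdiff.2 ⟨hi, hi'⟩)
      omega
    have hj' : j + 1 < τ.N := by omega
    have heq := (hτc.base j le_rfl (by omega)).finset_eq_of_subset
      (hτc.base (j + 1) (by omega) hj') hsub
    have hc' := hτc.merge hj' heq
    have h4₁ : s₁.var 4 = j := by rw [hf₁.var 4 rfl]; simp [hs₀, h4]
    have hsucc : ((j : ℤ) + 1).toNat = j + 1 := by omega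
    have w1 := hτ.w j (by omega)
    have w2 := hτ.w (j + 1) hj'
    refine .write (fun _ => ?_) ⟨{ τ with w := Function.update τ.w (j + 1) (τ.w j + τ.w (j + 1)) },
      ?_, hτN, hc', hτy⟩
    · have h1 := hc'.weight_le le_rfl hj'
      have h2 := hc'.nonneg (j + 1) le_rfl hj'
      rw [Function.update_self] at h1 h2
      simp only [Expr.eval, h4₁, Int.toNat_natCast, hsucc, w1, w2]
      omega
    · refine ⟨hτ.card, hτ.N, hτ.B, fun l hl => ?_, hτ.z, hτ.θ⟩
      simp only [Expr.eval, h4₁, Int.toNat_natCast, hsucc, w1, w2, Memory.setArr_arr, true_and,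
        Function.update_apply]
      split_ifs
      · rfl
      · exact hτ.w l hl

theorem WP.swapRounding (hbd : Bounds n U L) (hf : IsSubmodular f) {σ : State (Fin n)}
    (hσ : Stores s σ) {D : ℤ} (hD : 0 < D) (hDU : D ≤ U) (hpos : 0 < σ.N)
    (hN : σ.N ≤ L) (hcomb : IsComb M D 0 σ.N σ.B σ.w σ.z)
    (hD4 : ∀ c : Fin n, s.arr 4 c = D) {R : Finset (Fin n)}
    (h11 : ∀ c : Fin n, s.arr 11 c = if c ∈ R then 0 else 1) {y : ℝ}
    (hy : y ≤ multilinearExtension f (maskOut R (scalePoint D σ.z))) :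
    WP f M U L .swapRounding s fun s' => ∃ σ' : State (Fin n), Stores s' σ' ∧
      0 < σ'.N ∧ s'.var 15 = (σ'.N - 1 : ℕ) ∧ IsComb M D (σ'.N - 1) σ'.N σ'.B σ'.w σ'.z ∧
      y ≤ multilinearExtension f (maskOut R (scalePoint D σ'.z)) := by
  have hLU := hbd.length_le_bound
  have e15 : Expr.eval s (.sub (.var 2) (.lit 1)) = (σ.N - 1 : ℕ) := by
    simp only [Expr.eval, hσ.N]
    omega
  refine .seq (.assign (fun _ => by rw [e15]; omega) ?_)
  rw [e15]
  refine .forRange (m := σ.N - 1) (fun m s' => ∃ τ : State (Fin n), Stores s' τ ∧ τ.N = σ.N ∧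
      IsComb M D m τ.N τ.B τ.w τ.z ∧
      y ≤ multilinearExtension f (maskOut R (scalePoint D τ.z)))
    (by simp) (by omega) (by omega) rfl rfl (by decide)
    ⟨σ, ⟨by simp [hσ.card], by simp [hσ.N], hσ.B, hσ.w, hσ.z, hσ.θ⟩, rfl, hcomb, hy⟩ ?_ ?_
  · rintro m hm s₁ hf₁ h4 ⟨τ, hτ, hτN, hτc, hτy⟩
    refine (WP.mergeNext hbd hf hτ hD hDU (by omega) (by omega) hτc h4
      (by rw [hf₁.arr 4 rfl]; exact hD4) (by rw [hf₁.arr 11 rfl]; exact h11) hτy).mono ?_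
    rintro s₂ - - ⟨τ', hτ', hN', hc', hy'⟩
    exact ⟨τ', ⟨by simp [hτ'.card], by simp [hτ'.N], hτ'.B, hτ'.w, hτ'.z, hτ'.θ⟩, hN'.trans hτN,
      hc', hy'⟩
  · rintro s₁ hf₁ - ⟨τ, hτ, hτN, hτc, hτy⟩
    refine ⟨τ, hτ, by omega, ?_, by rwa [hτN] at hτc ⊢, hτy⟩
    rw [hf₁.var 15 rfl, hτN]
    simp

end Specs

/-! ## The whole algorithm -/

/-- Write the remaining base, without the coordinates rounded to zero, into array 2. -/
def Program.output : Program :=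
  .forRange 3 0 (.write 2 (.var 3)
    (.mul (.arr 6 (.add (.mul (.var 15) (.var 0)) (.var 3))) (.arr 11 (.var 3))))

/-- The rounding algorithm. -/
def Program.rounding : Program :=
  .seq .startFlow (.seq .pushRelabel (.seq .roundUpOrZero (.seq .swapRounding .output)))

section Specs

variable {n : ℕ} {f : Finset (Fin n) → ℝ} {M : Matroid (Fin n)} {U L : ℕ} {s : Memory}

theorem WP.output (hbd : Bounds n U L) {σ : State (Fin n)} (hσ : Stores s σ) {D : ℤ} (hD : 0 < D)
    (hpos : 0 < σ.N) (h15 : s.var 15 = (σ.N - 1 : ℕ))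
    (hcomb : IsComb M D (σ.N - 1) σ.N σ.B σ.w σ.z) {R : Finset (Fin n)}
    (h11 : ∀ c : Fin n, s.arr 11 c = if c ∈ R then 0 else 1) :
    WP f M U L .output s fun s' => ∃ S : Set (Fin n), M.Indep S ∧
      outputPoint n s' = S.indicator 1 ∧ outputPoint n s' = maskOut R (scalePoint D σ.z) := by
  set B := σ.B (σ.N - 1) with hB
  refine .forRange (m := n) (fun m s' => ∀ c : Fin n, c.val < m →
      s'.arr 2 c = if c ∈ B \ R then 1 else 0)
    hσ.card hbd.card_le hbd.card_le_bound rfl rfl (by decide) (by simp) ?_ ?_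
  · intro m hm s₁ hf₁ h3 hI
    have eB : s₁.arr 6 ((σ.N - 1) * n + m) = if (⟨m, hm⟩ : Fin n) ∈ B then 1 else 0 := by
      rw [hf₁.arr 6 rfl]
      exact hσ.B (σ.N - 1) (by omega) ⟨m, hm⟩
    have e11 : s₁.arr 11 m = if (⟨m, hm⟩ : Fin n) ∈ R then 0 else 1 := by
      rw [hf₁.arr 11 rfl]
      exact h11 ⟨m, hm⟩
    have h15' : s₁.var 15 = (σ.N - 1 : ℕ) := by rw [hf₁.var 15 rfl, h15]
    have h0 : s₁.var 0 = n := by rw [hf₁.var 0 rfl, hσ.card]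
    have hev : Expr.eval s₁ (.mul (.arr 6 (.add (.mul (.var 15) (.var 0)) (.var 3)))
        (.arr 11 (.var 3))) = if (⟨m, hm⟩ : Fin n) ∈ B \ R then 1 else 0 := by
      simp only [Expr.eval, h15', h0, h3, Int.toNat_natCast_mul_add, Int.toNat_natCast, eB, e11,
        Finset.mem_sdiff]
      split_ifs <;> simp_all
    refine .write (fun _ => ?_) fun c hc => ?_
    · rw [hev]
      have := hbd.one_le
      split_ifs <;> simp [this]
    · rw [hev]
      by_cases hcm : c.val = m
      · obtain rfl : c = ⟨m, hm⟩ := Fin.ext hcm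
        simp [Expr.eval, h3]
      · simpa [Expr.eval, h3, hcm] using hI c (by omega)
  · intro s' _ _ hI
    have hsing : Finset.Ico (σ.N - 1) σ.N = {σ.N - 1} := by
      ext l
      simp only [Finset.mem_Ico, Finset.mem_singleton]
      omega
    -- A single base is left and carries the full weight, so `z / D` is its indicator vector.
    have hw : σ.w (σ.N - 1) = D := by
      have := hcomb.sum
      rwa [hsing, Finset.sum_singleton] at this
    have hz (c : Fin n) : σ.z c = if c ∈ B then D else 0 := by
      rw [hcomb.eq c, hsing, Finset.sum_singleton, hw]
    have hD' : (D : ℝ) ≠ 0 := by exact_mod_cast hD.ne'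
    refine ⟨(B \ R : Finset (Fin n)), (hcomb.base (σ.N - 1) le_rfl (by omega)).indep.subset
      (by simp [hB]), ?_, ?_⟩
    · funext c
      rw [outputPoint, hI c c.isLt]
      by_cases hc : c ∈ B \ R
      · rw [if_pos hc, Set.indicator_of_mem (by exact_mod_cast hc)]
        simp
      · rw [if_neg hc, Set.indicator_of_notMem (by exact_mod_cast hc)]
        simp
    · funext c
      rw [outputPoint, hI c c.isLt]
      simp only [maskOut, scalePoint, hz c, Finset.mem_sdiff]
      by_cases h1 : c ∈ R <;> by_cases h2 : c ∈ B <;> simp [h1, h2, hD']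

theorem WP.rounding (hbd : Bounds n U L) (hf : IsSubmodular f) (hn : s.var 0 = n) {p : Fin n → ℤ}
    {d : Fin n → ℕ} (hd : ∀ i, 0 < d i) (hp0 : ∀ i, 0 ≤ p i) (hpd : ∀ i, p i ≤ d i)
    (hs0 : ∀ i : Fin n, s.arr 0 i = p i) (hs1 : ∀ i : Fin n, s.arr 1 i = d i)
    (hs5 : ∀ i : Fin n, s.arr 5 i = 0) (hs6 : ∀ i : Fin n, s.arr 6 i = 0)
    {D : ℕ} (hD : D = ∏ i, d i) (hU : D ≤ U)
    (hrank : SatisfiesRank M D fun i => p i * (D / d i : ℤ))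
    (hL : 1 + ((n ^ 2 * (n + 1) + n) * (n ^ 2 + 1) + n ^ 2) ≤ L) :
    WP f M U L .rounding s fun s' => ∃ S : Set (Fin n), M.Indep S ∧
      outputPoint n s' = S.indicator 1 ∧
      multilinearExtension f (scalePoint D fun i => p i * (D / d i : ℤ)) ≤
        multilinearExtension f (outputPoint n s') := by
  set a : Fin n → ℤ := fun i => p i * (D / d i : ℤ) with ha
  have hDpos : (0 : ℤ) < D := by
    rw [hD]
    exact_mod_cast Finset.prod_pos fun i _ => hd i
  have hDU : (D : ℤ) ≤ U := by exact_mod_cast hU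
  refine .seq ((WP.startFlow hbd hn hd hp0 hpd hs0 hs1 hs5 hs6 hD hU).mono ?_)
  rintro s₁ - - ⟨B, hB, hσ₁, harr⟩
  have hinv := State.inv_single hDpos.le hB a
  have hpot := (State.single (D : ℤ) B).potential_le (a := a) rfl
  rw [Fintype.card_fin] at hpot
  have hK : (State.single (D : ℤ) B).N + (State.single (D : ℤ) B).potential a ≤ L := by
    change 1 + _ ≤ L
    omega
  refine .seq ((WP.pushRelabel hbd hσ₁ (fun i => (harr i).1) hinv hrank hDU hK le_rfl).mono ?_)
  rintro s₂ hf₂ - ⟨σ, hσ, hσi, hσN, hge⟩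
  have hD4 (c : Fin n) : s₂.arr 4 c = D := by rw [hf₂.arr 4 rfl]; exact (harr c).2.2
  refine .seq ((WP.roundUpOrZero (f := f) hbd hσ hDpos (a := a)
    (fun i => mul_nonneg (hp0 i) (by positivity)) hge hσi.comb.point_le
    (fun i => by rw [hf₂.arr 3 rfl]; exact (harr i).1)
    (fun i => by rw [hf₂.arr 10 rfl]; exact (harr i).2.1) hD4).mono ?_)
  rintro s₃ hf₃ - ⟨R, h11, hle⟩
  have hσ₃ : Stores s₃ σ := hσ.of_frame hf₃ rfl rfl rfl rfl rfl rfl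
  refine .seq ((WP.swapRounding hbd hf hσ₃ hDpos hDU hσi.pos hσN hσi.comb
    (fun c => by rw [hf₃.arr 4 rfl]; exact hD4 c) h11 hle).mono ?_)
  rintro s₄ hf₄ - ⟨τ, hτ, hτpos, h15, hτc, hτle⟩
  refine (WP.output hbd hτ hDpos hτpos h15 hτc
    (fun c => by rw [hf₄.arr 11 rfl]; exact h11 c)).mono ?_
  rintro s₅ - - ⟨S, hS, hout, hout'⟩
  exact ⟨S, hS, hout, hout' ▸ hτle⟩

end Specs

/-! ## Input and output -/

theorem matroidPolytope_subset_Icc {X : Type*} (M : Matroid X) :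
    matroidPolytope M ⊆ Set.Icc (0 : X → ℝ) 1 := by
  classical
  refine convexHull_min ?_ (convex_Icc _ _)
  rintro _ ⟨S, -, rfl⟩
  refine ⟨fun i => ?_, fun i => ?_⟩ <;> by_cases hi : i ∈ S <;> simp [hi]

/-- A linear inequality that holds for the generating indicator vectors passes to their convex hull.
-/
theorem sum_le_of_mem_matroidPolytope {X : Type*} [Fintype X] [DecidableEq X] {M : Matroid X}
    {x : X → ℝ} (hx : x ∈ matroidPolytope M) {S : Finset X} {c : ℕ}
    (hc : ∀ I : Finset X, M.Indep I → (I ∩ S).card ≤ c) : ∑ i ∈ S, x i ≤ c := by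
  have hconv : Convex ℝ {y : X → ℝ | ∑ i ∈ S, y i ≤ c} := by
    refine convex_halfSpace_le (f := fun y : X → ℝ => ∑ i ∈ S, y i) ⟨fun y z => ?_, fun r y => ?_⟩ _
    · simp [Finset.sum_add_distrib]
    · simp [Finset.mul_sum]
  refine convexHull_min (s := {v : X → ℝ | ∃ S : Set X, M.Indep S ∧ v = S.indicator 1})
    ?_ hconv hx
  rintro _ ⟨I, hI, rfl⟩
  classical
  have h := hc I.toFinite.toFinset (by simpa using hI)
  have hsum : ∑ i ∈ S, I.indicator (1 : X → ℝ) i = ((I.toFinite.toFinset ∩ S).card : ℝ) := by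
    simp only [Set.indicator_apply, Pi.one_apply]
    rw [Finset.sum_ite, Finset.sum_const_zero, add_zero, Finset.sum_const, nsmul_eq_mul, mul_one]
    congr 2
    ext i
    simp [and_comm]
  rw [Set.mem_ofPred_eq, hsum]
  exact_mod_cast h

theorem scalePoint_commonDenominator {n : ℕ} (x : Fin n → ℚ) {D : ℕ} (hD : 0 < D)
    (hdvd : ∀ i, (x i).den ∣ D) :
    scalePoint (D : ℤ) (fun i => (x i).num * ((D : ℤ) / ((x i).den : ℤ))) =
      fun i => (x i : ℝ) := by
  funext i
  obtain ⟨e, he⟩ := hdvd i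
  have hden : (0 : ℤ) < (x i).den := by exact_mod_cast (x i).den_pos
  have h1 : (D : ℤ) / ((x i).den : ℤ) = e := by
    rw [he, Nat.cast_mul, Int.mul_ediv_cancel_left _ hden.ne']
  have he0 : (e : ℝ) ≠ 0 := by
    rintro h
    have : e = 0 := by exact_mod_cast h
    simp [this] at he
    omega
  have hden' : ((x i).den : ℝ) ≠ 0 := by exact_mod_cast (x i).den_nz
  simp only [scalePoint, h1]
  rw [Rat.cast_def, he]
  push_cast
  field_simp

/-- Apart from `0 ≤ x ≤ 1`, the algorithm uses membership in the polytope only in this form. -/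
theorem satisfiesRank_of_mem {n : ℕ} {M : Matroid (Fin n)} {a : Fin n → ℤ} {D : ℤ} (hD : 0 < D)
    (h : scalePoint D a ∈ matroidPolytope M) : SatisfiesRank M D a := by
  intro S c hc
  have h1 := sum_le_of_mem_matroidPolytope h hc
  have hD' : (0 : ℝ) < D := by exact_mod_cast hD
  simp only [scalePoint] at h1
  rw [← Finset.sum_div, div_le_iff₀ hD'] at h1
  have h2 : (∑ i ∈ S, (a i : ℝ)) ≤ D * c := by linarith
  exact_mod_cast h2

theorem prod_den_le_two_pow {n : ℕ} (x : Fin n → ℚ) :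
    ∏ i, (x i).den ≤ 2 ^ ∑ i, ratLength (x i) := by
  rw [← Finset.prod_pow_eq_pow_sum]
  refine Finset.prod_le_prod' fun i _ => (Nat.lt_size_self _).le.trans ?_
  refine Nat.pow_le_pow_right (by norm_num) ?_
  simp only [ratLength, bitLength, Int.natAbs_natCast]
  omega

/-! ### Choice of the bounds `U` and `L` -/

theorem mul_self_lt_two_pow (m : ℕ) : (m + 20) * (m + 20) < 2 ^ (m + 17) := by
  induction m with
  | zero => norm_num
  | succ m ih =>
    rw [show m + 1 + 17 = m + 17 + 1 by omega, pow_succ]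
    nlinarith

/-- A bound for the number of rounds and the binary lengths in the rounding algorithm. -/
noncomputable def lengthBound : Polynomial ℕ :=
  1 + ((Polynomial.X ^ 2 * (Polynomial.X + 1) + Polynomial.X) * (Polynomial.X ^ 2 + 1) +
    Polynomial.X ^ 2) + Polynomial.X + 20

theorem lengthBound_eval (l : ℕ) :
    lengthBound.eval l = 1 + ((l ^ 2 * (l + 1) + l) * (l ^ 2 + 1) + l ^ 2) + l + 20 := by
  simp [lengthBound]

/-- The requirements are circular: `U` must exceed `L * (n + 1)` while `L` must exceed the binary
length of `U`. The summand 20 in `lengthBound` gives room: with `L = m + 20`, both `D` and `L * (n +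
1)` are at most `2 ^ (m + 17)`. -/
theorem bounds_lengthBound {n l D : ℕ} (hn : n ≤ l) (hD : D ≤ 2 ^ l) :
    Bounds n (D + lengthBound.eval l * (n + 1)) (lengthBound.eval l) := by
  have hL := lengthBound_eval l
  generalize lengthBound.eval l = L at *
  have h1 : l + 21 ≤ L := by omega
  refine ⟨?_, Nat.le_add_left _ _, by omega⟩
  obtain ⟨m, rfl⟩ : ∃ m, L = m + 20 := ⟨L - 20, by omega⟩
  rw [Nat.succ_le_succ_iff, Nat.size_le]
  have h2 := mul_self_lt_two_pow m
  have h3 : (m + 20) * (n + 1) ≤ (m + 20) * (m + 20) := Nat.mul_le_mul_left _ (by omega)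
  have h4 : 2 ^ l ≤ 2 ^ (m + 17) := Nat.pow_le_pow_right (by norm_num) (by omega)
  have h5 : 2 ^ (m + 17) + 2 ^ (m + 17) = 2 ^ (m + 18) := by ring
  have h6 : 2 ^ (m + 18) ≤ 2 ^ (m + 19) := Nat.pow_le_pow_right (by norm_num) (by omega)
  omega

/-- The time is polynomial in `L`, and `L` is polynomial in the input length, whence the composition
of polynomials. -/
theorem exists_exec_rounding {n : ℕ} {f : Finset (Fin n) → ℝ} {M : Matroid (Fin n)}
    {x : Fin n → ℚ} (hf : IsSubmodular f) (hx : (fun i => (x i : ℝ)) ∈ matroidPolytope M) :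
    ∃ (s' : Memory) (t : ℕ), Exec f M .rounding (inputMemory x) s' t ∧
      t ≤ (Program.rounding.bound.comp lengthBound).eval (inputLength x) ∧
      outputPoint n s' ∈ matroidPolytope M ∧ IsIntegralPoint (outputPoint n s') ∧
      multilinearExtension f (fun i => (x i : ℝ)) ≤ multilinearExtension f (outputPoint n s') := by
  have h01 := matroidPolytope_subset_Icc M hx
  have hx0 (i : Fin n) : 0 ≤ x i := by
    have h : (0 : ℝ) ≤ x i := h01.1 i
    exact_mod_cast h
  have hx1 (i : Fin n) : x i ≤ 1 := by
    have h : (x i : ℝ) ≤ 1 := h01.2 i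
    exact_mod_cast h
  have hnum0 (i : Fin n) : 0 ≤ (x i).num := Rat.num_nonneg.2 (hx0 i)
  have hnumden (i : Fin n) : (x i).num ≤ (x i).den := Rat.num_le_denom_iff.2 (hx1 i)
  set D := ∏ i, (x i).den with hD
  have hdvd (i : Fin n) : (x i).den ∣ D := Finset.dvd_prod_of_mem _ (Finset.mem_univ i)
  have hDpos : 0 < D := Finset.prod_pos fun i _ => (x i).den_pos
  have hpt := scalePoint_commonDenominator x hDpos hdvd
  have hl : n ≤ inputLength x := Nat.le_add_right _ _
  have hbd := bounds_lengthBound hl (D := D)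
    ((prod_den_le_two_pow x).trans (Nat.pow_le_pow_right (by norm_num) (Nat.le_add_left _ _)))
  have hLge : 1 + ((n ^ 2 * (n + 1) + n) * (n ^ 2 + 1) + n ^ 2) ≤
      lengthBound.eval (inputLength x) := by
    rw [lengthBound_eval]
    have : 1 + ((n ^ 2 * (n + 1) + n) * (n ^ 2 + 1) + n ^ 2) ≤
        1 + ((inputLength x ^ 2 * (inputLength x + 1) + inputLength x) * (inputLength x ^ 2 + 1) +
          inputLength x ^ 2) := by gcongr
    omega
  have hmem : (inputMemory x).Bounded (D + lengthBound.eval (inputLength x) * (n + 1)) := by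
    have hnU := hbd.card_le_bound
    refine ⟨fun v => ?_, fun k i => ?_⟩
    · simp only [inputMemory]
      split_ifs <;> simp [hnU]
    · simp only [inputMemory]
      split_ifs with hi h0 h1
      · have h2 := Nat.le_of_dvd hDpos (hdvd ⟨i, hi⟩)
        have h3 := hnum0 ⟨i, hi⟩
        have h4 := hnumden ⟨i, hi⟩
        omega
      · have h2 := Nat.le_of_dvd hDpos (hdvd ⟨i, hi⟩)
        simp only [Int.natAbs_natCast]
        omega
      · simp
      · simp
  obtain ⟨s', t, hexec, ht, -, S, hS, hout, hle⟩ := WP.rounding (M := M) (s := inputMemory x) hbd hf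
    (by simp [inputMemory]) (p := fun i => (x i).num) (d := fun i => (x i).den)
    (fun i => (x i).den_pos) hnum0 hnumden (fun i => by simp [inputMemory])
    (fun i => by simp [inputMemory]) (fun i => by simp [inputMemory])
    (fun i => by simp [inputMemory]) hD (Nat.le_add_right _ _)
    (satisfiesRank_of_mem (by exact_mod_cast hDpos) (by rw [hpt]; exact hx)) hLge hbd hmem
  refine ⟨s', t, hexec, by rwa [Polynomial.eval_comp], ?_, ?_, ?_⟩
  · rw [hout]
    exact indicator_mem_matroidPolytope hS
  · rw [hout]
    exact isIntegralPoint_indicator S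
  · rwa [hpt] at hle

theorem mainTheorem4 :
    (∀ (X : Type*) [Fintype X] [DecidableEq X] (f : Finset X → ℝ) (M : Matroid X),
      IsSubmodular f → M.E = Set.univ →
        (∀ x ∈ matroidPolytope M, ∃ x' ∈ matroidPolytope M, IsIntegralPoint x' ∧
          multilinearExtension f x ≤ multilinearExtension f x') ∧
        HasNoIntegralityGap (multilinearExtension f) (matroidPolytope M)) ∧
    (∃ (c : Program) (p : Polynomial ℕ),
      ∀ (n : ℕ) (f : Finset (Fin n) → ℝ) (M : Matroid (Fin n)) (x : Fin n → ℚ),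
        IsSubmodular f → M.E = Set.univ → (fun i => (x i : ℝ)) ∈ matroidPolytope M →
          ∃ (s' : Memory) (t : ℕ), Exec f M c (inputMemory x) s' t ∧
            t ≤ p.eval (inputLength x) ∧
            outputPoint n s' ∈ matroidPolytope M ∧
            IsIntegralPoint (outputPoint n s') ∧
            multilinearExtension f (fun i => (x i : ℝ)) ≤
              multilinearExtension f (outputPoint n s')) := by
  exact ⟨fun _ _ _ _ _ hf _ => ⟨fun _ hx => exists_integral_ge hf hx, hasNoIntegralityGap hf⟩,
    .rounding, Program.rounding.bound.comp lengthBound,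
    fun _ _ _ _ hf _ hx => exists_exec_rounding hf hx⟩
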